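/- **Setting.** Let $F$ be a nonarchimedean local field with ring of integers $\mathcal O$, maximal ideal $\mathfrak p$, residue field $\kappa$ of odd cardinality $q$, and normalized valuation $\mathrm{val}$; fix a uniformizer $\varpi$. Let $n\ge 2$ with $n\mid q-1$, put $\underline n=n$ if $n$ is odd and $\underline n=n/2$ if $n$ is even, and let $\mu_n$ be the group of $n$-th roots of unity in $\kappa$ (identified by reduction with the $n$-th roots of unity of $F$). The $n$-th Hilbert symbol is $(a,b)_n=\bar c^{\,(q-1)/n}\in\mu_n$ with $c=(-1)^{\mathrm{val}(a)\mathrm{val}(b)}a^{\mathrm{val}(b)}b^{-\mathrm{val}(a)}$. Let $\widetilde G$ be Kubota's cover of $\mathrm{GL}_2(F)$: the set $\mathrm{GL}_2(F)\times\mu_n$ with $(g_1,\zeta_1)(g_2,\zeta_2)=(g_1g_2,\beta'(g_1,g_2)\zeta_1\zeta_2)$, $$\beta'(g_1,g_2)=\Big(\frac{X(g_1g_2)}{X(g_1)},\frac{X(g_1g_2)}{X(g_2)\det g_1}\Big)_n,$$ where $X(g)$ is the lower left entry of $g$ if it is nonzero and the lower right entry otherwise; its subgroup over $\mathrm{SL}_2(F)$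 is Kubota's cover of $\mathrm{SL}_2(F)$. Write $\widetilde K,\widetilde K^1,\widetilde T,\widetilde T^1,\widetilde B$ for the inverse images in $\widetilde G$ of $\mathrm{GL}_2(\mathcal O)$, $\mathrm{SL}_2(\mathcal O)$, the diagonal tori of $\mathrm{GL}_2(F)$ and $\mathrm{SL}_2(F)$, and the upper triangular Borel subgroup of $\mathrm{GL}_2(F)$; put $\widetilde B^1=\widetilde B\cap p^{-1}(\mathrm{SL}_2(F))$, $p$ being the projection $\widetilde G\to\mathrm{GL}_2(F)$. For $j\ge 1$ let $K_j=\{g\in\mathrm{GL}_2(\mathcal O): g\equiv 1 \bmod \mathfrak p^j\}$ and $K^1_j=K_j\cap\mathrm{SL}_2(F)$, identified with the subgroups $K_j\times\{1\}$ and $K^1_j\times\{1\}$ of $\widetilde G$, which are normalized by $\widetilde K$. Let $A$ be the centralizer of $\widetilde T\cap\widetilde K$ in $\widetilde T$ and $A^1$ the centralizer of $\widetilde T^1\cap\widetilde K$ in $\widetilde T^1$. A character of the center of $\widetilde T$ or of $\widetilde T^1$ is *primitive mod $m$* if $m$ is the least positive integer such that the character is trivial on the intersection of that center with $K_m$. Fix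 a faithful character $\epsilon:\mu_n\to\mathbb C^\times$; a representation is *genuine* if $\mu_n$ acts by $\epsilon$. All representations are complex. Let $\rho$ be a genuine irreducible representation of $\widetilde T^1$ with central character $\chi$, primitive mod $m$, and let $\chi_0$ be any extension of $\chi$ to a character of $A^1$. For $0\le k<\underline n$ define a character of $\widetilde B^1\cap\widetilde K^1$ by $$\chi_k\Big(\begin{pmatrix}t&s\\0&t^{-1}\end{pmatrix},\zeta\Big)=\chi_0\big(\mathrm{diag}(t,t^{-1}),(\varpi,t)_n^{2k}\zeta\big).$$ Likewise, for a genuine irreducible representation $\rho'$ of $\widetilde T$ with central character $\chi'$, primitive mod the same $m$, an extension $\chi'_0$ of $\chi'$ to $A$, and $0\le i,j<n$, define a character of $\widetilde B\cap\widetilde K$ by $$\chi'_{i,j}\Big(\begin{pmatrix}a&s\\0&d\end{pmatrix},\zeta\Big)=\chi'_0\big(\mathrm{diag}(a,d),(\varpi,a)_n^{-j}(\varpi,d)_n^{-i}\zeta\big).$$ For $l>m$ set, with smooth unnormalized induction, $$\widetilde W_{k,l}=\big(\mathrm{Ind}_{\widetilde B^1\cap\widetilde K^1}^{\widetilde K^1}\chi_k\big)^{K^1_l}\Big/\big(\mathrm{Ind}_{\widetilde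 B^1\cap\widetilde K^1}^{\widetilde K^1}\chi_k\big)^{K^1_{l-1}},\qquad \widetilde W'_{i,j,l}=\big(\mathrm{Ind}_{\widetilde B\cap\widetilde K}^{\widetilde K}\chi'_{i,j}\big)^{K_l}\Big/\big(\mathrm{Ind}_{\widetilde B\cap\widetilde K}^{\widetilde K}\chi'_{i,j}\big)^{K_{l-1}},$$ which are representations of $\widetilde K^1$ and of $\widetilde K$ respectively. **Statement.** 1. For every $\rho',\chi',\chi'_0$ as above such that $\rho$ embeds in $\mathrm{Res}_{\widetilde T^1}\rho'$, and for all $0\le k<\underline n$ and $l>m$, there are $0\le i,j<n$ such that $\widetilde W'_{i,j,l}$ is an irreducible representation of $\widetilde K$ and $\widetilde W_{k,l}\cong\mathrm{Res}_{\widetilde K^1}\widetilde W'_{i,j,l}$. 2. For all $0\le k<\underline n$ and $l>m$, the representation $\widetilde W_{k,l}$ is a direct sum of two irreducible subrepresentations; and whenever $\widetilde W_{k,l}=\widetilde W^+_{k,l}\oplus\widetilde W^-_{k,l}$ with both summands irreducible, these are inequivalent, finite-dimensional, and of the same dimension. -/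

import Mathlib

namespace Kubota

set_option linter.unusedSimpArgs false
set_option linter.unusedSectionVars false

section Cocycle

variable {F M : Type*} [Field F] [CommGroup M]

open Matrix

theorem bottom_right_ne_zero (g : GL (Fin 2) F) (h : g 1 0 = 0) : g 1 1 ≠ 0 := by
  intro h1
  have := g.det.ne_zero
  simp [Matrix.GeneralLinearGroup.val_det_apply, Matrix.det_fin_two, h, h1] at this

open Classical in
/-- `X(g)`: the lower left entry of `g` if that is nonzero, and the lower right entry otherwise. -/
noncomputable def lead (g : GL (Fin 2) F) : Fˣ :=
  if h : g 1 0 = 0 then Units.mk0 (g 1 1) (bottom_right_ne_zero g h) else Units.mk0 (g 1 0) h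

theorem lead_of_ne {g : GL (Fin 2) F} (h : g 1 0 ≠ 0) : (lead g : F) = g 1 0 := by
  simp [lead, h]

theorem lead_of_eq {g : GL (Fin 2) F} (h : g 1 0 = 0) : (lead g : F) = g 1 1 := by
  simp [lead, h]

/-- Kubota's 2-cocycle on `GL₂(F)` for a bimultiplicative symbol `S = ( , )`:
`β'(g₁, g₂) = (X(g₁g₂) / X(g₁), X(g₁g₂) / (X(g₂) det g₁))`. On `SL₂(F)` it is
`β(g₁, g₂) = (X(g₁g₂) / X(g₁), X(g₁g₂) / X(g₂))`. If `g = dg(1, det g) p(g)`, then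
`β'(g₁, g₂) = β(p(g₁)^y, p(g₂)) v(y, p(g₁))` for `y = det g₂`, where `h^y` denotes
`dg(1, y)⁻¹ h dg(1, y)` and `v(y, h) = 1` if the lower left entry of `h` is nonzero and
`v(y, h) = (y, d)` with `d` the lower right entry otherwise; so `(y, (h, ζ)) ↦ (dg(1, y) h, ζ)`
identifies `Fˣ ⋉ S̃L₂(F)` with the cover of `GL₂(F)` defined by `β'`. -/
noncomputable def cocycle (S : Fˣ →* Fˣ →* M) (g₁ g₂ : GL (Fin 2) F) : M :=
  S (lead (g₁ * g₂) / lead g₁) (lead (g₁ * g₂) / (lead g₂ * g₁.det))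

theorem mul_bottom_left (g h : GL (Fin 2) F) :
    (g * h) 1 0 = g 1 0 * h 0 0 + g 1 1 * h 1 0 := by
  simp [Matrix.mul_apply, Fin.sum_univ_two]

theorem mul_bottom_right (g h : GL (Fin 2) F) :
    (g * h) 1 1 = g 1 0 * h 0 1 + g 1 1 * h 1 1 := by
  simp [Matrix.mul_apply, Fin.sum_univ_two]

theorem det_val (g : GL (Fin 2) F) :
    (g.det : F) = g 0 0 * g 1 1 - g 0 1 * g 1 0 := by
  simp [Matrix.GeneralLinearGroup.val_det_apply, Matrix.det_fin_two]

theorem symbol_neg (S : Fˣ →* Fˣ →* M) (hS : ∀ a b : Fˣ, (a : F) + b = 1 → S a b = 1) (a : Fˣ) :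
    S a (-a) = 1 := by
  by_cases ha : a = 1
  · simp [ha]
  have h1 : (1 : F) - a ≠ 0 := by
    intro h
    exact ha (Units.ext (by simpa using (sub_eq_zero.mp h).symm))
  have h2 : (1 : F) - (a : F)⁻¹ ≠ 0 := by
    intro h
    apply ha
    ext
    have := sub_eq_zero.mp h
    field_simp at this
    simpa using this
  have e : -a = Units.mk0 _ h1 * (Units.mk0 _ h2)⁻¹ := by
    ext
    simp
    field_simp
    have : (a : F) - 1 ≠ 0 := by intro h; apply h1; linear_combination -h
    field_simp
    ring
  have e1 : S a (Units.mk0 _ h1) = 1 := hS _ _ (by simp)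
  have e2 : S a⁻¹ (Units.mk0 _ h2) = 1 := hS _ _ (by simp)
  rw [e, map_mul, map_inv, e1]
  simpa using e2

theorem symbol_symm (S : Fˣ →* Fˣ →* M) (hS : ∀ a b : Fˣ, (a : F) + b = 1 → S a b = 1)
    (a b : Fˣ) : S b a = (S a b)⁻¹ := by
  have h := symbol_neg S hS (a * b)
  have h1 : -(a * b) = (-a) * b := by ext; simp
  have h2 : S b (-(a * b)) = S b (-b) * S b a := by
    rw [← map_mul]; congr 1; ext; simp [mul_comm]
  rw [map_mul, MonoidHom.mul_apply, h2, h1, map_mul, symbol_neg S hS, symbol_neg S hS, one_mul,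
    one_mul, mul_comm] at h
  exact eq_inv_of_mul_eq_one_left h

theorem symbol_self (S : Fˣ →* Fˣ →* M) (hS : ∀ a b : Fˣ, (a : F) + b = 1 → S a b = 1)
    (a : Fˣ) : S a a = S a (-1) := by
  have h := symbol_neg S hS a
  have : -a = (-1) * a := by simp
  rw [this, map_mul] at h
  have h2 : S a (-1) * S a (-1) = 1 := by rw [← map_mul]; simp
  rw [mul_comm] at h
  rw [eq_inv_of_mul_eq_one_left h, inv_eq_of_mul_eq_one_left h2]




theorem cocycle_auxE (S : Fˣ →* Fˣ →* M) (hS : ∀ a b : Fˣ, (a : F) + b = 1 → S a b = 1)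
    (D₁ D₂ x₁ x₂ x₃ x₁₂ x₂₃ x : Fˣ)
    (h : (x₁₂ * x₂₃ : F) = D₂ * x₁ * x₃ + x₂ * x) :
    S (x₁₂ / x₁) (x₁₂ / (x₂ * D₁)) * S (x / x₁₂) (x / (x₃ * (D₁ * D₂))) =
    S (x / x₁) (x / (x₂₃ * D₁)) * S (x₂₃ / x₂) (x₂₃ / (x₃ * D₂)) := by
  have k := congrArg Additive.ofMul (hS (D₂ * x₁ * x₃ / (x₁₂ * x₂₃)) (x₂ * x / (x₁₂ * x₂₃)) (by
    simp only [Units.val_div_eq_div_val, Units.val_mul]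
    rw [← add_div, ← h, div_self]
    simp))
  have sk := symbol_symm S hS
  have ss := symbol_self S hS
  have s2 : ∀ a, Additive.ofMul (S (-1) a) + Additive.ofMul (S (-1) a) = 0 := by
    intro a
    rw [← ofMul_mul, ← MonoidHom.mul_apply, ← map_mul]; simp
  generalize (-1 : Fˣ) = e at *
  apply Additive.ofMul.injective
  simp only [div_eq_mul_inv, mul_inv, map_mul, map_inv, MonoidHom.mul_apply, MonoidHom.inv_apply,
    inv_inv, sk D₂ D₁, sk x₁ D₁, sk x₂ D₁, sk x₃ D₁, sk x₁₂ D₁, sk x₂₃ D₁, sk x D₁, sk x₁ D₂,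
    sk x₂ D₂, sk x₃ D₂, sk x₁₂ D₂, sk x₂₃ D₂, sk x D₂, sk x₂ x₁, sk x₃ x₁, sk x₁₂ x₁,
    sk x₂₃ x₁, sk x x₁, sk x₃ x₂, sk x₁₂ x₂, sk x₂₃ x₂, sk x x₂, sk x₁₂ x₃, sk x₂₃ x₃,
    sk x x₃, sk x₂₃ x₁₂, sk x x₁₂, sk x x₂₃, ss D₁, sk e D₁, ss D₂, sk e D₂,
    ss x₁, sk e x₁, ss x₂, sk e x₂, ss x₃, sk e x₃, ss x₁₂, sk e x₁₂,
    ss x₂₃, sk e x₂₃, ss x, sk e x,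
    ofMul_mul, ofMul_inv, ofMul_one] at k ⊢
  have k' := congrArg₂ (fun a b => a + b) k (s2 x₂₃)
  simp only [add_zero] at k'
  rw [← sub_eq_zero, ← k']
  abel

theorem cocycle_auxA (S : Fˣ →* Fˣ →* M) (hS : ∀ a b : Fˣ, (a : F) + b = 1 → S a b = 1)
    (D₁ D₂ x₁ x₂ x₃ x₁₂ x₂₃ x : Fˣ)
    (h : x₁₂ = x₁ * x₂) (h' : x = x₁ * x₂₃) :
    S (x₁₂ / x₁) (x₁₂ / (x₂ * D₁)) * S (x / x₁₂) (x / (x₃ * (D₁ * D₂))) =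
    S (x / x₁) (x / (x₂₃ * D₁)) * S (x₂₃ / x₂) (x₂₃ / (x₃ * D₂)) := by
  have sk := symbol_symm S hS
  have ss := symbol_self S hS
  have s2 : ∀ a, Additive.ofMul (S (-1) a) + Additive.ofMul (S (-1) a) = 0 := by
    intro a
    rw [← ofMul_mul, ← MonoidHom.mul_apply, ← map_mul]; simp
  generalize (-1 : Fˣ) = e at *
  apply Additive.ofMul.injective
  subst h h'
  simp only [div_eq_mul_inv, mul_inv, map_mul, map_inv, MonoidHom.mul_apply, MonoidHom.inv_apply,
    inv_inv, sk D₂ D₁, sk x₁ D₁, sk x₂ D₁, sk x₃ D₁, sk x₂₃ D₁, sk x₁ D₂, sk x₂ D₂, sk x₃ D₂,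
    sk x₂₃ D₂, sk x₂ x₁, sk x₃ x₁, sk x₂₃ x₁, sk x₃ x₂, sk x₂₃ x₂, sk x₂₃ x₃, ss D₁,
    sk e D₁, ss D₂, sk e D₂, ss x₁, sk e x₁, ss x₂, sk e x₂, ss x₃,
    sk e x₃, ss x₂₃, sk e x₂₃,
    ofMul_mul, ofMul_inv, ofMul_one]
  abel

theorem cocycle_auxC (S : Fˣ →* Fˣ →* M) (hS : ∀ a b : Fˣ, (a : F) + b = 1 → S a b = 1)
    (D₁ D₂ x₁ x₂ x₃ x₁₂ x₂₃ x : Fˣ)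
    (h : x₁₂ = x₁ * D₂ / x₂) (h' : x₂₃ = x₂ * x₃) :
    S (x₁₂ / x₁) (x₁₂ / (x₂ * D₁)) * S (x / x₁₂) (x / (x₃ * (D₁ * D₂))) =
    S (x / x₁) (x / (x₂₃ * D₁)) * S (x₂₃ / x₂) (x₂₃ / (x₃ * D₂)) := by
  have sk := symbol_symm S hS
  have ss := symbol_self S hS
  have s2 : ∀ a, Additive.ofMul (S (-1) a) + Additive.ofMul (S (-1) a) = 0 := by
    intro a
    rw [← ofMul_mul, ← MonoidHom.mul_apply, ← map_mul]; simp
  generalize (-1 : Fˣ) = e at *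
  apply Additive.ofMul.injective
  subst h h'
  simp only [div_eq_mul_inv, mul_inv, map_mul, map_inv, MonoidHom.mul_apply, MonoidHom.inv_apply,
    inv_inv, sk D₂ D₁, sk x₁ D₁, sk x₂ D₁, sk x₃ D₁, sk x D₁, sk x₁ D₂, sk x₂ D₂, sk x₃ D₂,
    sk x D₂, sk x₂ x₁, sk x₃ x₁, sk x x₁, sk x₃ x₂, sk x x₂, sk x x₃, ss D₁,
    sk e D₁, ss D₂, sk e D₂, ss x₁, sk e x₁, ss x₂, sk e x₂, ss x₃,
    sk e x₃, ss x, sk e x,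
    ofMul_mul, ofMul_inv, ofMul_one]
  rw [← sub_eq_zero]
  have z : ∀ a, (2 : ℤ) • Additive.ofMul (S e a) = 0 := fun a => by rw [two_zsmul, s2]
  abel_nf
  simp [z]

theorem cocycle_auxD1 (S : Fˣ →* Fˣ →* M) (hS : ∀ a b : Fˣ, (a : F) + b = 1 → S a b = 1)
    (D₁ D₂ x₁ x₂ x₃ x₁₂ x₂₃ x : Fˣ)
    (h : x₁₂ = -1 * (x₁ * D₂ / x₂)) (h' : x = x₁₂ * x₃) :
    S (x₁₂ / x₁) (x₁₂ / (x₂ * D₁)) * S (x / x₁₂) (x / (x₃ * (D₁ * D₂))) =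
    S (x / x₁) (x / (x₂₃ * D₁)) * S (x₂₃ / x₂) (x₂₃ / (x₃ * D₂)) := by
  have sk := symbol_symm S hS
  have ss := symbol_self S hS
  have s2 : ∀ a, Additive.ofMul (S (-1) a) + Additive.ofMul (S (-1) a) = 0 := by
    intro a
    rw [← ofMul_mul, ← MonoidHom.mul_apply, ← map_mul]; simp
  generalize (-1 : Fˣ) = e at *
  apply Additive.ofMul.injective
  subst h'; subst h
  simp only [div_eq_mul_inv, mul_inv, map_mul, map_inv, MonoidHom.mul_apply, MonoidHom.inv_apply,
    inv_inv, sk D₂ D₁, sk x₁ D₁, sk x₂ D₁, sk x₃ D₁, sk x₂₃ D₁, sk x₁ D₂, sk x₂ D₂, sk x₃ D₂,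
    sk x₂₃ D₂, sk x₂ x₁, sk x₃ x₁, sk x₂₃ x₁, sk x₃ x₂, sk x₂₃ x₂, sk x₂₃ x₃, ss D₁,
    sk e D₁, ss D₂, sk e D₂, ss x₁, sk e x₁, ss x₂, sk e x₂, ss x₃,
    sk e x₃, ss x₂₃, sk e x₂₃,
    ofMul_mul, ofMul_inv, ofMul_one]
  rw [← sub_eq_zero]
  have z : ∀ a, (2 : ℤ) • Additive.ofMul (S e a) = 0 := fun a => by rw [two_zsmul, s2]
  abel_nf
  simp [z]

theorem cocycle_auxB (S : Fˣ →* Fˣ →* M) (hS : ∀ a b : Fˣ, (a : F) + b = 1 → S a b = 1)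
    (D₁ D₂ x₁ x₂ x₃ x₁₂ x₂₃ x t : Fˣ)
    (h : x₂₃ = x₂ * t) (h' : x = x₁₂ * t) :
    S (x₁₂ / x₁) (x₁₂ / (x₂ * D₁)) * S (x / x₁₂) (x / (x₃ * (D₁ * D₂))) =
    S (x / x₁) (x / (x₂₃ * D₁)) * S (x₂₃ / x₂) (x₂₃ / (x₃ * D₂)) := by
  have sk := symbol_symm S hS
  have ss := symbol_self S hS
  have s2 : ∀ a, Additive.ofMul (S (-1) a) + Additive.ofMul (S (-1) a) = 0 := by
    intro a
    rw [← ofMul_mul, ← MonoidHom.mul_apply, ← map_mul]; simp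
  generalize (-1 : Fˣ) = e at *
  apply Additive.ofMul.injective
  subst h h'
  simp only [div_eq_mul_inv, mul_inv, map_mul, map_inv, MonoidHom.mul_apply, MonoidHom.inv_apply,
    inv_inv, sk D₂ D₁, sk x₁ D₁, sk x₂ D₁, sk x₃ D₁, sk x₁₂ D₁, sk t D₁, sk x₁ D₂, sk x₂ D₂,
    sk x₃ D₂, sk x₁₂ D₂, sk t D₂, sk x₂ x₁, sk x₃ x₁, sk x₁₂ x₁, sk t x₁, sk x₃ x₂,
    sk x₁₂ x₂, sk t x₂, sk x₁₂ x₃, sk t x₃, sk t x₁₂, ss D₁, sk e D₁, ss D₂,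
    sk e D₂, ss x₁, sk e x₁, ss x₂, sk e x₂, ss x₃, sk e x₃, ss x₁₂,
    sk e x₁₂, ss t, sk e t,
    ofMul_mul, ofMul_inv, ofMul_one]
  abel

theorem cocycle_auxD2 (S : Fˣ →* Fˣ →* M) (hS : ∀ a b : Fˣ, (a : F) + b = 1 → S a b = 1)
    (D₁ D₂ x₁ x₂ x₃ x₁₂ x₂₃ x : Fˣ)
    (h : x = -1 * (x₁ * D₂ * x₃ / x₂)) :
    S (x₁₂ / x₁) (x₁₂ / (x₂ * D₁)) * S (x / x₁₂) (x / (x₃ * (D₁ * D₂))) =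
    S (x / x₁) (x / (x₂₃ * D₁)) * S (x₂₃ / x₂) (x₂₃ / (x₃ * D₂)) := by
  have sk := symbol_symm S hS
  have ss := symbol_self S hS
  have s2 : ∀ a, Additive.ofMul (S (-1) a) + Additive.ofMul (S (-1) a) = 0 := by
    intro a
    rw [← ofMul_mul, ← MonoidHom.mul_apply, ← map_mul]; simp
  generalize (-1 : Fˣ) = e at *
  apply Additive.ofMul.injective
  subst h
  simp only [div_eq_mul_inv, mul_inv, map_mul, map_inv, MonoidHom.mul_apply, MonoidHom.inv_apply,
    inv_inv, sk D₂ D₁, sk x₁ D₁, sk x₂ D₁, sk x₃ D₁, sk x₁₂ D₁, sk x₂₃ D₁, sk x₁ D₂, sk x₂ D₂,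
    sk x₃ D₂, sk x₁₂ D₂, sk x₂₃ D₂, sk x₂ x₁, sk x₃ x₁, sk x₁₂ x₁, sk x₂₃ x₁, sk x₃ x₂,
    sk x₁₂ x₂, sk x₂₃ x₂, sk x₁₂ x₃, sk x₂₃ x₃, sk x₂₃ x₁₂, ss D₁, sk e D₁, ss D₂,
    sk e D₂, ss x₁, sk e x₁, ss x₂, sk e x₂, ss x₃, sk e x₃, ss x₁₂,
    sk e x₁₂, ss x₂₃, sk e x₂₃,
    ofMul_mul, ofMul_inv, ofMul_one]
  rw [← sub_eq_zero]
  have z : ∀ a, (2 : ℤ) • Additive.ofMul (S e a) = 0 := fun a => by rw [two_zsmul, s2]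
  abel_nf
  simp [z]

theorem cocycle_auxD3 (S : Fˣ →* Fˣ →* M) (hS : ∀ a b : Fˣ, (a : F) + b = 1 → S a b = 1)
    (D₁ D₂ x₁ x₂ x₃ x₁₂ x₂₃ x : Fˣ)
    (h : x₂₃ = x₁ * D₂ * x₃ / x₁₂) :
    S (x₁₂ / x₁) (x₁₂ / (x₂ * D₁)) * S (x / x₁₂) (x / (x₃ * (D₁ * D₂))) =
    S (x / x₁) (x / (x₂₃ * D₁)) * S (x₂₃ / x₂) (x₂₃ / (x₃ * D₂)) := by
  have sk := symbol_symm S hS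
  have ss := symbol_self S hS
  have s2 : ∀ a, Additive.ofMul (S (-1) a) + Additive.ofMul (S (-1) a) = 0 := by
    intro a
    rw [← ofMul_mul, ← MonoidHom.mul_apply, ← map_mul]; simp
  generalize (-1 : Fˣ) = e at *
  apply Additive.ofMul.injective
  subst h
  simp only [div_eq_mul_inv, mul_inv, map_mul, map_inv, MonoidHom.mul_apply, MonoidHom.inv_apply,
    inv_inv, sk D₂ D₁, sk x₁ D₁, sk x₂ D₁, sk x₃ D₁, sk x₁₂ D₁, sk x D₁, sk x₁ D₂, sk x₂ D₂,
    sk x₃ D₂, sk x₁₂ D₂, sk x D₂, sk x₂ x₁, sk x₃ x₁, sk x₁₂ x₁, sk x x₁, sk x₃ x₂,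
    sk x₁₂ x₂, sk x x₂, sk x₁₂ x₃, sk x x₃, sk x x₁₂, ss D₁, sk e D₁, ss D₂,
    sk e D₂, ss x₁, sk e x₁, ss x₂, sk e x₂, ss x₃, sk e x₃, ss x₁₂,
    sk e x₁₂, ss x, sk e x,
    ofMul_mul, ofMul_inv, ofMul_one]
  rw [← sub_eq_zero]
  have z : ∀ a, (2 : ℤ) • Additive.ofMul (S e a) = 0 := fun a => by rw [two_zsmul, s2]
  abel_nf
  simp [z]



theorem cocycle_assoc (S : Fˣ →* Fˣ →* M) (hS : ∀ a b : Fˣ, (a : F) + b = 1 → S a b = 1)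
    (g₁ g₂ g₃ : GL (Fin 2) F) :
    cocycle S g₁ g₂ * cocycle S (g₁ * g₂) g₃ = cocycle S g₁ (g₂ * g₃) * cocycle S g₂ g₃ := by
  have d2 := det_val g₂
  have n2 := g₂.det.ne_zero
  have e12 := mul_bottom_left g₁ g₂
  have f12 := mul_bottom_right g₁ g₂
  have e23 := mul_bottom_left g₂ g₃
  have f23 := mul_bottom_right g₂ g₃
  have e := mul_bottom_left (g₁ * g₂) g₃
  have f := mul_bottom_right (g₁ * g₂) g₃
  rw [e12, f12] at e f
  simp only [cocycle, map_mul, ← mul_assoc g₁ g₂ g₃]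
  by_cases h1 : g₁ 1 0 = 0
  · have L : ∀ h, lead (g₁ * h) = lead g₁ * lead h := by
      intro h
      have a := mul_bottom_left g₁ h
      have b := mul_bottom_right g₁ h
      have n := bottom_right_ne_zero _ h1
      rw [h1, zero_mul, zero_add] at a b
      ext
      by_cases hh : h 1 0 = 0
      · rw [hh, mul_zero] at a
        rw [Units.val_mul, lead_of_eq a, lead_of_eq h1, lead_of_eq hh, b]
      · rw [Units.val_mul, lead_of_ne (by rw [a]; exact mul_ne_zero n hh), lead_of_eq h1,
          lead_of_ne hh, a]
    apply cocycle_auxA S hS _ _ _ _ _ _ _ _ (L _)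
    rw [mul_assoc, L]
  have l1 := lead_of_ne h1
  by_cases h2 : g₂ 1 0 = 0
  · have n := bottom_right_ne_zero _ h2
    have n' : g₂ 0 0 ≠ 0 := by
      intro h
      apply n2
      rw [d2, h2, h]; ring
    apply cocycle_auxC S hS
    · ext
      rw [h2, mul_zero, add_zero] at e12
      simp only [Units.val_mul, Units.val_div_eq_div_val]
      rw [lead_of_ne (by rw [e12]; exact mul_ne_zero h1 n'), l1, lead_of_eq h2, d2, e12, h2]
      field_simp
      ring
    · ext
      rw [h2, zero_mul, zero_add] at e23 f23
      rw [Units.val_mul, lead_of_eq h2]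
      by_cases h3 : g₃ 1 0 = 0
      · rw [h3, mul_zero] at e23
        rw [lead_of_eq h3, lead_of_eq e23, f23]
      · rw [lead_of_ne h3, lead_of_ne (by rw [e23]; exact mul_ne_zero n h3), e23]
  have l2 := lead_of_ne h2
  by_cases h12 : (g₁ * g₂) 1 0 = 0
  · have l12 := lead_of_eq h12
    have n12 := bottom_right_ne_zero _ h12
    apply cocycle_auxD1 S hS
    · ext
      simp only [Units.val_mul, Units.val_div_eq_div_val, Units.val_neg, Units.val_one]
      rw [l12, f12, l1, l2, d2]
      field_simp
      rw [h12] at e12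
      linear_combination (-(g₂ 1 1)) * e12
    · ext
      rw [Units.val_mul, l12]
      have a := mul_bottom_left (g₁ * g₂) g₃
      have b := mul_bottom_right (g₁ * g₂) g₃
      rw [h12, zero_mul, zero_add] at a b
      by_cases h3 : g₃ 1 0 = 0
      · rw [h3, mul_zero] at a
        rw [lead_of_eq h3, lead_of_eq a, b]
      · rw [lead_of_ne h3, lead_of_ne (by rw [a]; exact mul_ne_zero n12 h3), a]
  have l12 := lead_of_ne h12
  have a := mul_bottom_left (g₁ * g₂) g₃
  have b := mul_bottom_right (g₁ * g₂) g₃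
  by_cases h3 : g₃ 1 0 = 0
  · have n3 : g₃ 0 0 ≠ 0 := by
      intro h
      apply g₃.det.ne_zero
      rw [det_val, h3, h]; ring
    rw [h3, mul_zero, add_zero] at a e23
    apply cocycle_auxB S hS (t := Units.mk0 _ n3)
    · ext
      rw [Units.val_mul, lead_of_ne (by rw [e23]; exact mul_ne_zero h2 n3), e23, l2]; rfl
    · ext
      rw [Units.val_mul, lead_of_ne (by rw [a]; exact mul_ne_zero h12 n3), a, l12]; rfl
  have l3 := lead_of_ne h3
  have key : (g₁ * g₂) 1 0 * (g₂ * g₃) 1 0 =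
      g₂.det * g₁ 1 0 * g₃ 1 0 + g₂ 1 0 * (g₁ * g₂ * g₃) 1 0 := by
    rw [e, e12, e23, d2]; ring
  by_cases h23 : (g₂ * g₃) 1 0 = 0
  · rw [h23, mul_zero] at key
    have n : (g₁ * g₂ * g₃) 1 0 ≠ 0 := by
      intro h
      rw [h, mul_zero, add_zero] at key
      exact mul_ne_zero (mul_ne_zero n2 h1) h3 key.symm
    apply cocycle_auxD2 S hS
    ext
    simp only [Units.val_mul, Units.val_div_eq_div_val, Units.val_neg, Units.val_one]
    rw [lead_of_ne n, l1, l2, l3]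
    field_simp
    linear_combination -key
  have l23 := lead_of_ne h23
  by_cases h : (g₁ * g₂ * g₃) 1 0 = 0
  · rw [h, mul_zero, add_zero] at key
    apply cocycle_auxD3 S hS
    ext
    simp only [Units.val_mul, Units.val_div_eq_div_val]
    rw [l12, l1, l23, l3]
    field_simp
    linear_combination key
  · apply cocycle_auxE S hS
    rw [l12, l23, l1, l3, l2, lead_of_ne h, key]

theorem lead_one : lead (1 : GL (Fin 2) F) = 1 := by
  ext
  rw [lead_of_eq (by simp)]
  simp

theorem cocycle_one_left (S : Fˣ →* Fˣ →* M) (g : GL (Fin 2) F) : cocycle S 1 g = 1 := by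
  simp [cocycle, lead_one]

theorem cocycle_one_right (S : Fˣ →* Fˣ →* M) (g : GL (Fin 2) F) : cocycle S g 1 = 1 := by
  simp [cocycle, lead_one]

end Cocycle

section Valuation

open ValuativeRel

variable {F : Type*} [Field F] [ValuativeRel F] [TopologicalSpace F]
  [IsNonarchimedeanLocalField F]

/-- The normalized additive valuation `val : Fˣ → ℤ`; it takes the value `1` on uniformizers. -/
noncomputable def ord (x : Fˣ) : ℤ :=
  -WithZero.log (IsNonarchimedeanLocalField.valueGroupWithZeroIsoInt F (valuation F (x : F)))

theorem ord_mul (x y : Fˣ) : ord (x * y) = ord x + ord y := by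
  simp only [ord, Units.val_mul, map_mul]
  rw [WithZero.log_mul (by simp) (by simp)]
  ring

theorem ord_one : ord (1 : Fˣ) = 0 := by simp [ord]

theorem ord_inv (x : Fˣ) : ord x⁻¹ = -ord x := by
  have := ord_mul x x⁻¹
  rw [mul_inv_cancel, ord_one] at this
  omega

theorem ord_zpow (x : Fˣ) (n : ℤ) : ord (x ^ n) = n * ord x := by
  simp [ord, WithZero.log_zpow]

theorem ord_eq_zero_iff (x : Fˣ) : ord x = 0 ↔ valuation F (x : F) = 1 := by
  have h : ord x = 0 ↔
      IsNonarchimedeanLocalField.valueGroupWithZeroIsoInt F (valuation F (x : F)) = 1 := by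
    rw [ord, neg_eq_zero]
    constructor
    · intro h
      rw [← WithZero.exp_log (x := IsNonarchimedeanLocalField.valueGroupWithZeroIsoInt F
        (valuation F (x : F))) (by simp), h]
      simp
    · intro h; simp [h]
  rw [h]
  simp

theorem ord_pos_iff (x : Fˣ) : 0 < ord x ↔ valuation F (x : F) < 1 := by
  rw [ord, neg_pos, ← WithZero.log_one, WithZero.log_lt_log (by simp) (by simp),
    ← map_one (IsNonarchimedeanLocalField.valueGroupWithZeroIsoInt F)]
  exact map_lt_map_iff _

theorem ord_neg_one : ord (-1 : Fˣ) = 0 := by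
  rw [ord_eq_zero_iff]; simp

/-- A unit of the field of valuation zero, as a unit of the ring of integers. -/
def integerUnit (x : Fˣ) (hx : valuation F (x : F) = 1) : (𝒪[F])ˣ where
  val := ⟨x, hx.le⟩
  inv := ⟨(x⁻¹ : Fˣ), by
    have : valuation F ((x⁻¹ : Fˣ) : F) = 1 := by simp [hx]
    exact this.le⟩
  val_inv := by ext; simp
  inv_val := by ext; simp

/-- `c ↦ c̄`, the reduction of an element of valuation zero in `κˣ`. -/
noncomputable def reduction (x : Fˣ) (hx : ord x = 0) : (𝓀[F])ˣ :=
  Units.map (IsLocalRing.residue 𝒪[F]).toMonoidHom (integerUnit x ((ord_eq_zero_iff x).mp hx))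

theorem reduction_mul (x y : Fˣ) (hx : ord x = 0) (hy : ord y = 0) (hxy : ord (x * y) = 0) :
    reduction (x * y) hxy = reduction x hx * reduction y hy := by
  rw [reduction, reduction, reduction, ← map_mul]
  congr 1

/-- `c = (-1)^(val a * val b) * a^(val b) / b^(val a)`. -/
noncomputable def tameArg (a b : Fˣ) : Fˣ :=
  (-1) ^ (ord a * ord b) * a ^ ord b / b ^ ord a

theorem ord_tameArg (a b : Fˣ) : ord (tameArg a b) = 0 := by
  rw [tameArg, div_eq_mul_inv, ord_mul, ord_mul, ord_inv, ord_zpow, ord_zpow, ord_zpow,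
    ord_neg_one]
  ring

theorem tameArg_mul_left (a a' b : Fˣ) : tameArg (a * a') b = tameArg a b * tameArg a' b := by
  simp only [tameArg, ord_mul, add_mul, zpow_add, mul_zpow, div_eq_mul_inv, mul_inv]
  simp only [mul_comm, mul_left_comm, mul_assoc]

theorem tameArg_mul_right (a b b' : Fˣ) : tameArg a (b * b') = tameArg a b * tameArg a b' := by
  simp only [tameArg, ord_mul, mul_add, zpow_add, mul_zpow, div_eq_mul_inv, mul_inv]
  simp only [mul_comm, mul_left_comm, mul_assoc]

variable (F) in
/-- `q`, the number of elements of the residue field. -/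
noncomputable abbrev resCard : ℕ := Nat.card 𝓀[F]

/-- `(a, b)_n = c̄ ^ ((q - 1) / n)`. The group `μ_n` of `n`-th roots of unity is taken inside the
residue field; for `n ∣ q - 1`, reduction identifies it with the `n`-th roots of unity of `F`. -/
noncomputable def hilbertSymbol (n : ℕ) (hn : n ∣ resCard F - 1) :
    Fˣ →* Fˣ →* rootsOfUnity n 𝓀[F] :=
  MonoidHom.mk' (fun a => MonoidHom.mk' (fun b =>
    ⟨reduction (tameArg a b) (ord_tameArg a b) ^ ((resCard F - 1) / n), by
      rw [mem_rootsOfUnity, ← pow_mul, Nat.div_mul_cancel hn, ← Nat.card_units, pow_card_eq_one']⟩)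
    (fun b b' => by
      ext1
      simp only [Subgroup.coe_mul, ← mul_pow]
      rw [← reduction_mul _ _ _ _ (by rw [ord_mul, ord_tameArg, ord_tameArg, add_zero])]
      congr 2
      exact tameArg_mul_right a b b'))
    (fun a a' => by
      ext1 b
      apply Subtype.ext
      simp only [MonoidHom.mk'_apply, MonoidHom.mul_apply, Subgroup.coe_mul, ← mul_pow]
      rw [← reduction_mul _ _ _ _ (by rw [ord_mul, ord_tameArg, ord_tameArg, add_zero])]
      congr 2
      exact tameArg_mul_left a a' b)

end Valuation

section Symbol

open ValuativeRel

variable {F : Type*} [Field F] [ValuativeRel F] [TopologicalSpace F]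
  [IsNonarchimedeanLocalField F]

theorem reduction_one (h : ord (1 : Fˣ) = 0) : reduction (1 : Fˣ) h = 1 := by
  ext
  exact map_one (IsLocalRing.residue 𝒪[F])

theorem reduction_congr {x y : Fˣ} (h : x = y) (hx : ord x = 0) (hy : ord y = 0) :
    reduction x hx = reduction y hy := by
  subst h; rfl

/-- Elements congruent to `1` modulo the maximal ideal. -/
def IsOneUnit (x : F) : Prop := valuation F (x - 1) < 1

theorem IsOneUnit.val_eq {x : F} (h : IsOneUnit x) : valuation F x = 1 := by
  have := Valuation.map_one_add_of_lt (valuation F) h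
  rwa [add_sub_cancel] at this

theorem IsOneUnit.reduction {x : Fˣ} (h : IsOneUnit (x : F)) (hx : ord x = 0) :
    reduction x hx = 1 := by
  ext
  change IsLocalRing.residue 𝒪[F] ⟨x, _⟩ = 1
  rw [← map_one (IsLocalRing.residue 𝒪[F]), ← sub_eq_zero, ← map_sub,
    IsLocalRing.residue_eq_zero_iff, IsLocalRing.mem_maximalIdeal, mem_nonunits_iff,
    Valuation.Integer.not_isUnit_iff_valuation_lt_one]
  exact h

theorem reduction_zpow_eq_one (x : Fˣ) (k : ℤ) (hx : ord x = 0) (h : reduction x hx = 1)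
    (hk : ord (x ^ k) = 0) : reduction (x ^ k) hk = 1 := by
  have key : ∀ m : ℕ, ∀ hm : ord (x ^ m) = 0, reduction (x ^ m) hm = 1 := by
    intro m
    induction m with
    | zero => intro hm; rw [reduction_congr (pow_zero x) hm ord_one, reduction_one]
    | succ m ih =>
      intro hm
      have h' : ord (x ^ m) = 0 := by
        have := ord_zpow x m
        rw [zpow_natCast] at this
        rw [this, hx, mul_zero]
      rw [reduction_congr (pow_succ x m) hm (by rwa [← pow_succ]),
        reduction_mul _ _ h' hx, ih h', h, one_mul]
  obtain ⟨m, rfl | rfl⟩ := k.eq_nat_or_neg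
  · rw [reduction_congr (zpow_natCast x m) hk (by rwa [← zpow_natCast]), key]
  · have h' : ord (x ^ m) = 0 := by
      have := ord_zpow x m
      rw [zpow_natCast] at this
      rw [this, hx, mul_zero]
    have := reduction_mul (x ^ m) (x ^ (-(m : ℤ))) h' hk (by simp [ord_one])
    rw [reduction_congr (y := 1) (by simp) _ ord_one, reduction_one, key m h', one_mul] at this
    exact this.symm

variable {n : ℕ} (hn : n ∣ resCard F - 1)

theorem hilbertSymbol_eq_one_of (a b : Fˣ) (h : reduction (tameArg a b) (ord_tameArg a b) = 1) :
    hilbertSymbol n hn a b = 1 := by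
  apply Subtype.ext
  change reduction (tameArg a b) (ord_tameArg a b) ^ _ = 1
  rw [h, one_pow]

theorem hilbertSymbol_oneUnit_left (a b : Fˣ) (h : IsOneUnit (a : F)) :
    hilbertSymbol n hn a b = 1 := by
  have ha : ord a = 0 := (ord_eq_zero_iff a).mpr h.val_eq
  apply hilbertSymbol_eq_one_of
  have e : tameArg a b = a ^ ord b := by simp [tameArg, ha]
  rw [reduction_congr e _ (by rw [ord_zpow, ha, mul_zero])]
  exact reduction_zpow_eq_one _ _ ha (h.reduction ha) _

theorem hilbertSymbol_oneUnit_right (a b : Fˣ) (h : IsOneUnit (b : F)) :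
    hilbertSymbol n hn a b = 1 := by
  have hb : ord b = 0 := (ord_eq_zero_iff b).mpr h.val_eq
  apply hilbertSymbol_eq_one_of
  have e : tameArg a b = b ^ (-ord a) := by simp [tameArg, hb]
  rw [reduction_congr e _ (by rw [ord_zpow, hb, mul_zero])]
  exact reduction_zpow_eq_one _ _ hb (h.reduction hb) _

theorem hilbertSymbol_units (a b : Fˣ) (ha : ord a = 0) (hb : ord b = 0) :
    hilbertSymbol n hn a b = 1 := by
  apply hilbertSymbol_eq_one_of
  have e : tameArg a b = 1 := by simp [tameArg, ha, hb]
  rw [reduction_congr e _ ord_one, reduction_one]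

theorem ord_eq_of_valuation_eq (a b : Fˣ) (h : valuation F (a : F) = valuation F (b : F)) :
    ord a = ord b := by
  rw [ord, ord, h]

theorem hilbertSymbol_steinberg (a b : Fˣ) (h : (a : F) + b = 1) :
    hilbertSymbol n hn a b = 1 := by
  have hb : (b : F) = 1 - a := by linear_combination h
  have ha' : (a : F) = 1 - b := by linear_combination h
  rcases lt_trichotomy (ord a) 0 with ha | ha | ha
  · have v : 0 < ord a⁻¹ := by rw [ord_inv]; omega
    rw [ord_pos_iff] at v
    have e1 : (b : F) = -a * (1 - (a⁻¹ : Fˣ)) := by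
      rw [hb, mul_sub]; simp; ring
    have o1 : IsOneUnit (1 - ((a⁻¹ : Fˣ) : F)) := by
      unfold IsOneUnit
      rwa [sub_sub_cancel_left, Valuation.map_neg]
    have vb : valuation F (b : F) = valuation F (a : F) := by
      rw [e1, map_mul, Valuation.map_neg, o1.val_eq, mul_one]
    have ob := ord_eq_of_valuation_eq _ _ vb
    have vb' : valuation F ((b⁻¹ : Fˣ) : F) < 1 := by
      rw [← ord_pos_iff, ord_inv, ob]; omega
    have o2 : IsOneUnit (((-1 * a / b : Fˣ)) : F) := by
      have : ((-1 * a / b : Fˣ) : F) = 1 - (b⁻¹ : Fˣ) := by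
        simp [ha']
        field_simp
      unfold IsOneUnit
      rwa [this, sub_sub_cancel_left, Valuation.map_neg]
    apply hilbertSymbol_eq_one_of
    have e : tameArg a b = (-1 * a / b) ^ ord a := by
      rw [tameArg, ob, div_zpow, mul_zpow]
      congr 2
      rw [zpow_mul]
      rcases Int.even_or_odd (ord a) with he | he
      · simp [he.neg_one_zpow]
      · simp [he.neg_one_zpow]
    have o3 := (ord_eq_zero_iff _).mpr o2.val_eq
    rw [reduction_congr e _ (by rw [ord_zpow, o3, mul_zero])]
    exact reduction_zpow_eq_one _ _ o3 (o2.reduction o3) _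
  · have hb0 : 0 ≤ ord b := by
      by_contra hlt
      push Not at hlt
      have v : 0 < ord b⁻¹ := by rw [ord_inv]; omega
      rw [ord_pos_iff] at v
      have e1 : (a : F) = -b * (1 - (b⁻¹ : Fˣ)) := by
        rw [ha', mul_sub]; simp; ring
      have o1 : IsOneUnit (1 - ((b⁻¹ : Fˣ) : F)) := by
        unfold IsOneUnit
        rwa [sub_sub_cancel_left, Valuation.map_neg]
      have vb : valuation F (a : F) = valuation F (b : F) := by
        rw [e1, map_mul, Valuation.map_neg, o1.val_eq, mul_one]
      have := ord_eq_of_valuation_eq _ _ vb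
      omega
    rcases hb0.eq_or_lt with hb0 | hb0
    · exact hilbertSymbol_units hn a b ha hb0.symm
    · apply hilbertSymbol_oneUnit_left
      unfold IsOneUnit
      rw [ord_pos_iff] at hb0
      rwa [ha', sub_sub_cancel_left, Valuation.map_neg]
  · apply hilbertSymbol_oneUnit_right
    unfold IsOneUnit
    rw [ord_pos_iff] at ha
    rwa [hb, sub_sub_cancel_left, Valuation.map_neg]

end Symbol

section Cover

open ValuativeRel Matrix

/-- The covering group `G̃` of `GL₂(F)`: the set `GL₂(F) × μ_n` with the multiplication
`(g₁, ζ₁) (g₂, ζ₂) = (g₁ g₂, β'(g₁, g₂) ζ₁ ζ₂)`. -/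
@[ext]
structure Cover (F : Type*) [Field F] [ValuativeRel F] [TopologicalSpace F]
    [IsNonarchimedeanLocalField F] (n : ℕ) (hn : n ∣ resCard F - 1) where
  mat : GL (Fin 2) F
  root : rootsOfUnity n 𝓀[F]

variable {F : Type*} [Field F] [ValuativeRel F] [TopologicalSpace F]
  [IsNonarchimedeanLocalField F] {n : ℕ} {hn : n ∣ resCard F - 1}

noncomputable instance : Mul (Cover F n hn) where
  mul x y := ⟨x.mat * y.mat, cocycle (hilbertSymbol n hn) x.mat y.mat * x.root * y.root⟩

noncomputable instance : One (Cover F n hn) where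
  one := ⟨1, 1⟩

noncomputable instance : Inv (Cover F n hn) where
  inv x := ⟨x.mat⁻¹, (cocycle (hilbertSymbol n hn) x.mat⁻¹ x.mat)⁻¹ * x.root⁻¹⟩

theorem Cover.mul_mat (x y : Cover F n hn) : (x * y).mat = x.mat * y.mat := rfl

theorem Cover.mul_root (x y : Cover F n hn) :
    (x * y).root = cocycle (hilbertSymbol n hn) x.mat y.mat * x.root * y.root := rfl

theorem Cover.one_mat : (1 : Cover F n hn).mat = 1 := rfl

theorem Cover.one_root : (1 : Cover F n hn).root = 1 := rfl

theorem Cover.inv_mat (x : Cover F n hn) : (x⁻¹).mat = x.mat⁻¹ := rfl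

theorem Cover.inv_root (x : Cover F n hn) :
    (x⁻¹).root = (cocycle (hilbertSymbol n hn) x.mat⁻¹ x.mat)⁻¹ * x.root⁻¹ := rfl

noncomputable instance : Group (Cover F n hn) :=
  Group.ofLeftAxioms
    (fun x y z => by
      ext1
      · simp only [Cover.mul_mat, mul_assoc]
      · have := cocycle_assoc (hilbertSymbol n hn) (hilbertSymbol_steinberg hn) x.mat y.mat z.mat
        simp only [Cover.mul_mat, Cover.mul_root]
        calc _ = (cocycle (hilbertSymbol n hn) x.mat y.mat *
              cocycle (hilbertSymbol n hn) (x.mat * y.mat) z.mat) *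
              (x.root * y.root * z.root) := by
              simp only [mul_comm, mul_left_comm, mul_assoc]
          _ = _ := by
              rw [this]
              simp only [mul_comm, mul_left_comm, mul_assoc])
    (fun x => by
      ext1
      · simp only [Cover.mul_mat, Cover.one_mat, one_mul]
      · simp only [Cover.mul_root, Cover.one_mat, Cover.one_root, cocycle_one_left, one_mul])
    (fun x => by
      ext1
      · simp only [Cover.mul_mat, Cover.inv_mat, Cover.one_mat, inv_mul_cancel]
      · simp only [Cover.mul_root, Cover.inv_mat, Cover.inv_root, Cover.one_root,
          mul_inv_cancel_left, inv_mul_cancel])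

/-- The projection `p : G̃ → GL₂(F)`. -/
noncomputable def Cover.proj : Cover F n hn →* GL (Fin 2) F where
  toFun := Cover.mat
  map_one' := rfl
  map_mul' _ _ := rfl

end Cover

section Subgroups

open ValuativeRel Matrix

variable (F : Type*) [Field F] [ValuativeRel F] [TopologicalSpace F]
  [IsNonarchimedeanLocalField F]

/-- `K = GL₂(𝒪)` inside `GL₂(F)`. -/
noncomputable def maxCompact : Subgroup (GL (Fin 2) F) :=
  (GeneralLinearGroup.map (𝒪[F]).subtype).range

/-- `K_j`: the elements of `GL₂(𝒪)` congruent to the identity modulo `𝔭 ^ j`. -/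
noncomputable def congruenceSubgroup (j : ℕ) : Subgroup (GL (Fin 2) F) :=
  (GeneralLinearGroup.map (Ideal.Quotient.mk (𝓂[F] ^ j))).ker.map
    (GeneralLinearGroup.map (𝒪[F]).subtype)

/-- `SL₂(F)` inside `GL₂(F)`. -/
def specialLinear : Subgroup (GL (Fin 2) F) := GeneralLinearGroup.det.ker

/-- `B`: upper triangular matrices. -/
def borel : Subgroup (GL (Fin 2) F) where
  carrier := {g | g 1 0 = 0}
  mul_mem' {g h} hg hh := by
    simp only [Set.mem_ofPred_eq] at *
    rw [mul_bottom_left, hg, hh]; ring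
  one_mem' := by simp
  inv_mem' {g} hg := by
    simp only [Set.mem_ofPred_eq] at *
    have h := mul_bottom_left g g⁻¹
    rw [mul_inv_cancel, hg, zero_mul, zero_add] at h
    simpa [bottom_right_ne_zero g hg] using h

/-- `T`: diagonal matrices. -/
def torus : Subgroup (GL (Fin 2) F) where
  carrier := {g | g 1 0 = 0 ∧ g 0 1 = 0}
  mul_mem' {g h} hg hh := by
    simp only [Set.mem_ofPred_eq] at *
    simp [Matrix.mul_apply, Fin.sum_univ_two, hg, hh]
  one_mem' := by simp
  inv_mem' {g} hg := by
    refine ⟨(borel F).inv_mem hg.1, ?_⟩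
    have h : (g * g⁻¹) 0 1 = g 0 0 * g⁻¹ 0 1 + g 0 1 * g⁻¹ 1 1 := by
      simp only [Units.val_mul, Matrix.mul_apply, Fin.sum_univ_two]
    rw [mul_inv_cancel, hg.2, zero_mul, add_zero] at h
    have n : g 0 0 ≠ 0 := by
      intro h0
      apply g.det.ne_zero
      rw [det_val, h0, hg.1]; ring
    simpa [n] using h

variable {F}

theorem congruenceSubgroup_le (j : ℕ) : congruenceSubgroup F j ≤ maxCompact F := by
  rintro _ ⟨u, -, rfl⟩
  exact ⟨u, rfl⟩

theorem congruenceSubgroup_anti {i j : ℕ} (h : i ≤ j) :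
    congruenceSubgroup F j ≤ congruenceSubgroup F i := by
  rintro _ ⟨u, hu, rfl⟩
  refine ⟨u, ?_, rfl⟩
  simp only [SetLike.mem_coe, MonoidHom.mem_ker] at hu ⊢
  ext a b
  have := congrArg (fun g : GL (Fin 2) (𝒪[F] ⧸ 𝓂[F] ^ j) => g a b) hu
  simp only [GeneralLinearGroup.map_apply] at this ⊢
  have h1 : ∀ k : ℕ, ((1 : GL (Fin 2) (𝒪[F] ⧸ 𝓂[F] ^ k)) a b) =
      Ideal.Quotient.mk (𝓂[F] ^ k) ((1 : Matrix (Fin 2) (Fin 2) 𝒪[F]) a b) := by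
    intro k
    simp only [Units.val_one, Matrix.one_apply]
    split_ifs <;> simp
  rw [h1, Ideal.Quotient.eq] at this ⊢
  exact Ideal.pow_le_pow_right h this

theorem conj_mem_congruenceSubgroup {j : ℕ} {g u : GL (Fin 2) F} (hg : g ∈ maxCompact F)
    (hu : u ∈ congruenceSubgroup F j) : g * u * g⁻¹ ∈ congruenceSubgroup F j := by
  obtain ⟨g, rfl⟩ := hg
  obtain ⟨u, hu, rfl⟩ := hu
  exact ⟨g * u * g⁻¹, (MonoidHom.normal_ker _).conj_mem _ hu _, by simp⟩

theorem valuation_le_of_mem {g : GL (Fin 2) F} (hg : g ∈ maxCompact F) (a b : Fin 2) :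
    valuation F (g a b) ≤ 1 := by
  obtain ⟨g, rfl⟩ := hg
  exact (g a b).2

theorem valuation_det_of_mem {g : GL (Fin 2) F} (hg : g ∈ maxCompact F) :
    ord g.det = 0 := by
  rw [ord_eq_zero_iff]
  apply le_antisymm
  · rw [det_val]
    refine (Valuation.map_sub _ _ _).trans (max_le ?_ ?_) <;> rw [map_mul] <;>
    exact mul_le_one' (valuation_le_of_mem hg _ _) (valuation_le_of_mem hg _ _)
  · have hg' := (maxCompact F).inv_mem hg
    have : valuation F ((g⁻¹).det : F) ≤ 1 := by
      rw [det_val]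
      refine (Valuation.map_sub _ _ _).trans (max_le ?_ ?_) <;> rw [map_mul] <;>
      exact mul_le_one' (valuation_le_of_mem hg' _ _) (valuation_le_of_mem hg' _ _)
    rw [map_inv, Units.val_inv_eq_inv_val, map_inv₀] at this
    exact (inv_le_one₀ (zero_lt_iff.mpr ((map_ne_zero _).mpr g.det.ne_zero))).mp this

theorem mem_maxCompact {g : GL (Fin 2) F} (h : ∀ a b, valuation F (g a b) ≤ 1)
    (hd : ord g.det = 0) : g ∈ maxCompact F := by
  rw [ord_eq_zero_iff] at hd
  let A : Matrix (Fin 2) (Fin 2) 𝒪[F] := fun a b => ⟨g a b, h a b⟩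
  have hA : IsUnit A.det := by
    apply Valuation.Integers.isUnit_of_one' (Valuation.integer.integers (valuation F))
    rw [← hd, det_val, Matrix.det_fin_two]
    rfl
  refine ⟨GeneralLinearGroup.mk'' A hA, ?_⟩
  ext a b
  rfl

theorem valuation_of_mem_congruence {u : GL (Fin 2) F} (hu : u ∈ congruenceSubgroup F 1)
    (a b : Fin 2) : valuation F (u a b - (1 : Matrix (Fin 2) (Fin 2) F) a b) < 1 := by
  obtain ⟨u, hu, rfl⟩ := hu
  simp only [SetLike.mem_coe, MonoidHom.mem_ker] at hu
  have := congrArg (fun g : GL (Fin 2) (𝒪[F] ⧸ 𝓂[F] ^ 1) => g a b) hu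
  simp only [GeneralLinearGroup.map_apply] at this
  have h1 : ((1 : GL (Fin 2) (𝒪[F] ⧸ 𝓂[F] ^ 1)) a b) =
      Ideal.Quotient.mk (𝓂[F] ^ 1) ((1 : Matrix (Fin 2) (Fin 2) 𝒪[F]) a b) := by
    simp only [Units.val_one, Matrix.one_apply]
    split_ifs <;> simp
  rw [h1, Ideal.Quotient.eq, pow_one, IsLocalRing.mem_maximalIdeal, mem_nonunits_iff,
    Valuation.Integer.not_isUnit_iff_valuation_lt_one] at this
  convert this using 2
  simp only [GeneralLinearGroup.map_apply, Matrix.one_apply, AddSubgroupClass.coe_sub]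
  split_ifs <;> rfl

theorem oneUnit_of_mem {u : GL (Fin 2) F} (hu : u ∈ congruenceSubgroup F 1) (a : Fin 2) :
    IsOneUnit (u a a) := by
  have := valuation_of_mem_congruence hu a a
  rwa [Matrix.one_apply_eq] at this

theorem valuation_offdiag_of_mem {u : GL (Fin 2) F} (hu : u ∈ congruenceSubgroup F 1)
    {a b : Fin 2} (hab : a ≠ b) : valuation F (u a b) < 1 := by
  have := valuation_of_mem_congruence hu a b
  rwa [Matrix.one_apply_ne hab, sub_zero] at this

theorem oneUnit_det_of_mem {u : GL (Fin 2) F} (hu : u ∈ congruenceSubgroup F 1) :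
    IsOneUnit (u.det : F) := by
  have h0 := oneUnit_of_mem hu 0
  have h1 := oneUnit_of_mem hu 1
  have h2 := valuation_offdiag_of_mem hu (a := 0) (b := 1) (by simp)
  have h3 := valuation_offdiag_of_mem hu (a := 1) (b := 0) (by simp)
  unfold IsOneUnit
  have e : (u.det : F) - 1 = u 0 0 * (u 1 1 - 1) + (u 0 0 - 1) - u 0 1 * u 1 0 := by
    rw [det_val]; ring
  rw [e]
  apply Valuation.map_sub_lt
  · apply Valuation.map_add_lt
    · rw [map_mul, h0.val_eq, one_mul]; exact h1
    · exact h0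
  · rw [map_mul]; exact mul_lt_one' h2 h3

variable {n : ℕ} (hn : n ∣ resCard F - 1)

theorem lead_mul_of_eq {g : GL (Fin 2) F} (h1 : g 1 0 = 0) (h : GL (Fin 2) F) :
    lead (g * h) = lead g * lead h := by
  have a := mul_bottom_left g h
  have b := mul_bottom_right g h
  have n := bottom_right_ne_zero _ h1
  rw [h1, zero_mul, zero_add] at a b
  ext
  by_cases hh : h 1 0 = 0
  · rw [hh, mul_zero] at a
    rw [Units.val_mul, lead_of_eq a, lead_of_eq h1, lead_of_eq hh, b]
  · rw [Units.val_mul, lead_of_ne (by rw [a]; exact mul_ne_zero n hh), lead_of_eq h1,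
      lead_of_ne hh, a]

set_option maxHeartbeats 1000000 in
theorem cocycle_congruence {u v : GL (Fin 2) F} (hu : u ∈ congruenceSubgroup F 1)
    (hv : v ∈ congruenceSubgroup F 1) : cocycle (hilbertSymbol n hn) u v = 1 := by
  have R := hilbertSymbol_oneUnit_right hn
  have L := hilbertSymbol_oneUnit_left hn
  have hS := hilbertSymbol_steinberg hn
  have duv := oneUnit_det_of_mem hu
  have u1 := oneUnit_of_mem hu 1
  have v0 := oneUnit_of_mem hv 0
  have huv := (congruenceSubgroup F 1).mul_mem hu hv
  have nu : u 1 1 ≠ 0 := by intro h; have := u1.val_eq; simp [h] at this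
  have nv : v 0 0 ≠ 0 := by intro h; have := v0.val_eq; simp [h] at this
  have e := mul_bottom_left u v
  unfold cocycle
  by_cases h1 : u 1 0 = 0
  · rw [lead_mul_of_eq h1]
    have : lead u * lead v / (lead v * u.det) = lead u / u.det := by
      rw [mul_comm, mul_div_mul_left_eq_div]
    rw [this, map_div, R _ _ duv, R _ (lead u) (by rw [lead_of_eq h1]; exact u1), one_div_one]
  have l1 := lead_of_ne h1
  by_cases h2 : v 1 0 = 0
  · rw [h2, mul_zero, add_zero] at e
    have : lead (u * v) / lead u = Units.mk0 _ nv := by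
      ext
      rw [Units.val_div_eq_div_val, lead_of_ne (by rw [e]; exact mul_ne_zero h1 nv), l1, e]
      field_simp
      rfl
    rw [this]
    exact L _ _ v0
  have l2 := lead_of_ne h2
  by_cases h3 : (u * v) 1 0 = 0
  · have l3 := lead_of_eq h3
    have r : IsOneUnit (lead (u * v) : F) := by rw [l3]; exact oneUnit_of_mem huv 1
    have key : ∀ x y z D : Fˣ, IsOneUnit (y : F) → IsOneUnit (D : F) →
        hilbertSymbol n hn (y / x) (y / (z * D)) = hilbertSymbol n hn x z := by
      intro x y z D hy hD
      rw [map_div (hilbertSymbol n hn) y x, MonoidHom.div_apply, L y _ hy,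
        map_div (hilbertSymbol n hn x), map_mul, R x y hy, R x D hD]
      simp
    rw [key _ _ _ _ r duv]
    have : lead v = (-lead u) * (Units.mk0 _ nv / Units.mk0 _ nu) := by
      ext
      rw [Units.val_mul, Units.val_neg, Units.val_div_eq_div_val, l1, l2, Units.val_mk0,
        Units.val_mk0]
      field_simp
      linear_combination e.symm.trans h3
    rw [this, map_mul, symbol_neg _ hS, map_div, R _ (Units.mk0 _ nv) v0,
      R _ (Units.mk0 _ nu) u1, one_div_one, one_mul]
  · have l3 := lead_of_ne h3
    obtain ⟨A, hA⟩ : ∃ A : Fˣ, A = lead (u * v) / (lead u * Units.mk0 _ nv) := ⟨_, rfl⟩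
    obtain ⟨B, hB⟩ : ∃ B : Fˣ, B = lead (u * v) / (lead v * Units.mk0 _ nu) := ⟨_, rfl⟩
    have e1 : lead (u * v) / lead u = A * Units.mk0 _ nv := by
      rw [hA, ← div_div, div_mul_cancel]
    have e2 : lead (u * v) / (lead v * u.det) = B * Units.mk0 _ nu / u.det := by
      rw [hB, ← div_div, ← div_div, div_mul_cancel]
    have s : hilbertSymbol n hn A⁻¹ B⁻¹ = 1 := by
      apply hS
      rw [hA, hB, inv_div, inv_div]
      simp only [Units.val_div_eq_div_val, Units.val_mul, Units.val_mk0]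
      rw [l1, l2, ← add_div, l3, e]
      rw [mul_comm (v 1 0) (u 1 1)]
      exact div_self (by rw [← e]; exact h3)
    simp only [map_inv, MonoidHom.inv_apply, inv_inv] at s
    have key : ∀ x y D : Fˣ, IsOneUnit (x : F) → IsOneUnit (y : F) → IsOneUnit (D : F) →
        hilbertSymbol n hn (A * x) (B * y / D) = hilbertSymbol n hn A B := by
      intro x y D hx hy hD
      rw [map_mul (hilbertSymbol n hn) A x, MonoidHom.mul_apply, L x _ hx, mul_one,
        map_div (hilbertSymbol n hn A), map_mul, R _ y hy, R _ D hD, mul_one, div_one]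
    rw [e1, e2, key _ _ _ v0 u1 duv, s]

/-- The lift `K_j × {1}` of `K_j` to the cover, for `j ≥ 1`. (For the unused index `j = 0` it is
the lift of `K_1`.) -/
noncomputable def congruenceLift (j : ℕ) : Subgroup (Cover F n hn) where
  carrier := {x | x.mat ∈ congruenceSubgroup F (max 1 j) ∧ x.root = 1}
  mul_mem' {x y} hx hy := by
    refine ⟨(congruenceSubgroup F _).mul_mem hx.1 hy.1, ?_⟩
    rw [Cover.mul_root, hx.2, hy.2, cocycle_congruence hn
      (congruenceSubgroup_anti (le_max_left 1 j) hx.1)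
      (congruenceSubgroup_anti (le_max_left 1 j) hy.1)]
    simp
  one_mem' := ⟨(congruenceSubgroup F _).one_mem, rfl⟩
  inv_mem' {x} hx := by
    have h := (congruenceSubgroup F _).inv_mem hx.1
    refine ⟨h, ?_⟩
    rw [Cover.inv_root, hx.2, cocycle_congruence hn
      (congruenceSubgroup_anti (le_max_left 1 j) h)
      (congruenceSubgroup_anti (le_max_left 1 j) hx.1)]
    simp

theorem congruenceLift_anti {i j : ℕ} (h : i ≤ j) :
    congruenceLift (F := F) hn j ≤ congruenceLift hn i := fun _ hx =>
  ⟨congruenceSubgroup_anti (max_le_max le_rfl h) hx.1, hx.2⟩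

/-- Conjugation by `x` preserves the lift of `K_1`. -/
def ConjGood (x : Cover F n hn) : Prop :=
  ∀ u ∈ congruenceSubgroup F 1, x * ⟨u, 1⟩ * x⁻¹ = ⟨x.mat * u * x.mat⁻¹, 1⟩

theorem conjGood_mul {x y : Cover F n hn} (hx : ConjGood hn x) (hy : ConjGood hn y)
    (hym : y.mat ∈ maxCompact F) : ConjGood hn (x * y) := by
  intro u hu
  have e : x * y * ⟨u, 1⟩ * (x * y)⁻¹ = x * (y * ⟨u, 1⟩ * y⁻¹) * x⁻¹ := by group
  rw [e, hy u hu, hx _ (conj_mem_congruenceSubgroup hym hu)]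
  simp [Cover.mul_mat, mul_assoc]

theorem conjGood_of_cocycle {x : Cover F n hn} (h : ∀ u ∈ congruenceSubgroup F 1,
    cocycle (hilbertSymbol n hn) x.mat u =
      cocycle (hilbertSymbol n hn) (x.mat * u * x.mat⁻¹) x.mat) : ConjGood hn x := by
  intro u hu
  rw [mul_inv_eq_iff_eq_mul]
  ext1
  · simp [Cover.mul_mat]
  · simp [Cover.mul_root, h u hu]

theorem conjGood_of_borel {x : Cover F n hn} (hx : x.mat ∈ maxCompact F)
    (h0 : x.mat 1 0 = 0) : ConjGood hn x := by
  apply conjGood_of_cocycle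
  intro u hu
  obtain ⟨g, ζ⟩ := x
  dsimp only at *
  have R := hilbertSymbol_oneUnit_right hn
  have L := hilbertSymbol_oneUnit_left hn
  have hS := hilbertSymbol_steinberg hn
  have n1 := bottom_right_ne_zero _ h0
  have n0 : g 0 0 ≠ 0 := by
    intro h
    apply g.det.ne_zero
    rw [det_val, h0, h]; ring
  have l0 := lead_of_eq h0
  have hu' := conj_mem_congruenceSubgroup hx hu
  set u' := g * u * g⁻¹ with hu'd
  have eu : u' * g = g * u := by rw [hu'd]; group
  have det' : u'.det = u.det := by
    rw [hu'd, map_mul, map_mul, map_inv]; rw [mul_comm g.det, mul_inv_cancel_right]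
  have du := oneUnit_det_of_mem hu
  have e1 : lead g * lead u / (lead u * g.det) = lead g / g.det := by
    rw [mul_comm, mul_div_mul_left_eq_div]
  have e2 : lead g * lead u / (lead g * u.det) = lead u / u.det := by
    rw [mul_div_mul_left_eq_div]
  have e3 : lead g * lead u / lead g = lead u := mul_div_cancel_left _ _
  unfold cocycle
  rw [eu, lead_mul_of_eq h0, det', e1, e2, e3, map_div (hilbertSymbol n hn _) (lead u),
    R _ _ du, div_one]
  have E := mul_bottom_left u' g
  rw [eu, mul_bottom_left, h0, zero_mul, zero_add, mul_zero, add_zero] at E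
  by_cases h : u 1 0 = 0
  · have h' : u' 1 0 = 0 := by
      rw [h, mul_zero] at E
      simpa [n0] using E.symm
    rw [L (lead u) _ (by rw [lead_of_eq h]; exact oneUnit_of_mem hu 1),
      R _ (lead u) (by rw [lead_of_eq h]; exact oneUnit_of_mem hu 1)]
  · have h' : u' 1 0 ≠ 0 := by
      intro h'
      rw [h', zero_mul] at E
      exact mul_ne_zero n1 h E
    have e4 : lead g * lead u / lead u' = Units.mk0 _ n0 := by
      ext
      rw [Units.val_div_eq_div_val, Units.val_mul, l0, lead_of_ne h, lead_of_ne h', E]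
      field_simp
      rfl
    have e5 : lead g / g.det = (Units.mk0 _ n0)⁻¹ := by
      ext
      rw [Units.val_div_eq_div_val, l0, det_val, h0, mul_zero, sub_zero]
      simp only [Units.val_inv_eq_inv_val, Units.val_mk0]
      field_simp
    rw [e4, e5, map_inv, symbol_symm _ hS (lead u) (Units.mk0 _ n0)]

/-- The matrix `w`. -/
def weyl : GL (Fin 2) F :=
  GeneralLinearGroup.mkOfDetNeZero !![0, 1; -1, 0] (by simp [Matrix.det_fin_two])

theorem conjGood_weyl : ConjGood hn (⟨weyl, 1⟩ : Cover F n hn) := by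
  apply conjGood_of_cocycle
  intro u hu
  have hw : (weyl : GL (Fin 2) F) ∈ maxCompact F := by
    apply mem_maxCompact
    · intro a b
      fin_cases a <;> fin_cases b <;> simp [weyl, GeneralLinearGroup.mkOfDetNeZero]
    · rw [ord_eq_zero_iff, det_val]
      simp [weyl, GeneralLinearGroup.mkOfDetNeZero]
  dsimp only
  have R := hilbertSymbol_oneUnit_right hn
  have L := hilbertSymbol_oneUnit_left hn
  have hu' := conj_mem_congruenceSubgroup hw hu
  set u' := (weyl : GL (Fin 2) F) * u * weyl⁻¹ with hu'd
  have eu : u' * weyl = weyl * u := by rw [hu'd]; group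
  have u0 := oneUnit_of_mem hu 0
  have n0 : u 0 0 ≠ 0 := by intro h; have := u0.val_eq; simp [h] at this
  have w10 : (weyl : GL (Fin 2) F) 1 0 = -1 := by
    simp [weyl, GeneralLinearGroup.mkOfDetNeZero]
  have w11 : (weyl : GL (Fin 2) F) 1 1 = 0 := by
    simp [weyl, GeneralLinearGroup.mkOfDetNeZero]
  have lw : lead (weyl : GL (Fin 2) F) = -1 := by
    ext; rw [lead_of_ne (by rw [w10]; simp), w10]; simp
  have E := mul_bottom_left weyl u
  rw [w10, w11, zero_mul, add_zero] at E
  have lu : lead (weyl * u) = -1 * Units.mk0 _ n0 := by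
    ext
    rw [lead_of_ne (by rw [E]; simp [n0]), E]
    simp
  unfold cocycle
  rw [eu, lu, lw, mul_div_cancel_left, mul_div_mul_left_eq_div, L (Units.mk0 _ n0) _ u0,
    map_div, R _ (Units.mk0 _ n0) u0, R _ _ (oneUnit_det_of_mem hu'), one_div_one]

theorem weyl_mem : (weyl : GL (Fin 2) F) ∈ maxCompact F := by
  apply mem_maxCompact
  · intro a b
    fin_cases a <;> fin_cases b <;> simp [weyl, GeneralLinearGroup.mkOfDetNeZero]
  · rw [ord_eq_zero_iff, det_val]
    simp [weyl, GeneralLinearGroup.mkOfDetNeZero]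

theorem weyl_mul_bottom_left (g : GL (Fin 2) F) :
    ((weyl : GL (Fin 2) F) * g) 1 0 = -g 0 0 := by
  rw [mul_bottom_left]
  simp [weyl, GeneralLinearGroup.mkOfDetNeZero]

theorem conjGood_inv {x : Cover F n hn} (hx : x.mat ∈ maxCompact F) (h : ConjGood hn x) :
    ConjGood hn x⁻¹ := by
  intro u hu
  have hu' := conj_mem_congruenceSubgroup ((maxCompact F).inv_mem hx) hu
  rw [Cover.inv_mat]
  have := h _ hu'
  rw [inv_inv] at this ⊢
  rw [show x.mat * (x.mat⁻¹ * u * x.mat) * x.mat⁻¹ = u by group] at this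
  rw [← this]
  group

theorem conjGood_of_unit {x : Cover F n hn} (hx : x.mat ∈ maxCompact F)
    (h : valuation F (x.mat 1 0) = 1) : ConjGood hn x := by
  have hc : x.mat 1 0 ≠ 0 := by intro h0; simp [h0] at h
  let t : F := -(x.mat 0 0 / x.mat 1 0)
  let y : Cover F n hn :=
    ⟨GeneralLinearGroup.mkOfDetNeZero !![1, t; 0, 1] (by simp [Matrix.det_fin_two]), 1⟩
  have y10 : y.mat 1 0 = 0 := by simp [y, GeneralLinearGroup.mkOfDetNeZero]
  have hy : y.mat ∈ maxCompact F := by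
    apply mem_maxCompact
    · have ht : valuation F t ≤ 1 := by
        simp only [t, Valuation.map_neg, map_div₀, h, div_one]
        exact valuation_le_of_mem hx _ _
      intro a b
      fin_cases a <;> fin_cases b <;> simp [y, GeneralLinearGroup.mkOfDetNeZero, ht]
    · rw [ord_eq_zero_iff, det_val]
      simp [y, GeneralLinearGroup.mkOfDetNeZero]
  let w : Cover F n hn := ⟨weyl, 1⟩
  have hw : w.mat ∈ maxCompact F := weyl_mem (F := F)
  have hz : (w * (y * x)).mat ∈ maxCompact F :=
    (maxCompact F).mul_mem hw ((maxCompact F).mul_mem hy hx)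
  have z10 : (w * (y * x)).mat 1 0 = 0 := by
    rw [Cover.mul_mat, weyl_mul_bottom_left, Cover.mul_mat]
    simp only [Units.val_mul, Matrix.mul_apply, Fin.sum_univ_two]
    simp only [y, t, GeneralLinearGroup.mkOfDetNeZero]
    simp
    field_simp
    simp
  have e : x = y⁻¹ * (w⁻¹ * (w * (y * x))) := by group
  rw [e]
  have gz := conjGood_of_borel hn hz z10
  have gw := conjGood_inv hn (x := w) hw (conjGood_weyl hn)
  have gy := conjGood_inv hn hy (conjGood_of_borel hn hy y10)
  exact conjGood_mul hn gy (conjGood_mul hn gw gz hz)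
    ((maxCompact F).mul_mem ((maxCompact F).inv_mem hw) hz)

theorem conjGood_of_mem {x : Cover F n hn} (hx : x.mat ∈ maxCompact F) : ConjGood hn x := by
  by_cases h : valuation F (x.mat 1 0) = 1
  · exact conjGood_of_unit hn hx h
  have h1 := lt_of_le_of_ne (valuation_le_of_mem hx 1 0) h
  have h0 : valuation F (x.mat 0 0) = 1 := by
    by_contra hne
    have h2 := lt_of_le_of_ne (valuation_le_of_mem hx 0 0) hne
    have := (ord_eq_zero_iff _).mp (valuation_det_of_mem hx)
    rw [det_val] at this
    apply absurd this
    apply ne_of_lt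
    apply Valuation.map_sub_lt <;> rw [map_mul]
    · exact mul_lt_one_of_lt_of_le h2 (valuation_le_of_mem hx _ _)
    · rw [mul_comm]; exact mul_lt_one_of_lt_of_le h1 (valuation_le_of_mem hx _ _)
  let w : Cover F n hn := ⟨weyl, 1⟩
  have hw : w.mat ∈ maxCompact F := weyl_mem (F := F)
  have hz : (w * x).mat ∈ maxCompact F := (maxCompact F).mul_mem hw hx
  have gz : ConjGood hn (w * x) := by
    apply conjGood_of_unit hn hz
    rw [Cover.mul_mat, weyl_mul_bottom_left, Valuation.map_neg, h0]
  have e : x = w⁻¹ * (w * x) := by group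
  rw [e]
  exact conjGood_mul hn (conjGood_inv hn (x := w) hw (conjGood_weyl hn)) gz hz

end Subgroups

section Representations

/-! Smooth induction and its level-`l` quotients, for a group `H` with a decreasing sequence
`U 1 ⊇ U 2 ⊇ ⋯` of normal subgroups (a neighbourhood basis of the identity). -/

variable {H : Type*} [Group H]

/-- The space of the smooth (unnormalized) induction `Ind_B^H χ`: functions with
`f (b g) = χ b f g` which are invariant under right translation by some `U j`, `j ≥ 1`. -/
def smoothInd (B : Subgroup H) (χ : B → ℂ) (U : ℕ → Subgroup H) (hU : Antitone U) :
    Submodule ℂ (H → ℂ) where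
  carrier := {f | (∀ (b : B) (g : H), f (b * g) = χ b * f g) ∧
    ∃ j, 1 ≤ j ∧ ∀ u ∈ U j, ∀ g : H, f (g * u) = f g}
  add_mem' {f f'} hf hf' := by
    obtain ⟨hf, j, hj, hfj⟩ := hf
    obtain ⟨hf', j', hj', hfj'⟩ := hf'
    refine ⟨fun b g => by simp [hf, hf', mul_add], max j j', le_max_of_le_left hj, ?_⟩
    intro u hu g
    simp [hfj u (hU (le_max_left j j') hu), hfj' u (hU (le_max_right j j') hu)]
  zero_mem' := ⟨fun b g => by simp, 1, le_rfl, fun u _ g => rfl⟩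
  smul_mem' c f hf := by
    obtain ⟨hf, j, hj, hfj⟩ := hf
    exact ⟨fun b g => by simp [hf]; ring, j, hj, fun u hu g => by simp [hfj u hu]⟩

/-- `H` acts on `Ind_B^H χ` by right translation. -/
def smoothIndRep (B : Subgroup H) (χ : B → ℂ) (U : ℕ → Subgroup H) (hU : Antitone U)
    (hN : ∀ j, (U j).Normal) : Representation ℂ H (smoothInd B χ U hU) where
  toFun h :=
    { toFun := fun f => ⟨fun g => f.1 (g * h), by
        obtain ⟨f, hf, j, hj, hfj⟩ := f
        refine ⟨fun b g => by simp [hf, mul_assoc], j, hj, fun u hu g => ?_⟩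
        have := hfj _ ((hN j).conj_mem u hu h⁻¹) (g * h)
        simpa [mul_assoc] using this⟩
      map_add' := fun _ _ => rfl
      map_smul' := fun _ _ => rfl }
  map_one' := by
    ext f g
    simp
  map_mul' h h' := by
    ext f g
    simp [mul_assoc]

variable {V : Type*} [AddCommGroup V] [Module ℂ V]

/-- The subrepresentation of vectors fixed by a normal subgroup `N`. -/
def fixedVectors (ρ : Representation ℂ H V) (N : Subgroup H) (hN : N.Normal) :
    Subrepresentation ρ where
  toSubmodule :=
    { carrier := {v | ∀ u ∈ N, ρ u v = v}
      add_mem' := fun {v w} hv hw u hu => by rw [map_add, hv u hu, hw u hu]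
      zero_mem' := fun u _ => map_zero _
      smul_mem' := fun c v hv u hu => by rw [map_smul, hv u hu] }
  apply_mem_toSubmodule h v hv u hu := by
    have := hv _ (hN.conj_mem u hu h⁻¹)
    rw [← Module.End.mul_apply, ← map_mul]
    conv_rhs => rw [← this]
    rw [← Module.End.mul_apply, ← map_mul]
    congr 2
    group

/-- The quotient `V^N / V^N'`, as a representation of `H`. -/
def fixedQuotient (ρ : Representation ℂ H V) (N N' : Subgroup H) (hN : N.Normal)
    (hN' : N'.Normal) :
    Representation ℂ H ((fixedVectors ρ N hN).toSubmodule ⧸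
      (fixedVectors ρ N' hN').toSubmodule.comap (fixedVectors ρ N hN).toSubmodule.subtype) :=
  (fixedVectors ρ N hN).toRepresentation.quotient _
    (fun h _ hv => (fixedVectors ρ N' hN').apply_mem_toSubmodule h hv)

end Representations

section Groups

open ValuativeRel Matrix

variable (F : Type*) [Field F] [ValuativeRel F] [TopologicalSpace F]
  [IsNonarchimedeanLocalField F] (n : ℕ) (hn : n ∣ resCard F - 1)

/-- `K̃`, the inverse image of `GL₂(𝒪)`. -/
noncomputable def coverK : Subgroup (Cover F n hn) := (maxCompact F).comap Cover.proj

/-- `K̃¹`, the inverse image of `SL₂(𝒪)`. On `SL₂(F)` the cocycle `β'` is Kubota's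
cocycle `β`, so the cover of `SL₂(F)` is the inverse image of `SL₂(F)` in `G̃`. -/
noncomputable def coverK1 : Subgroup (Cover F n hn) :=
  (maxCompact F ⊓ specialLinear F).comap Cover.proj

/-- `B̃`, the inverse image of the upper triangular Borel subgroup. -/
noncomputable def coverB : Subgroup (Cover F n hn) := (borel F).comap Cover.proj

/-- `T̃`, the inverse image of the diagonal torus of `GL₂(F)`. -/
noncomputable def coverT : Subgroup (Cover F n hn) := (torus F).comap Cover.proj

/-- `T̃¹`, the inverse image of the diagonal torus of `SL₂(F)`. -/
noncomputable def coverT1 : Subgroup (Cover F n hn) :=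
  (torus F ⊓ specialLinear F).comap Cover.proj

variable {F n}

theorem coverK1_le : coverK1 F n hn ≤ coverK F n hn := fun _ hx => hx.1

theorem coverT1_le : coverT1 F n hn ≤ coverT F n hn := fun _ hx => hx.1

variable {hn}

/-- The centralizer in `T` of `T ∩ K̃`: for `T = T̃` this is `A`, and for `T = T̃¹` it is
`A¹`. -/
noncomputable def torusA (T : Subgroup (Cover F n hn)) : Subgroup T :=
  Subgroup.centralizer ((coverK F n hn).subgroupOf T : Set T)

theorem center_le_torusA (T : Subgroup (Cover F n hn)) : Subgroup.center T ≤ torusA T :=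
  Subgroup.center_le_centralizer _

theorem ord_lead_of_torus {x : Cover F n hn} (hx : x ∈ coverT F n hn)
    (hK : x ∈ coverK F n hn) : ord (lead x.mat) = 0 := by
  have hT : x.mat 1 0 = 0 ∧ x.mat 0 1 = 0 := hx
  have hK : x.mat ∈ maxCompact F := hK
  have hd := (ord_eq_zero_iff _).mp (valuation_det_of_mem hK)
  rw [det_val, hT.1, mul_zero, sub_zero, map_mul] at hd
  rw [ord_eq_zero_iff, lead_of_eq hT.1]
  apply le_antisymm (valuation_le_of_mem hK _ _)
  rw [← hd]
  exact mul_le_of_le_one_left' (valuation_le_of_mem hK _ _)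

theorem cocycle_torus {x y : Cover F n hn} (hx : x ∈ coverT F n hn) (hy : y ∈ coverT F n hn)
    (hxK : x ∈ coverK F n hn) (hyK : y ∈ coverK F n hn) :
    cocycle (hilbertSymbol n hn) x.mat y.mat = 1 := by
  have hT : x.mat 1 0 = 0 ∧ x.mat 0 1 = 0 := hx
  have hd := valuation_det_of_mem (show x.mat ∈ maxCompact F from hxK)
  unfold cocycle
  rw [lead_mul_of_eq hT.1]
  have ox := ord_lead_of_torus hx hxK
  have oy := ord_lead_of_torus hy hyK
  apply hilbertSymbol_units
  · rw [mul_div_cancel_left]; exact oy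
  · rw [mul_comm, mul_div_mul_left_eq_div, div_eq_mul_inv, ord_mul, ord_inv, ox, hd]; rfl

theorem mem_torusA {T : Subgroup (Cover F n hn)} (hT : T ≤ coverT F n hn) (x : T)
    (hx : (x : Cover F n hn) ∈ coverK F n hn) : x ∈ torusA T := by
  rw [torusA, Subgroup.mem_centralizer_iff]
  intro y hy
  have hy : (y : Cover F n hn) ∈ coverK F n hn := hy
  apply Subtype.ext
  have tx := hT x.2
  have ty := hT y.2
  have mx : (x : Cover F n hn).mat 1 0 = 0 ∧ (x : Cover F n hn).mat 0 1 = 0 := tx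
  have my : (y : Cover F n hn).mat 1 0 = 0 ∧ (y : Cover F n hn).mat 0 1 = 0 := ty
  rw [Subgroup.coe_mul, Subgroup.coe_mul]
  ext1
  · rw [Cover.mul_mat, Cover.mul_mat]
    ext a b
    simp only [Units.val_mul, Matrix.mul_apply, Fin.sum_univ_two]
    fin_cases a <;> fin_cases b <;> simp [mx, my, mul_comm]
  · rw [Cover.mul_root, Cover.mul_root, cocycle_torus tx ty hx hy, cocycle_torus ty tx hy hx]
    simp [mul_comm]

theorem diag_ne_zero {g : GL (Fin 2) F} (h : g 1 0 = 0) (i : Fin 2) : g i i ≠ 0 := by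
  intro h0
  apply g.det.ne_zero
  rw [det_val, h]
  fin_cases i <;> simp at h0 <;> simp [h0]

/-- The `i`-th diagonal entry of an upper triangular invertible matrix. -/
noncomputable def diagEntry (g : GL (Fin 2) F) (h : g 1 0 = 0) (i : Fin 2) : Fˣ :=
  Units.mk0 (g i i) (diag_ne_zero h i)

/-- For `b = ((a s; 0 d), ζ)` in `B̃`, the element `(dg(a, d), η ζ)` of `T̃`. -/
noncomputable def diagPart (b : Cover F n hn) (h : b ∈ coverB F n hn) (η : rootsOfUnity n 𝓀[F]) :
    Cover F n hn :=
  ⟨GeneralLinearGroup.mkOfDetNeZero !![b.mat 0 0, 0; 0, b.mat 1 1] (by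
    rw [Matrix.det_fin_two]
    simpa using ⟨diag_ne_zero (g := b.mat) h 0, diag_ne_zero (g := b.mat) h 1⟩), η * b.root⟩

theorem diagPart_det (b : Cover F n hn) (h : b ∈ coverB F n hn) (η : rootsOfUnity n 𝓀[F]) :
    (diagPart b h η).mat.det = b.mat.det := by
  have h' : b.mat 1 0 = 0 := h
  ext
  rw [det_val, det_val, h']
  simp [diagPart, GeneralLinearGroup.mkOfDetNeZero]

theorem diagPart_mem_coverT (b : Cover F n hn) (h : b ∈ coverB F n hn)
    (η : rootsOfUnity n 𝓀[F]) : diagPart b h η ∈ coverT F n hn := by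
  constructor <;> simp [diagPart, GeneralLinearGroup.mkOfDetNeZero, Cover.proj]

theorem diagPart_mem_coverT1 (b : Cover F n hn) (h : b ∈ coverB F n hn)
    (h1 : b ∈ coverK1 F n hn) (η : rootsOfUnity n 𝓀[F]) :
    diagPart b h η ∈ coverT1 F n hn :=
  ⟨diagPart_mem_coverT b h η, (diagPart_det b h η).trans h1.2⟩

theorem diagPart_mem_coverK (b : Cover F n hn) (h : b ∈ coverB F n hn)
    (hK : b ∈ coverK F n hn) (η : rootsOfUnity n 𝓀[F]) : diagPart b h η ∈ coverK F n hn := by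
  have hK' : b.mat ∈ maxCompact F := hK
  apply mem_maxCompact
  · intro i j
    fin_cases i <;> fin_cases j <;>
      simp [diagPart, GeneralLinearGroup.mkOfDetNeZero, Cover.proj, valuation_le_of_mem hK']
  · exact (congrArg ord (diagPart_det b h η)).trans (valuation_det_of_mem hK')

/-- `K_j × {1}`, `j ≥ 1`, as a subgroup of `H`; for `H = K̃¹` this is `K¹_j × {1}`. -/
noncomputable def levelSubgroup (H : Subgroup (Cover F n hn)) (j : ℕ) : Subgroup H :=
  (congruenceLift hn j).subgroupOf H

theorem levelSubgroup_anti (H : Subgroup (Cover F n hn)) : Antitone (levelSubgroup H) :=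
  fun _ _ h _ hx => congruenceLift_anti hn h hx

theorem levelSubgroup_normal {H : Subgroup (Cover F n hn)} (hH : H ≤ coverK F n hn) (j : ℕ) :
    (levelSubgroup H j).Normal := by
  constructor
  intro u hu g
  have hg : (g : Cover F n hn).mat ∈ maxCompact F := hH g.2
  have hu : (u : Cover F n hn) ∈ congruenceLift hn j := hu
  change (g : Cover F n hn) * u * (g : Cover F n hn)⁻¹ ∈ congruenceLift hn j
  have e : (u : Cover F n hn) = ⟨(u : Cover F n hn).mat, 1⟩ := by ext1 <;> simp [hu.2]
  rw [e, conjGood_of_mem hn hg _ (congruenceSubgroup_anti (le_max_left 1 j) hu.1)]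
  exact ⟨conj_mem_congruenceSubgroup hg hu.1, rfl⟩

/-- The level-`l` quotient `(Ind χ)^{K_l} / (Ind χ)^{K_{l-1}}` of the smooth induction of `χ` from
`B̃ ∩ H` to `H`, for `H ⊆ K̃` and `l ≥ 2`. -/
noncomputable def levelQuotient {H : Subgroup (Cover F n hn)} (hH : H ≤ coverK F n hn)
    (χ : (coverB F n hn).subgroupOf H → ℂ) (l : ℕ) :=
  fixedQuotient
    (smoothIndRep ((coverB F n hn).subgroupOf H) χ (levelSubgroup H) (levelSubgroup_anti H)
      (levelSubgroup_normal hH))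
    (levelSubgroup H l) (levelSubgroup H (l - 1))
    (levelSubgroup_normal hH l) (levelSubgroup_normal hH (l - 1))

/-- The character `χ_k` on `B̃¹ ∩ K̃¹` (trivial on the unipotent radical):
`χ_k((t s; 0 t⁻¹), ζ) = χ₀(dg(t), (ϖ, t)_n ^ (2 k) ζ)`. -/
noncomputable def chiSL (ϖ : Fˣ) (χ₀ : torusA (coverT1 F n hn) →* ℂˣ) (k : ℕ)
    (b : (coverB F n hn).subgroupOf (coverK1 F n hn)) : ℂ :=
  let η := hilbertSymbol n hn ϖ (diagEntry b.1.1.mat b.2 0) ^ (2 * k)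
  χ₀ ⟨⟨diagPart b.1.1 b.2 η, diagPart_mem_coverT1 _ _ b.1.2 η⟩,
    mem_torusA (coverT1_le hn) _ (diagPart_mem_coverK _ b.2 (coverK1_le hn b.1.2) η)⟩

/-- The character `χ'_{i,j}` on `B̃ ∩ K̃` (trivial on the unipotent radical):
`χ'_{i,j}((a s; 0 d), ζ) = χ'₀(dg(a, d), (ϖ, a)_n ^ (-j) (ϖ, d)_n ^ (-i) ζ)`. -/
noncomputable def chiGL (ϖ : Fˣ) (χ₀' : torusA (coverT F n hn) →* ℂˣ) (i j : ℕ)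
    (b : (coverB F n hn).subgroupOf (coverK F n hn)) : ℂ :=
  let η := (hilbertSymbol n hn ϖ (diagEntry b.1.1.mat b.2 0) ^ j)⁻¹ *
    (hilbertSymbol n hn ϖ (diagEntry b.1.1.mat b.2 1) ^ i)⁻¹
  χ₀' ⟨⟨diagPart b.1.1 b.2 η, diagPart_mem_coverT _ _ η⟩,
    mem_torusA le_rfl _ (diagPart_mem_coverK _ b.2 b.1.2 η)⟩

/-- `W̃_{k,l}`, a representation of `K̃¹`. -/
noncomputable def WSL (ϖ : Fˣ) (χ₀ : torusA (coverT1 F n hn) →* ℂˣ) (k l : ℕ) :=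
  levelQuotient (coverK1_le hn) (chiSL ϖ χ₀ k) l

/-- `W̃'_{i,j,l}`, a representation of `K̃`. -/
noncomputable def WGL (ϖ : Fˣ) (χ₀' : torusA (coverT F n hn) →* ℂˣ) (i j l : ℕ) :=
  levelQuotient (le_refl (coverK F n hn)) (chiGL ϖ χ₀' i j) l

/-- The central subgroup `μ_n` acts by the character `ε`. -/
def IsGenuine {T : Subgroup (Cover F n hn)} {V : Type*} [AddCommGroup V] [Module ℂ V]
    (ε : rootsOfUnity n 𝓀[F] →* ℂˣ) (ρ : Representation ℂ T V) : Prop :=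
  ∀ x : T, (x : Cover F n hn).mat = 1 → ∀ v : V, ρ x v = (ε (x : Cover F n hn).root : ℂ) • v

/-- The center acts by the character `χ`. -/
def HasCentralCharacter {T : Subgroup (Cover F n hn)} {V : Type*} [AddCommGroup V] [Module ℂ V]
    (ρ : Representation ℂ T V) (χ : Subgroup.center T →* ℂˣ) : Prop :=
  ∀ (z : Subgroup.center T) (v : V), ρ z v = (χ z : ℂ) • v

/-- `χ₀` extends the central character `χ`. -/
def Extends {T : Subgroup (Cover F n hn)} (χ₀ : torusA T →* ℂˣ)
    (χ : Subgroup.center T →* ℂˣ) : Prop :=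
  χ₀.comp (Subgroup.inclusion (center_le_torusA T)) = χ

/-- `m` is the least positive integer such that `χ` is trivial on `Z(T) ∩ K_m`. -/
def IsPrimitiveMod {T : Subgroup (Cover F n hn)} (χ : Subgroup.center T →* ℂˣ) (m : ℕ) : Prop :=
  IsLeast {j : ℕ | 1 ≤ j ∧ ∀ z : Subgroup.center T,
    ((z : T) : Cover F n hn) ∈ congruenceLift hn j → χ z = 1} m

/-- `n` for odd `n`, and `n / 2` for even `n`. -/
def reducedDegree (n : ℕ) : ℕ := if Odd n then n else n / 2

end Groups

end Kubota

/-!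
Let `χ` be one of the characters inducing `W̃_{k,l}`, put `l = r + 1`, and let `L_j` be the space of
functions of level `j` on `K̃¹`: those with `f (b g) = χ b * f g` which are right invariant under
`K¹_j`. So `W̃ = L_{r+1} / L_r`. As `r ≥ m`, the character `χ` is trivial on the elements of `K_1`
whose diagonal entries are congruent to `1` modulo `𝔭 ^ r`, because their diagonal parts are central
in the torus (`isLevelChar_torusChar`). On the side of `SL₂`, nothing else is used of `χ` than this
and that it depends only on the diagonal entries and the root of unity (`IsLevelChar`).

For `x` in the residue field `κ` let `u(x)` be the lower unipotent element with entry `ϖ ^ r x̂`,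
for a lift `x̂` of `x`. The value `f (u(x) g)` for `f ∈ L_{r+1}` does not depend on the lift
(`apply_mul_eq_unip`), so with the quadratic character `η` of `κ` there is an intertwining operator
`T f (g) = ∑ η(x) f (u(x) g)`, `quadOp`. It kills `L_r`, and since the self-convolution of `η` is a
Jacobi sum, its square on `W̃` is the scalar `η(-1) q` (`quadOp_sq`). Let `δ` be the class of the
function supported on `B̃ K¹_l` which is `χ` on the Borel subgroup (`bump`). Then

* `δ` generates `W̃`: the translates of the bump function span `L_{r+1}` (`eq_sum_bump`);
* every nonzero subrepresentation of `W̃` contains a nonzero eigenvector of the Borel subgroup with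
  eigencharacter `χ`, obtained by averaging (`LevelOperators.exists_eigenvector`);
* those eigenvectors are the combinations of `δ` and `T δ`, which are linearly independent
  (`quadOp_eigen_span`, `quadOp_bump`). The point is that an eigenfunction in `L_{r+1}` is already
  invariant under `K¹_r` away from the coset of `1`, as one sees by extracting a square root of a
  one-unit, which exists for odd `q` (`apply_mul_of_not_inPow_bottom`).

These properties, collected in `SplitDatum`, imply that the intertwining operators of `W̃` are the
`a + b T`, and that `W̃` is the direct sum of the two eigenspaces of `T`, which are irreducible and
are the summands of any nontrivial decomposition. Conjugation by `diag(1, ν)` for a nonsquare unit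
`ν` induces an operator `J` of `W̃` which fixes `δ` and anticommutes with `T` (`conjOp_quadOp`). It
interchanges the eigenspaces, which therefore have the same dimension, and no proper nonzero
subrepresentation is stable under it (`SplitDatum.eq_top_of_stable`).

For `GL₂`, suppose that a character `χ'` of `B̃ ∩ K̃` extends `χ`. Since `K̃` is the product of
`B̃ ∩ K̃` and `K̃¹`, restriction of functions identifies the level quotient for `χ'` with `W̃`, and
`diag(1, ν)⁻¹` acts on it as a multiple of `J`; so it is irreducible (`levelQuotient_restrict`). It
remains to choose `χ'_{i,j}` extending `χ_k`. The quotient of `χ_k` by the restriction of `χ'_{0,0}`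
is trivial on the elements whose diagonal entries pair trivially with `ϖ`, since their diagonal
parts are central in both tori and `χ`, `χ'` agree there. So it is a power of the pairing with `ϖ`
composed with `ε`, and can be absorbed by `i`, with `j = 0` (`exists_chiGL_eq_chiSL`).
-/

/-! ### Splitting a representation by an intertwining operator with scalar square -/

namespace Kubota

section SplitDatum

variable {H W : Type*} [Group H] [AddCommGroup W] [Module ℂ W]

/-- `w` is an eigenvector of the subgroup `B` with eigencharacter `χ` (possibly `w = 0`). -/
def IsEigenvector (σ : Representation ℂ H W) (B : Subgroup H) (χ : B → ℂ) (w : W) : Prop :=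
  ∀ b : B, σ b w = χ b • w

/-- A representation `σ` of `H` generated by a `χ`-eigenvector `δ` of a subgroup `B`, all of whose
nonzero subrepresentations contain a `χ`-eigenvector, together with an intertwining operator `T`
with square `τ ^ 2 ≠ 0` such that `δ` and `T δ` form a basis of the space of `χ`-eigenvectors, and
an injective linear operator `J` (not intertwining) which fixes `δ` and anticommutes with `T`. -/
structure SplitDatum (σ : Representation ℂ H W) (B : Subgroup H) (χ : B → ℂ) where
  δ : W
  T : W →ₗ[ℂ] W
  J : W →ₗ[ℂ] W
  τ : ℂ
  τ_ne : τ ≠ 0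
  T_comm : ∀ h w, T (σ h w) = σ h (T w)
  T_sq : ∀ w, T (T w) = (τ * τ) • w
  T_δ : ∀ a : ℂ, T δ ≠ a • δ
  eigen_δ : IsEigenvector σ B χ δ
  cyclic : ∀ M : Subrepresentation σ, δ ∈ M.toSubmodule → M.toSubmodule = ⊤
  exists_eigen : ∀ M : Subrepresentation σ, M.toSubmodule ≠ ⊥ →
    ∃ w ∈ M.toSubmodule, w ≠ 0 ∧ IsEigenvector σ B χ w
  eigen_span : ∀ w, IsEigenvector σ B χ w → ∃ a b : ℂ, w = a • δ + b • T δ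
  J_T : ∀ w, J (T w) = -T (J w)
  J_δ : J δ = δ
  J_inj : Function.Injective J

namespace SplitDatum

variable {σ : Representation ℂ H W} {B : Subgroup H} {χ : B → ℂ} (D : SplitDatum σ B χ)

theorem δ_ne_zero : D.δ ≠ 0 := by
  intro h
  apply D.T_δ 0
  simp [h]

/-- Since `δ` is cyclic, an intertwining operator is determined by the eigenvector to which it
maps `δ`. -/
theorem endomorphism_eq (A : W →ₗ[ℂ] W) (hA : ∀ h w, A (σ h w) = σ h (A w)) :
    ∃ a b : ℂ, ∀ w, A w = a • w + b • D.T w := by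
  obtain ⟨a, b, hab⟩ := D.eigen_span (A D.δ) (fun x => by rw [← hA, D.eigen_δ x, map_smul])
  refine ⟨a, b, fun w => ?_⟩
  let M : Subrepresentation σ :=
    { toSubmodule := LinearMap.eqLocus A (a • LinearMap.id + b • D.T)
      apply_mem_toSubmodule := fun h v hv => by
        simp only [LinearMap.mem_eqLocus, LinearMap.add_apply, LinearMap.smul_apply,
          LinearMap.id_apply] at hv ⊢
        rw [hA, hv, D.T_comm, map_add, map_smul, map_smul] }
  have hM := D.cyclic M (by simpa [M] using hab)
  have : w ∈ M.toSubmodule := by rw [hM]; trivial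
  simpa [M] using this

/-- The eigenspace of `T` for the eigenvalue `s`. -/
def piece (s : ℂ) : Subrepresentation σ where
  toSubmodule := LinearMap.eqLocus D.T (s • LinearMap.id)
  apply_mem_toSubmodule h v hv := by
    simp only [LinearMap.mem_eqLocus, LinearMap.smul_apply, LinearMap.id_apply] at hv ⊢
    rw [D.T_comm, hv, map_smul]

theorem mem_piece {s : ℂ} {w : W} : w ∈ (D.piece s).toSubmodule ↔ D.T w = s • w := by
  simp [piece]

theorem add_mem_piece {s : ℂ} (hs : s * s = D.τ * D.τ) (w : W) :
    D.T w + s • w ∈ (D.piece s).toSubmodule := by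
  rw [mem_piece, map_add, D.T_sq, map_smul, smul_add, smul_smul, hs, add_comm]

theorem ne_zero_of_sq {s : ℂ} (hs : s * s = D.τ * D.τ) : s ≠ 0 := by
  rintro rfl
  simp [D.τ_ne] at hs

/-- A nonzero invariant subspace `M` of an eigenspace of `T` contains an eigenvector of `B`, hence
the projection `T δ + s δ` of `δ` to the eigenspace. As `δ` is cyclic, `T + s` maps all of `W` into
`M`; on the eigenspace it is multiplication by `2 s ≠ 0`. -/
theorem piece_isIrreducible {s : ℂ} (hs : s * s = D.τ * D.τ) :
    (D.piece s).toRepresentation.IsIrreducible := by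
  have hs0 := D.ne_zero_of_sq hs
  have hne : D.T D.δ + s • D.δ ≠ 0 := fun h => D.T_δ (-s) (by
    rw [neg_smul]; exact eq_neg_of_add_eq_zero_left h)
  refine { exists_pair_ne := ⟨⊥, ⊤, fun h => hne ?_⟩, eq_bot_or_eq_top := fun M => ?_ }
  · have h2 : (⟨_, D.add_mem_piece hs D.δ⟩ : (D.piece s).toSubmodule) ∈
        (⊤ : Subrepresentation (D.piece s).toRepresentation).toSubmodule := trivial
    rw [← h] at h2
    exact congrArg Subtype.val ((Submodule.mem_bot ℂ).mp h2)
  · by_cases hM : M.toSubmodule = ⊥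
    · exact Or.inl (Subrepresentation.toSubmodule_injective hM)
    right
    let M' : Subrepresentation σ :=
      { toSubmodule := M.toSubmodule.map (D.piece s).toSubmodule.subtype
        apply_mem_toSubmodule := by
          rintro h _ ⟨v, hv, rfl⟩
          exact ⟨_, M.apply_mem_toSubmodule h hv, rfl⟩ }
    have hM' : M'.toSubmodule ≠ ⊥ := by
      intro h
      refine hM (eq_bot_iff.mpr fun v hv => ?_)
      have hv' : (v : W) ∈ M'.toSubmodule := ⟨v, hv, rfl⟩
      rw [h] at hv'
      exact Subtype.ext ((Submodule.mem_bot ℂ).mp hv')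
    obtain ⟨w, hw, hw0, hwe⟩ := D.exists_eigen M' hM'
    obtain ⟨a, b, rfl⟩ := D.eigen_span w hwe
    have hT : D.T (a • D.δ + b • D.T D.δ) = s • (a • D.δ + b • D.T D.δ) := by
      obtain ⟨v, -, hv⟩ := hw
      rw [← hv]
      exact D.mem_piece.mp v.2
    rw [map_add, map_smul, map_smul, D.T_sq, ← hs] at hT
    -- `T w = s w` for `w = a δ + b T δ` forces `w = b (T δ + s δ)`
    have hab : a - s * b = 0 := by
      by_contra hd
      apply D.T_δ s
      have : (a - s * b) • D.T D.δ = (a - s * b) • s • D.δ := by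
        rw [← sub_eq_zero] at hT ⊢
        rw [← hT]
        module
      exact smul_right_injective W hd this
    have hb : b ≠ 0 := by
      rintro rfl
      rw [mul_zero, sub_zero] at hab
      simp [hab] at hw0
    have hv : D.T D.δ + s • D.δ ∈ M'.toSubmodule := by
      have := M'.toSubmodule.smul_mem b⁻¹ hw
      rw [sub_eq_zero.mp hab] at this
      convert this using 1
      rw [smul_add, smul_smul, smul_smul, inv_mul_cancel₀ hb, one_smul, add_comm]
      congr 2
      field_simp
    let N : Subrepresentation σ :=
      { toSubmodule := M'.toSubmodule.comap (D.T + s • LinearMap.id)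
        apply_mem_toSubmodule := fun h v hv => by
          simp only [Submodule.mem_comap, LinearMap.add_apply, LinearMap.smul_apply,
            LinearMap.id_apply] at hv ⊢
          have := M'.apply_mem_toSubmodule h hv
          rwa [map_add, map_smul, ← D.T_comm] at this }
    have hN := D.cyclic N (by simpa [N] using hv)
    apply Subrepresentation.toSubmodule_injective
    refine eq_top_iff.mpr fun w _ => ?_
    have h1 : (w : W) ∈ N.toSubmodule := by rw [hN]; trivial
    simp only [N, Submodule.mem_comap, LinearMap.add_apply, LinearMap.smul_apply,
      LinearMap.id_apply] at h1
    rw [D.mem_piece.mp w.2, ← add_smul] at h1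
    have h2 := M'.toSubmodule.smul_mem (s + s)⁻¹ h1
    rw [smul_smul, inv_mul_cancel₀ (by simpa using hs0), one_smul] at h2
    obtain ⟨v, hv, hvw⟩ := h2
    rwa [← Subtype.ext hvw]

theorem isCompl_pieces :
    IsCompl (D.piece D.τ).toSubmodule (D.piece (-D.τ)).toSubmodule := by
  have h2 : D.τ + D.τ ≠ 0 := by simpa using D.τ_ne
  rw [isCompl_iff, Submodule.disjoint_def, codisjoint_iff, eq_top_iff]
  constructor
  · intro w h h'
    rw [mem_piece] at h h'
    rw [h, ← sub_eq_zero, ← sub_smul, sub_neg_eq_add] at h'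
    exact (smul_eq_zero.mp h').resolve_left h2
  · intro w _
    have h1 := (D.piece D.τ).toSubmodule.smul_mem (D.τ + D.τ)⁻¹ (D.add_mem_piece rfl w)
    have h3 := (D.piece (-D.τ)).toSubmodule.smul_mem (-(D.τ + D.τ)⁻¹)
      (D.add_mem_piece (neg_mul_neg _ _) w)
    have := Submodule.add_mem_sup h1 h3
    convert this using 1
    rw [smul_add, smul_add, smul_smul, smul_smul]
    have : (D.τ + D.τ)⁻¹ * D.τ + -(D.τ + D.τ)⁻¹ * -D.τ = 1 := by
      rw [neg_mul_neg, ← mul_add, inv_mul_cancel₀ h2]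
    rw [neg_smul, add_add_add_comm, add_neg_cancel, zero_add, ← add_smul, this, one_smul]

/-- The two summands of a nontrivial invariant decomposition are the two eigenspaces of `T`: the
projection to one of them is an intertwining operator, hence a polynomial in `T`. -/
theorem eq_piece_of_isCompl {Wp Wm : Subrepresentation σ}
    (h : IsCompl Wp.toSubmodule Wm.toSubmodule) (hp : Wp.toSubmodule ≠ ⊥)
    (hm : Wm.toSubmodule ≠ ⊥) :
    ∃ s : ℂ, s ≠ 0 ∧ Wp.toSubmodule = (D.piece s).toSubmodule ∧
      Wm.toSubmodule = (D.piece (-s)).toSubmodule := by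
  let P : W →ₗ[ℂ] W := Wp.toSubmodule.projection Wm.toSubmodule h
  have Pp : ∀ w ∈ Wp.toSubmodule, P w = w := fun w hw =>
    Submodule.projection_apply_left h ⟨w, hw⟩
  have Pm : ∀ w ∈ Wm.toSubmodule, P w = 0 := fun w hw =>
    (Submodule.projection_apply_eq_zero_iff h).mpr hw
  have dec : ∀ w : W, ∃ p ∈ Wp.toSubmodule, ∃ m ∈ Wm.toSubmodule, p + m = w := fun w =>
    Submodule.mem_sup.mp (by rw [h.sup_eq_top]; trivial)
  have hP : ∀ x w, P (σ x w) = σ x (P w) := by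
    intro x w
    obtain ⟨p, hp, m, hm, rfl⟩ := dec w
    simp only [map_add]
    rw [Pp _ hp, Pm _ hm, Pp _ (Wp.apply_mem_toSubmodule x hp),
      Pm _ (Wm.apply_mem_toSubmodule x hm), map_zero]
  obtain ⟨a, b, hab⟩ := D.endomorphism_eq P hP
  obtain ⟨p0, hp0, np0⟩ := Submodule.exists_mem_ne_zero_of_ne_bot hp
  obtain ⟨m0, hm0, nm0⟩ := Submodule.exists_mem_ne_zero_of_ne_bot hm
  have hb : b ≠ 0 := by
    rintro rfl
    have e1 := hab p0
    have e2 := hab m0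
    rw [Pp p0 hp0, zero_smul, add_zero] at e1
    rw [Pm m0 hm0, zero_smul, add_zero] at e2
    have ha : a = 0 := (smul_eq_zero.mp e2.symm).resolve_right nm0
    rw [ha, zero_smul] at e1
    exact np0 e1
  -- `P = a + b T` is `1` on `Wp` and `0` on `Wm`, so `T` is scalar on both
  have Tp : ∀ p ∈ Wp.toSubmodule, D.T p = ((1 - a) / b) • p := by
    intro p hp
    have e := hab p
    rw [Pp p hp] at e
    apply smul_right_injective W hb
    simp only
    rw [smul_smul, mul_div_cancel₀ _ hb, sub_smul, one_smul]
    nth_rw 2 [e]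
    abel
  have Tm : ∀ p ∈ Wm.toSubmodule, D.T p = (-a / b) • p := by
    intro p hp
    have e := hab p
    rw [Pm p hp] at e
    apply smul_right_injective W hb
    simp only
    rw [smul_smul, mul_div_cancel₀ _ hb, neg_smul]
    exact (neg_eq_of_add_eq_zero_right e.symm).symm
  have sq : ∀ (s : ℂ) (w : W), w ≠ 0 → D.T w = s • w → s * s = D.τ * D.τ := by
    intro s w hw e
    have := D.T_sq w
    rw [e, map_smul, e, smul_smul] at this
    exact smul_left_injective ℂ hw this
  obtain ⟨s, hs⟩ : ∃ s, s = (1 - a) / b := ⟨_, rfl⟩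
  have s1 := sq _ p0 np0 (Tp p0 hp0)
  have s2 := sq _ m0 nm0 (Tm m0 hm0)
  have hs0 : s ≠ 0 := by rw [hs]; exact D.ne_zero_of_sq s1
  have hneg : -a / b = -s := by
    rcases mul_self_eq_mul_self_iff.mp (s2.trans s1.symm) with e | e
    · field_simp at e
      exact absurd e (by intro h; apply one_ne_zero (α := ℂ); linear_combination -h)
    · rw [e, hs]
  rw [← hs] at Tp
  rw [hneg] at Tm
  have h2 : s + s ≠ 0 := by simpa using hs0
  refine ⟨s, hs0, le_antisymm (fun w hw => D.mem_piece.mpr (Tp w hw)) ?_,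
    le_antisymm (fun w hw => D.mem_piece.mpr (Tm w hw)) ?_⟩
  · intro w hw
    obtain ⟨p, hp, m, hm, rfl⟩ := dec w
    rw [mem_piece, map_add, Tp p hp, Tm m hm] at hw
    have : (s + s) • m = 0 := by
      rw [← sub_eq_zero] at hw
      rw [← neg_eq_zero, ← hw]; module
    rw [(smul_eq_zero.mp this).resolve_left h2, add_zero]
    exact hp
  · intro w hw
    obtain ⟨p, hp, m, hm, rfl⟩ := dec w
    rw [mem_piece, map_add, Tp p hp, Tm m hm] at hw
    have : (s + s) • p = 0 := by
      rw [← sub_eq_zero] at hw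
      rw [← hw]; module
    rw [(smul_eq_zero.mp this).resolve_left h2, zero_add]
    exact hm

theorem ne_bot_of_isIrreducible {M : Subrepresentation σ}
    (h : M.toRepresentation.IsIrreducible) : M.toSubmodule ≠ ⊥ := by
  intro hb
  obtain ⟨X, Y, hXY⟩ := h.exists_pair_ne
  apply hXY
  apply Subrepresentation.toSubmodule_injective
  have : Subsingleton M.toSubmodule := by rw [hb]; infer_instance
  ext w
  rw [Subsingleton.elim w 0]
  simp

/-- An equivalence of the two summands, extended by zero, would be an intertwining operator, hence
a polynomial in `T`, and would preserve the first summand. -/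
theorem isEmpty_equiv (D : SplitDatum σ B χ) {Wp Wm : Subrepresentation σ}
    (h : IsCompl Wp.toSubmodule Wm.toSubmodule) (hp : Wp.toSubmodule ≠ ⊥)
    (hm : Wm.toSubmodule ≠ ⊥) :
    IsEmpty (Representation.Equiv Wp.toRepresentation Wm.toRepresentation) := by
  constructor
  intro φ
  obtain ⟨s, -, hsp, -⟩ := D.eq_piece_of_isCompl h hp hm
  let A : W →ₗ[ℂ] W := Wm.toSubmodule.subtype ∘ₗ φ.toLinearMap ∘ₗ
    Wp.toSubmodule.projectionOnto Wm.toSubmodule h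
  have Ap : ∀ p : Wp.toSubmodule, A p = φ p := by
    intro p
    simp [A]
  have Am : ∀ m : Wm.toSubmodule, A m = 0 := by
    intro m
    simp [A]
  have hA : ∀ x w, A (σ x w) = σ x (A w) := by
    intro x w
    obtain ⟨p, hp, m, hm, rfl⟩ := Submodule.mem_sup.mp
      (show w ∈ Wp.toSubmodule ⊔ Wm.toSubmodule by rw [h.sup_eq_top]; trivial)
    simp only [map_add]
    rw [Ap ⟨p, hp⟩, Am ⟨m, hm⟩, map_zero,
      show A (σ x p) = _ from Ap ⟨_, Wp.apply_mem_toSubmodule x hp⟩,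
      show A (σ x m) = _ from Am ⟨_, Wm.apply_mem_toSubmodule x hm⟩, add_zero, add_zero]
    exact congrArg Subtype.val
      (Representation.IntertwiningMap.isIntertwining _ _ φ.toIntertwiningMap x ⟨p, hp⟩)
  obtain ⟨a, b, hab⟩ := D.endomorphism_eq A hA
  obtain ⟨p0, hp0, np0⟩ := Submodule.exists_mem_ne_zero_of_ne_bot hp
  have e := hab p0
  rw [show A p0 = _ from Ap ⟨p0, hp0⟩] at e
  have hT : D.T p0 = s • p0 := D.mem_piece.mp (by rw [← hsp]; exact hp0)
  have hz : ((φ ⟨p0, hp0⟩ : Wm.toSubmodule) : W) = 0 := by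
    refine (Submodule.disjoint_def.mp h.disjoint) _ ?_ (φ ⟨p0, hp0⟩).2
    rw [e, hT]
    exact Wp.toSubmodule.add_mem (Wp.toSubmodule.smul_mem _ hp0)
      (Wp.toSubmodule.smul_mem _ (Wp.toSubmodule.smul_mem _ hp0))
  have hz' : φ ⟨p0, hp0⟩ = 0 := Subtype.ext hz
  exact np0 (congrArg Subtype.val (φ.toLinearEquiv.map_eq_zero_iff.mp hz'))

/-- As `J` anticommutes with `T`, it interchanges the two eigenspaces. -/
theorem J_mem_piece {s : ℂ} {w : W} (hw : w ∈ (D.piece s).toSubmodule) :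
    D.J w ∈ (D.piece (-s)).toSubmodule := by
  rw [mem_piece] at hw ⊢
  rw [neg_smul, ← map_smul, ← hw, D.J_T, neg_neg]

theorem finrank_piece_le [FiniteDimensional ℂ W] (s : ℂ) :
    Module.finrank ℂ (D.piece s).toSubmodule ≤ Module.finrank ℂ (D.piece (-s)).toSubmodule := by
  refine LinearMap.finrank_le_finrank_of_injective
    (f := D.J.restrict fun w hw => D.J_mem_piece (s := s) hw) ?_
  intro x y hxy
  exact Subtype.ext (D.J_inj (congrArg Subtype.val hxy))

theorem finrank_piece_eq [FiniteDimensional ℂ W] (s : ℂ) :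
    Module.finrank ℂ (D.piece s).toSubmodule = Module.finrank ℂ (D.piece (-s)).toSubmodule :=
  le_antisymm (D.finrank_piece_le s) (by
    have := D.finrank_piece_le (-s)
    rwa [neg_neg] at this)

/-- With `a δ + b T δ`, an invariant subspace stable under `J` also contains `a δ - b T δ`. -/
theorem eq_top_of_stable (M : Subrepresentation σ) (hM : M.toSubmodule ≠ ⊥)
    (hJ : ∀ w ∈ M.toSubmodule, D.J w ∈ M.toSubmodule) : M.toSubmodule = ⊤ := by
  obtain ⟨w, hw, hw0, hwe⟩ := D.exists_eigen M hM
  obtain ⟨a, b, rfl⟩ := D.eigen_span w hwe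
  have h1 := hJ _ hw
  rw [map_add, map_smul, map_smul, D.J_T, D.J_δ] at h1
  have ha := M.toSubmodule.add_mem hw h1
  have hb := M.toSubmodule.sub_mem hw h1
  have ea : a • D.δ + b • D.T D.δ + (a • D.δ + b • -D.T D.δ) = (a + a) • D.δ := by module
  have eb : a • D.δ + b • D.T D.δ - (a • D.δ + b • -D.T D.δ) = (b + b) • D.T D.δ := by module
  rw [ea] at ha
  rw [eb] at hb
  by_cases ha0 : a = 0
  · have hb0 : b ≠ 0 := by
      rintro rfl
      simp [ha0] at hw0
    have h2 := M.toSubmodule.smul_mem (b + b)⁻¹ hb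
    rw [smul_smul, inv_mul_cancel₀ (by simpa using hb0), one_smul] at h2
    let N : Subrepresentation σ :=
      { toSubmodule := M.toSubmodule.comap D.T
        apply_mem_toSubmodule := fun h v hv => by
          simp only [Submodule.mem_comap] at hv ⊢
          rw [D.T_comm]
          exact M.apply_mem_toSubmodule h hv }
    have hN := D.cyclic N h2
    refine eq_top_iff.mpr fun w _ => ?_
    have h3 : D.T w ∈ N.toSubmodule := by rw [hN]; trivial
    have h4 : D.T (D.T w) ∈ M.toSubmodule := h3
    rw [D.T_sq] at h4
    have h5 := M.toSubmodule.smul_mem (D.τ * D.τ)⁻¹ h4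
    rwa [smul_smul, inv_mul_cancel₀ (mul_self_ne_zero.mpr D.τ_ne), one_smul] at h5
  · have h2 := M.toSubmodule.smul_mem (a + a)⁻¹ ha
    rw [smul_smul, inv_mul_cancel₀ (by simpa using ha0), one_smul] at h2
    exact D.cyclic M h2

end SplitDatum

end SplitDatum

/-! ### Functions of given level, averages and bump functions -/

section LevelFun

variable {H : Type*} [Group H]

/-- The functions `f` on `H` with `f (b g) = χ b f g` for `b ∈ B` which are invariant under right
translation by `N`. -/
def levelFun (B : Subgroup H) (χ : B → ℂ) (N : Subgroup H) : Submodule ℂ (H → ℂ) where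
  carrier := {f | (∀ (b : B) (g : H), f (b * g) = χ b * f g) ∧ ∀ u ∈ N, ∀ g : H, f (g * u) = f g}
  add_mem' {f f'} hf hf' :=
    ⟨fun b g => by simp [hf.1, hf'.1, mul_add], fun u hu g => by simp [hf.2 u hu, hf'.2 u hu]⟩
  zero_mem' := ⟨fun b g => by simp, fun u _ g => rfl⟩
  smul_mem' c f hf := ⟨fun b g => by simp [hf.1]; ring, fun u hu g => by simp [hf.2 u hu]⟩

variable {B : Subgroup H} {χ : B → ℂ} {N N' : Subgroup H}

theorem levelFun_left (f : levelFun B χ N) (b : B) (g : H) : f.1 (b * g) = χ b * f.1 g := f.2.1 b g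

theorem levelFun_right (f : levelFun B χ N) {u : H} (hu : u ∈ N) (g : H) : f.1 (g * u) = f.1 g :=
  f.2.2 u hu g

theorem levelFun_left_normal (hN : N.Normal) (f : levelFun B χ N) {u : H} (hu : u ∈ N) (g : H) :
    f.1 (u * g) = f.1 g := by
  have := levelFun_right f (hN.conj_mem u hu g⁻¹) g
  rw [← this]
  group

/-- Right translation on `levelFun B χ N`. -/
def levelFunRep (B : Subgroup H) (χ : B → ℂ) (N : Subgroup H) (hN : N.Normal) :
    Representation ℂ H (levelFun B χ N) where
  toFun h :=
    { toFun := fun f => ⟨fun g => f.1 (g * h), fun b g => by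
          simpa [mul_assoc] using f.2.1 b (g * h),
        fun u hu g => by
          have := f.2.2 _ (hN.conj_mem u hu h⁻¹) (g * h)
          simpa [mul_assoc] using this⟩
      map_add' := fun _ _ => rfl
      map_smul' := fun _ _ => rfl }
  map_one' := by
    ext f g
    simp
  map_mul' h h' := by
    ext f g
    simp [mul_assoc]

@[simp] theorem levelFunRep_apply (hN : N.Normal) (h : H) (f : levelFun B χ N) (g : H) :
    (levelFunRep B χ N hN h f).1 g = f.1 (g * h) := rfl

theorem levelFunRep_of_mem (hN : N.Normal) {u : H} (hu : u ∈ N) (f : levelFun B χ N) :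
    levelFunRep B χ N hN u f = f := by
  ext g
  exact levelFun_right f hu g

/-- The projection from the vectors fixed by `N` to the quotient by those fixed by `N'`. -/
def fixedProj {V : Type*} [AddCommGroup V] [Module ℂ V] (ρ : Representation ℂ H V)
    (N N' : Subgroup H) (hN : N.Normal) (hN' : N'.Normal) :
    (fixedVectors ρ N hN).toSubmodule →ₗ[ℂ] ((fixedVectors ρ N hN).toSubmodule ⧸
      (fixedVectors ρ N' hN').toSubmodule.comap (fixedVectors ρ N hN).toSubmodule.subtype) :=
  Submodule.mkQ _

/-- The quotient map onto the level quotient of a smooth induction, in terms of functions. -/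
def levelProj (B : Subgroup H) (χ : B → ℂ) (U : ℕ → Subgroup H) (hU : Antitone U)
    (hN : ∀ j, (U j).Normal) (l l' : ℕ) (hl : 1 ≤ l) :=
  (fixedProj (smoothIndRep B χ U hU hN) (U l) (U l') (hN l) (hN l')).comp
    ({ toFun := fun f => ⟨⟨f.1, f.2.1, l, hl, f.2.2⟩, fun u hu => Subtype.ext (funext fun g =>
        f.2.2 u hu g)⟩
       map_add' := fun _ _ => rfl
       map_smul' := fun _ _ => rfl } : levelFun B χ (U l) →ₗ[ℂ]
        (fixedVectors (smoothIndRep B χ U hU hN) (U l) (hN l)).toSubmodule)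

theorem levelProj_surjective (B : Subgroup H) (χ : B → ℂ) (U : ℕ → Subgroup H) (hU : Antitone U)
    (hN : ∀ j, (U j).Normal) (l l' : ℕ) (hl : 1 ≤ l) :
    Function.Surjective (levelProj B χ U hU hN l l' hl) := by
  refine (Submodule.mkQ_surjective _).comp ?_
  rintro ⟨⟨f, hf, j, hj, hfj⟩, hfl⟩
  exact ⟨⟨f, hf, fun u hu g => congrFun (congrArg Subtype.val (hfl u hu)) g⟩, rfl⟩

theorem levelProj_eq_zero_iff (B : Subgroup H) (χ : B → ℂ) (U : ℕ → Subgroup H) (hU : Antitone U)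
    (hN : ∀ j, (U j).Normal) (l l' : ℕ) (hl : 1 ≤ l) (f : levelFun B χ (U l)) :
    levelProj B χ U hU hN l l' hl f = 0 ↔ f.1 ∈ levelFun B χ (U l') := by
  refine (Submodule.Quotient.mk_eq_zero _).trans ?_
  constructor
  · intro h
    exact ⟨f.2.1, fun u hu g => congrFun (congrArg Subtype.val (h u hu)) g⟩
  · intro h u hu
    exact Subtype.ext (funext fun g => h.2 u hu g)

end LevelFun

section Average

variable {H : Type*} [Group H] {W W' : Type*} [AddCommGroup W] [Module ℂ W] [AddCommGroup W']
  [Module ℂ W']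

/-- The average of `χ(b)⁻¹ σ(b) w` over `b ∈ B / (B ∩ N)`. -/
noncomputable def eigenAverage (σ : Representation ℂ H W) (B : Subgroup H) (χ : B → ℂ)
    (N : Subgroup H) [Fintype (B ⧸ N.subgroupOf B)] (w : W) : W :=
  (Fintype.card (B ⧸ N.subgroupOf B) : ℂ)⁻¹ •
    ∑ x : B ⧸ N.subgroupOf B, (χ x.out)⁻¹ • σ x.out w

variable {σ : Representation ℂ H W} {σ' : Representation ℂ H W'} {B : Subgroup H} {χ : B → ℂ}
  {N : Subgroup H} [Fintype (B ⧸ N.subgroupOf B)]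

theorem map_eigenAverage (A : W →ₗ[ℂ] W') (hA : ∀ h w, A (σ h w) = σ' h (A w)) (w : W) :
    A (eigenAverage σ B χ N w) = eigenAverage σ' B χ N (A w) := by
  simp [eigenAverage, hA, map_sum]

theorem eigenAverage_mem (M : Subrepresentation σ) {w : W} (hw : w ∈ M.toSubmodule) :
    eigenAverage σ B χ N w ∈ M.toSubmodule :=
  M.toSubmodule.smul_mem _ (M.toSubmodule.sum_mem fun _ _ =>
    M.toSubmodule.smul_mem _ (M.apply_mem_toSubmodule _ hw))

theorem eigenAverage_of_isEigenvector (hχ : ∀ b, χ b ≠ 0) {w : W} (hw : IsEigenvector σ B χ w) :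
    eigenAverage σ B χ N w = w := by
  have hc : (Fintype.card (B ⧸ N.subgroupOf B) : ℂ) ≠ 0 := by
    have : Nonempty (B ⧸ N.subgroupOf B) := ⟨QuotientGroup.mk 1⟩
    exact_mod_cast Fintype.card_ne_zero
  rw [eigenAverage, Finset.sum_congr rfl (g := fun _ => w)]
  · rw [Finset.sum_const, Finset.card_univ, ← Nat.cast_smul_eq_nsmul ℂ, smul_smul,
      inv_mul_cancel₀ hc, one_smul]
  · intro x _
    rw [hw, smul_smul, inv_mul_cancel₀ (hχ _), one_smul]

theorem isEigenvector_eigenAverage (hmul : ∀ b b', χ (b * b') = χ b * χ b')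
    (hχ : ∀ b, χ b ≠ 0) (htriv : ∀ b : B, (b : H) ∈ N → χ b = 1) {w : W}
    (hw : ∀ u ∈ N, σ u w = w) : IsEigenvector σ B χ (eigenAverage σ B χ N w) := by
  have key : ∀ b b' : B, (QuotientGroup.mk b : B ⧸ N.subgroupOf B) = QuotientGroup.mk b' →
      (χ b)⁻¹ • σ b w = (χ b')⁻¹ • σ b' w := by
    intro b b' h
    rw [QuotientGroup.eq, Subgroup.mem_subgroupOf] at h
    have e : b' = b * (b⁻¹ * b') := by group
    rw [e, hmul, htriv _ h, mul_one]
    rw [Subgroup.coe_mul, map_mul, Module.End.mul_apply, hw _ h]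
  intro b
  rw [eigenAverage, map_smul, map_sum, smul_comm]
  congr 1
  rw [Finset.smul_sum]
  refine Fintype.sum_equiv (MulAction.toPerm b : Equiv.Perm (B ⧸ N.subgroupOf B)) _ _ fun x => ?_
  have hx : (QuotientGroup.mk (b * x.out) : B ⧸ N.subgroupOf B) =
      QuotientGroup.mk ((MulAction.toPerm b : Equiv.Perm (B ⧸ N.subgroupOf B)) x).out := by
    rw [QuotientGroup.out_eq', MulAction.toPerm_apply]
    conv_rhs => rw [← QuotientGroup.out_eq' x]
    rfl
  rw [← key _ _ hx, map_smul, hmul, smul_smul, mul_inv, mul_inv_cancel_left₀ (hχ b),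
    Subgroup.coe_mul, map_mul, Module.End.mul_apply]

end Average

section Bump

variable {H : Type*} [Group H] {B : Subgroup H} {χ : B → ℂ} {N : Subgroup H}

open Classical in
/-- The function supported on `B N` with value `χ(b)` at `b u`. -/
noncomputable def bumpFun (χ : B → ℂ) (N : Subgroup H) (g : H) : ℂ :=
  if h : ∃ b : B, (b : H)⁻¹ * g ∈ N then χ h.choose else 0

theorem bumpFun_of_mem (hmul : ∀ b b', χ (b * b') = χ b * χ b')
    (htriv : ∀ b : B, (b : H) ∈ N → χ b = 1) (b : B) {g : H} (h : (b : H)⁻¹ * g ∈ N) :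
    bumpFun χ N g = χ b := by
  have hex : ∃ b : B, (b : H)⁻¹ * g ∈ N := ⟨b, h⟩
  rw [bumpFun, dif_pos hex]
  have h' := hex.choose_spec
  generalize hex.choose = b' at h'
  have : ((b⁻¹ * b' : B) : H) ∈ N := by
    have := N.mul_mem h (N.inv_mem h')
    simpa [mul_assoc] using this
  have e := htriv _ this
  rw [show b' = b * (b⁻¹ * b') by group, hmul, e, mul_one]

theorem bumpFun_of_not {g : H} (h : ¬ ∃ b : B, (b : H)⁻¹ * g ∈ N) : bumpFun χ N g = 0 := by
  rw [bumpFun, dif_neg h]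

/-- `bumpFun` as an element of `levelFun B χ N`. -/
noncomputable def bump (hmul : ∀ b b', χ (b * b') = χ b * χ b')
    (htriv : ∀ b : B, (b : H) ∈ N → χ b = 1) : levelFun B χ N :=
  ⟨bumpFun χ N, by
    constructor
    · intro b g
      by_cases h : ∃ b' : B, (b' : H)⁻¹ * g ∈ N
      · obtain ⟨b', h⟩ := h
        rw [bumpFun_of_mem hmul htriv b' h, bumpFun_of_mem hmul htriv (b * b')
          (by simpa [mul_assoc] using h), hmul]
      · rw [bumpFun_of_not h, mul_zero, bumpFun_of_not]
        rintro ⟨b', h'⟩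
        exact h ⟨b⁻¹ * b', by simpa [mul_assoc] using h'⟩
    · intro u hu g
      by_cases h : ∃ b' : B, (b' : H)⁻¹ * g ∈ N
      · obtain ⟨b', h⟩ := h
        rw [bumpFun_of_mem hmul htriv b' h, bumpFun_of_mem hmul htriv b'
          (by rw [← mul_assoc]; exact N.mul_mem h hu)]
      · rw [bumpFun_of_not h, bumpFun_of_not]
        rintro ⟨b', h'⟩
        refine h ⟨b', ?_⟩
        have := N.mul_mem h' (N.inv_mem hu)
        simpa [mul_assoc] using this⟩

theorem isEigenvector_bump (hN : N.Normal) (hmul : ∀ b b', χ (b * b') = χ b * χ b')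
    (htriv : ∀ b : B, (b : H) ∈ N → χ b = 1) :
    IsEigenvector (levelFunRep B χ N hN) B χ (bump hmul htriv) := by
  intro b
  ext g
  change bumpFun χ N (g * b) = χ b * bumpFun χ N g
  by_cases h : ∃ b' : B, (b' : H)⁻¹ * g ∈ N
  · obtain ⟨b', h⟩ := h
    rw [bumpFun_of_mem hmul htriv b' h, bumpFun_of_mem hmul htriv (b' * b), hmul, mul_comm]
    have := hN.conj_mem _ h (b : H)⁻¹
    simpa [mul_assoc] using this
  · rw [bumpFun_of_not h, mul_zero, bumpFun_of_not]
    rintro ⟨b', h'⟩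
    refine h ⟨b' * b⁻¹, ?_⟩
    have := hN.conj_mem _ h' (b : H)
    simpa [mul_assoc] using this

/-- The translates of the bump function span: on each right coset of the group `B N`, a function
in `levelFun B χ N` is a multiple of a translated bump function. -/
theorem eq_sum_bump (hN : N.Normal) [N.FiniteIndex] (hmul : ∀ b b', χ (b * b') = χ b * χ b')
    (htriv : ∀ b : B, (b : H) ∈ N → χ b = 1) (M : Subrepresentation (levelFunRep B χ N hN))
    (hM : bump hmul htriv ∈ M.toSubmodule) : M.toSubmodule = ⊤ := by
  classical
  refine eq_top_iff.mpr fun f _ => ?_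
  have : (B ⊔ N).FiniteIndex := Subgroup.finiteIndex_of_le le_sup_right
  have : Finite (Quotient (QuotientGroup.rightRel (B ⊔ N))) :=
    Finite.of_equiv _ (QuotientGroup.quotientRightRelEquivQuotientLeftRel (B ⊔ N)).symm
  have : Fintype (Quotient (QuotientGroup.rightRel (B ⊔ N))) := Fintype.ofFinite _
  have e : f = ∑ r : Quotient (QuotientGroup.rightRel (B ⊔ N)),
      f.1 r.out • levelFunRep B χ N hN (r.out)⁻¹ (bump hmul htriv) := by
    ext g
    rw [Submodule.coe_sum, Finset.sum_apply]
    simp only [Submodule.coe_smul, Pi.smul_apply, smul_eq_mul, levelFunRep_apply]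
    rw [Finset.sum_eq_single (Quotient.mk _ g)]
    · have hr : QuotientGroup.rightRel (B ⊔ N) (Quotient.mk _ g).out g :=
        Quotient.mk_out (s := QuotientGroup.rightRel (B ⊔ N)) g
      generalize (Quotient.mk (QuotientGroup.rightRel (B ⊔ N)) g).out = r at hr
      rw [QuotientGroup.rightRel_apply] at hr
      rw [← SetLike.mem_coe, Subgroup.mul_normal] at hr
      obtain ⟨b, hb, u, hu, hbu⟩ := hr
      have hbu : b * u = g * r⁻¹ := hbu
      have hg : g = b * (u * r) := by rw [← mul_assoc, hbu]; group
      change _ = _ * bumpFun χ N (g * r⁻¹)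
      rw [bumpFun_of_mem hmul htriv ⟨b, hb⟩ (by rw [← hbu]; simpa using hu), hg,
        levelFun_left f ⟨b, hb⟩, levelFun_left_normal hN f hu, mul_comm]
    · intro r _ hr
      refine mul_eq_zero_of_right _ (bumpFun_of_not ?_)
      rintro ⟨b, hb⟩
      apply hr
      rw [← Quotient.out_eq r]
      apply Quotient.sound
      change QuotientGroup.rightRel (B ⊔ N) _ _
      rw [QuotientGroup.rightRel_apply]
      have := (B ⊔ N).mul_mem (Subgroup.mem_sup_left b.2) (Subgroup.mem_sup_right hb)
      rwa [mul_inv_cancel_left] at this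
    · simp
  rw [e]
  exact M.toSubmodule.sum_mem fun r _ =>
    M.toSubmodule.smul_mem _ (M.apply_mem_toSubmodule _ hM)

theorem finiteDimensional_levelFun (hN : N.Normal) [N.FiniteIndex] :
    FiniteDimensional ℂ (levelFun B χ N) := by
  have : (B ⊔ N).FiniteIndex := Subgroup.finiteIndex_of_le le_sup_right
  have : Finite (Quotient (QuotientGroup.rightRel (B ⊔ N))) :=
    Finite.of_equiv _ (QuotientGroup.quotientRightRelEquivQuotientLeftRel (B ⊔ N)).symm
  let A : levelFun B χ N →ₗ[ℂ] (Quotient (QuotientGroup.rightRel (B ⊔ N)) → ℂ) :=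
    { toFun := fun f r => f.1 r.out
      map_add' := fun _ _ => rfl
      map_smul' := fun _ _ => rfl }
  refine FiniteDimensional.of_injective A ?_
  rw [injective_iff_map_eq_zero]
  intro f hf
  ext g
  have h0 := congrFun hf (Quotient.mk _ g)
  have hr : QuotientGroup.rightRel (B ⊔ N) (Quotient.mk _ g).out g :=
    Quotient.mk_out (s := QuotientGroup.rightRel (B ⊔ N)) g
  change f.1 (Quotient.mk _ g).out = 0 at h0
  generalize (Quotient.mk (QuotientGroup.rightRel (B ⊔ N)) g).out = r at hr h0
  rw [QuotientGroup.rightRel_apply, ← SetLike.mem_coe, Subgroup.mul_normal] at hr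
  obtain ⟨b, hb, u, hu, hbu⟩ := hr
  have hbu : b * u = g * r⁻¹ := hbu
  have hg : g = b * (u * r) := by rw [← mul_assoc, hbu]; group
  rw [hg, levelFun_left f ⟨b, hb⟩, levelFun_left_normal hN f hu, h0, mul_zero]
  rfl

end Bump

/-! ### The splitting of a level quotient -/

section Descend

variable {L W X : Type*} [AddCommGroup L] [Module ℂ L] [AddCommGroup W] [Module ℂ W]
  [AddCommGroup X] [Module ℂ X]

/-- The map induced on `W` by a linear map which vanishes on the kernel of a surjection `π` onto
`W`. -/
noncomputable def descend (π : L →ₗ[ℂ] W) (hπ : Function.Surjective π) (A : L →ₗ[ℂ] X)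
    (hA : ∀ f, π f = 0 → A f = 0) : W →ₗ[ℂ] X :=
  ((LinearMap.ker π).liftQ A hA).comp (π.quotKerEquivOfSurjective hπ).symm.toLinearMap

theorem descend_apply (π : L →ₗ[ℂ] W) (hπ : Function.Surjective π) (A : L →ₗ[ℂ] X)
    (hA : ∀ f, π f = 0 → A f = 0) (f : L) : descend π hπ A hA (π f) = A f := by
  have : (π.quotKerEquivOfSurjective hπ).symm (π f) = Submodule.Quotient.mk f := by
    rw [LinearEquiv.symm_apply_eq]
    rfl
  simp only [descend, LinearMap.comp_apply, LinearEquiv.coe_coe, this]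
  exact Submodule.liftQ_apply _ _ _

end Descend

section SplitLevel

variable {H : Type*} [Group H] {B : Subgroup H} {χ : B → ℂ} {N N' : Subgroup H}

/-- Operators on the functions of level `N` from which the two-piece structure of the quotient by
the functions of level `N'` can be read off: `P` is a projector onto the functions of level `N'`,
and `T`, `J` induce the operators of the same name of `SplitDatum`. -/
structure LevelOperators (B : Subgroup H) (χ : B → ℂ) (N N' : Subgroup H) (hN : N.Normal) where
  mul : ∀ b b', χ (b * b') = χ b * χ b'
  one : χ 1 = 1
  triv : ∀ b : B, (b : H) ∈ N → χ b = 1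
  P : levelFun B χ N →ₗ[ℂ] levelFun B χ N
  T : levelFun B χ N →ₗ[ℂ] levelFun B χ N
  J : levelFun B χ N →ₗ[ℂ] levelFun B χ N
  τ : ℂ
  τ_ne : τ ≠ 0
  P_comm : ∀ h f, P (levelFunRep B χ N hN h f) = levelFunRep B χ N hN h (P f)
  P_mem : ∀ f, (P f).1 ∈ levelFun B χ N'
  P_of_mem : ∀ f, f.1 ∈ levelFun B χ N' → P f = f
  T_comm : ∀ h f, T (levelFunRep B χ N hN h f) = levelFunRep B χ N hN h (T f)
  T_mem : ∀ f, f.1 ∈ levelFun B χ N' → (T f).1 ∈ levelFun B χ N'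
  T_sq : ∀ f, (T (T f) - (τ * τ) • f).1 ∈ levelFun B χ N'
  T_bump : ∀ a : ℂ, (T (bump mul triv) - a • bump mul triv).1 ∉ levelFun B χ N'
  eigen_span : ∀ f, IsEigenvector (levelFunRep B χ N hN) B χ f →
    ∃ a b : ℂ, (f - (a • bump mul triv + b • T (bump mul triv))).1 ∈ levelFun B χ N'
  J_T : ∀ f, J (T f) = -T (J f)
  J_bump : J (bump mul triv) = bump mul triv
  J_mem_iff : ∀ f, (J f).1 ∈ levelFun B χ N' ↔ f.1 ∈ levelFun B χ N'

namespace LevelOperators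

variable {hN : N.Normal}

theorem ne_zero (D : LevelOperators B χ N N' hN) (b : B) : χ b ≠ 0 := by
  intro h
  have := D.mul b b⁻¹
  rw [mul_inv_cancel, D.one, h, zero_mul] at this
  exact one_ne_zero this

variable {W : Type*} [AddCommGroup W] [Module ℂ W] {σ : Representation ℂ H W}
  (π : levelFun B χ N →ₗ[ℂ] W)

/-- A function representing a nonzero vector of `M`, minus its projection to level `N'`, has a
translate which is nonzero at `1` and killed by `P`. Averaging over `B` keeps both properties, so
the average is not of level `N'`. -/
theorem exists_eigenvector (D : LevelOperators B χ N N' hN) [N.FiniteIndex]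
    (hk : ∀ f, π f = 0 ↔ f.1 ∈ levelFun B χ N')
    (hσ : ∀ h f, π (levelFunRep B χ N hN h f) = σ h (π f)) (hπ : Function.Surjective π)
    (M : Subrepresentation σ) (hM : M.toSubmodule ≠ ⊥) :
    ∃ w ∈ M.toSubmodule, w ≠ 0 ∧ IsEigenvector σ B χ w := by
  have : Fintype (B ⧸ N.subgroupOf B) := Fintype.ofFinite _
  obtain ⟨w, hw, hw0⟩ := Submodule.exists_mem_ne_zero_of_ne_bot hM
  obtain ⟨f, rfl⟩ := hπ w
  have hne : f - D.P f ≠ 0 := fun h => hw0 ((hk f).mpr (by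
    rw [sub_eq_zero.mp h]; exact D.P_mem f))
  obtain ⟨g, hg⟩ : ∃ g, (f - D.P f).1 g ≠ 0 := by
    by_contra! hall
    exact hne (Subtype.ext (funext hall))
  obtain ⟨f', hf'⟩ : ∃ f', f' = levelFunRep B χ N hN g (f - D.P f) := ⟨_, rfl⟩
  have h1 : f'.1 1 ≠ 0 := by
    rw [hf', levelFunRep_apply, one_mul]
    exact hg
  have hP : D.P f' = 0 := by
    rw [hf', D.P_comm, map_sub, D.P_of_mem _ (D.P_mem f), sub_self, map_zero]
  have hfM : π f' ∈ M.toSubmodule := by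
    rw [hf', hσ, map_sub, (hk _).mpr (D.P_mem f), sub_zero]
    exact M.apply_mem_toSubmodule g hw
  have hval : (eigenAverage (levelFunRep B χ N hN) B χ N f').1 1 = f'.1 1 := by
    have hc : (Fintype.card (B ⧸ N.subgroupOf B) : ℂ) ≠ 0 := by
      have : Nonempty (B ⧸ N.subgroupOf B) := ⟨QuotientGroup.mk 1⟩
      exact_mod_cast Fintype.card_ne_zero
    rw [eigenAverage, Submodule.coe_smul, Submodule.coe_sum, Pi.smul_apply, Finset.sum_apply,
      Finset.sum_congr rfl (g := fun _ => f'.1 1)]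
    · rw [Finset.sum_const, Finset.card_univ, nsmul_eq_mul, smul_eq_mul, inv_mul_cancel_left₀ hc]
    · intro x _
      rw [Submodule.coe_smul, Pi.smul_apply, levelFunRep_apply, smul_eq_mul, one_mul]
      have := levelFun_left f' x.out 1
      rw [mul_one] at this
      rw [this, inv_mul_cancel_left₀ (D.ne_zero _)]
  refine ⟨π (eigenAverage (levelFunRep B χ N hN) B χ N f'), ?_, ?_, ?_⟩
  · rw [map_eigenAverage π hσ]
    exact eigenAverage_mem M hfM
  · rw [Ne, hk]
    intro hmem
    have h2 := D.P_of_mem _ hmem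
    rw [map_eigenAverage D.P D.P_comm, hP] at h2
    have h3 : eigenAverage (levelFunRep B χ N hN) B χ N (0 : levelFun B χ N) = 0 := by
      simp [eigenAverage]
    rw [h3] at h2
    rw [← h2] at hval
    exact h1 hval.symm
  · rw [map_eigenAverage π hσ]
    refine isEigenvector_eigenAverage D.mul D.ne_zero D.triv fun u hu => ?_
    rw [← hσ, levelFunRep_of_mem hN hu]

/-- The two-piece structure on the level quotient. -/
noncomputable def splitDatum (D : LevelOperators B χ N N' hN) [N.FiniteIndex]
    (hk : ∀ f, π f = 0 ↔ f.1 ∈ levelFun B χ N')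
    (hσ : ∀ h f, π (levelFunRep B χ N hN h f) = σ h (π f)) (hπ : Function.Surjective π) :
    SplitDatum σ B χ where
  δ := π (bump D.mul D.triv)
  T := descend π hπ (π ∘ₗ D.T) fun f hf => (hk _).mpr (D.T_mem f ((hk f).mp hf))
  J := descend π hπ (π ∘ₗ D.J) fun f hf => (hk _).mpr ((D.J_mem_iff f).mpr ((hk f).mp hf))
  τ := D.τ
  τ_ne := D.τ_ne
  T_comm h w := by
    obtain ⟨f, rfl⟩ := hπ w
    rw [← hσ, descend_apply, descend_apply, LinearMap.comp_apply, LinearMap.comp_apply, D.T_comm,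
      hσ]
  T_sq w := by
    obtain ⟨f, rfl⟩ := hπ w
    rw [descend_apply, LinearMap.comp_apply, descend_apply, LinearMap.comp_apply, ← map_smul,
      ← sub_eq_zero, ← map_sub]
    exact (hk _).mpr (D.T_sq f)
  T_δ a h := by
    rw [descend_apply, LinearMap.comp_apply, ← map_smul, ← sub_eq_zero, ← map_sub] at h
    exact D.T_bump a ((hk _).mp h)
  eigen_δ b := by
    rw [← hσ, isEigenvector_bump hN D.mul D.triv b, map_smul]
  cyclic M hM := by
    let M' : Subrepresentation (levelFunRep B χ N hN) :=
      { toSubmodule := M.toSubmodule.comap π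
        apply_mem_toSubmodule := fun h f hf => by
          rw [Submodule.mem_comap] at hf ⊢
          rw [hσ]
          exact M.apply_mem_toSubmodule h hf }
    have h := eq_sum_bump hN D.mul D.triv M' hM
    refine eq_top_iff.mpr fun w _ => ?_
    obtain ⟨f, rfl⟩ := hπ w
    have hf : f ∈ M'.toSubmodule := by rw [h]; trivial
    exact hf
  exists_eigen := D.exists_eigenvector π hk hσ hπ
  eigen_span w hw := by
    have : Fintype (B ⧸ N.subgroupOf B) := Fintype.ofFinite _
    obtain ⟨f, rfl⟩ := hπ w
    obtain ⟨a, b, hab⟩ := D.eigen_span (eigenAverage (levelFunRep B χ N hN) B χ N f)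
      (isEigenvector_eigenAverage D.mul D.ne_zero D.triv fun u hu => levelFunRep_of_mem hN hu f)
    refine ⟨a, b, ?_⟩
    rw [descend_apply, LinearMap.comp_apply, ← sub_eq_zero, ← map_smul, ← map_smul, ← map_add]
    rw [← eigenAverage_of_isEigenvector (N := N) D.ne_zero hw, ← map_eigenAverage π hσ, ← map_sub]
    exact (hk _).mpr hab
  J_T w := by
    obtain ⟨f, rfl⟩ := hπ w
    rw [descend_apply, descend_apply, LinearMap.comp_apply, LinearMap.comp_apply, descend_apply,
      descend_apply, LinearMap.comp_apply, LinearMap.comp_apply, D.J_T, map_neg]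
  J_δ := by
    rw [descend_apply, LinearMap.comp_apply, D.J_bump]
  J_inj := by
    rw [injective_iff_map_eq_zero]
    intro w hw
    obtain ⟨f, rfl⟩ := hπ w
    rw [descend_apply, LinearMap.comp_apply, hk, D.J_mem_iff] at hw
    exact (hk f).mpr hw

theorem splitDatum_J (D : LevelOperators B χ N N' hN) [N.FiniteIndex]
    (hk : ∀ f, π f = 0 ↔ f.1 ∈ levelFun B χ N')
    (hσ : ∀ h f, π (levelFunRep B χ N hN h f) = σ h (π f)) (hπ : Function.Surjective π)
    (f : levelFun B χ N) : (D.splitDatum π hk hσ hπ).J (π f) = π (D.J f) :=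
  descend_apply _ _ _ _ _

end LevelOperators

end SplitLevel

/-! ### Powers of the maximal ideal and congruence subgroups -/

section InPow

open ValuativeRel

variable {F : Type*} [Field F] [ValuativeRel F]

/-- `𝔭 ^ j`, as a condition on elements of `F`. -/
def InPow (ϖ : Fˣ) (j : ℕ) (x : F) : Prop := valuation F x ≤ valuation F (ϖ : F) ^ j

variable {ϖ : Fˣ} {j : ℕ}

theorem inPow_zero (j : ℕ) : InPow ϖ j (0 : F) := by simp [InPow]

theorem InPow.add {x y : F} (hx : InPow ϖ j x) (hy : InPow ϖ j y) : InPow ϖ j (x + y) :=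
  (Valuation.map_add _ _ _).trans (max_le hx hy)

theorem InPow.sub {x y : F} (hx : InPow ϖ j x) (hy : InPow ϖ j y) : InPow ϖ j (x - y) :=
  (Valuation.map_sub _ _ _).trans (max_le hx hy)

theorem InPow.mul {i : ℕ} {x y : F} (hx : InPow ϖ i x) (hy : InPow ϖ j y) :
    InPow ϖ (i + j) (x * y) := by
  rw [InPow, map_mul, pow_add]
  exact mul_le_mul' hx hy

theorem InPow.mul_left {x y : F} (hy : InPow ϖ j y) (hx : valuation F x ≤ 1) :
    InPow ϖ j (x * y) := by
  rw [InPow, map_mul]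
  exact (mul_le_mul' hx hy).trans_eq (one_mul _)

theorem InPow.mul_right {x y : F} (hy : InPow ϖ j y) (hx : valuation F x ≤ 1) :
    InPow ϖ j (y * x) := by
  rw [mul_comm]; exact hy.mul_left hx

theorem inPow_uniformizer_mul (r : ℕ) (y : 𝒪[F]) : InPow ϖ r ((ϖ : F) ^ r * y) := by
  rw [InPow, map_mul, map_pow]
  exact (mul_le_mul' le_rfl y.2).trans_eq (mul_one _)

theorem exists_integer_of_inPow {r : ℕ} {x : F} (hx : InPow ϖ r x) :
    ∃ y : 𝒪[F], x = (ϖ : F) ^ r * y := by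
  have h0 : (ϖ : F) ^ r ≠ 0 := pow_ne_zero _ ϖ.ne_zero
  refine ⟨⟨x / (ϖ : F) ^ r, ?_⟩, ?_⟩
  · change valuation F _ ≤ 1
    rw [map_div₀, map_pow]
    exact (div_le_one₀ (zero_lt_iff.mpr (pow_ne_zero _ ((map_ne_zero _).mpr ϖ.ne_zero)))).mpr hx
  · rw [mul_div_cancel₀ _ h0]

theorem valuation_lt_of_not_inPow {r : ℕ} {x y : F} (hx : ¬ InPow ϖ r x) (hy : InPow ϖ r y) :
    valuation F (y / x) < 1 := by
  have hlt : valuation F y < valuation F x := lt_of_le_of_lt hy (not_le.mp hx)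
  rw [map_div₀]
  exact (div_lt_one₀ (zero_le.trans_lt hlt)).mpr hlt

end InPow

section LocalField

open ValuativeRel Matrix

variable {F : Type*} [Field F] [ValuativeRel F] [TopologicalSpace F]
  [IsNonarchimedeanLocalField F] {ϖ : Fˣ} {j : ℕ}

theorem valuation_le_of_lt_one (hϖ : ord ϖ = 1) {x : F} (hx : valuation F x < 1) :
    valuation F x ≤ valuation F (ϖ : F) := by
  by_cases h0 : x = 0
  · simp [h0]
  have h1 : 0 < ord (Units.mk0 x h0) := (ord_pos_iff _).mpr hx
  have h2 : ord (Units.mk0 x h0 / ϖ) = ord (Units.mk0 x h0) - 1 := by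
    rw [div_eq_mul_inv, ord_mul, ord_inv, hϖ]; ring
  have h3 : valuation F ((Units.mk0 x h0 / ϖ : Fˣ) : F) ≤ 1 := by
    rcases (show 0 ≤ ord (Units.mk0 x h0 / ϖ) by omega).eq_or_lt with h | h
    · exact ((ord_eq_zero_iff _).mp h.symm).le
    · exact ((ord_pos_iff _).mp h).le
  rw [Units.val_div_eq_div_val, map_div₀, Units.val_mk0] at h3
  exact (div_le_one₀ (zero_lt_iff.mpr ((map_ne_zero _).mpr ϖ.ne_zero))).mp h3

theorem valuation_uniformizer_lt (hϖ : ord ϖ = 1) : valuation F (ϖ : F) < 1 :=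
  (ord_pos_iff ϖ).mp (by omega)

theorem InPow.mono (hϖ : ord ϖ = 1) {i : ℕ} (h : i ≤ j) {x : F} (hx : InPow ϖ j x) :
    InPow ϖ i x :=
  hx.trans (pow_le_pow_right_of_le_one' (valuation_uniformizer_lt hϖ).le h)

theorem InPow.lt_one (hϖ : ord ϖ = 1) (hj : 1 ≤ j) {x : F} (hx : InPow ϖ j x) :
    valuation F x < 1 :=
  ((hx.mono hϖ hj).trans_eq (pow_one _)).trans_lt (valuation_uniformizer_lt hϖ)

theorem InPow.le_one (hϖ : ord ϖ = 1) {x : F} (hx : InPow ϖ j x) : valuation F x ≤ 1 :=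
  (hx.mono hϖ (Nat.zero_le j)).trans_eq (pow_zero _)

theorem inPow_one_iff (hϖ : ord ϖ = 1) {x : F} : InPow ϖ 1 x ↔ valuation F x < 1 := by
  refine ⟨fun h => h.lt_one hϖ le_rfl, fun h => ?_⟩
  rw [InPow, pow_one]
  exact valuation_le_of_lt_one hϖ h

theorem mem_maximalIdeal_pow_iff (hϖ : ord ϖ = 1) (y : 𝒪[F]) (j : ℕ) :
    y ∈ 𝓂[F] ^ j ↔ InPow ϖ j (y : F) := by
  let p : 𝒪[F] := ⟨ϖ, (valuation_uniformizer_lt hϖ).le⟩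
  have dvd : ∀ (x z : 𝒪[F]), z ∣ x ↔ valuation F (x : F) ≤ valuation F (z : F) := fun x z =>
    (Valuation.Integers.dvd_iff_le (Valuation.integer.integers (valuation F)))
  have hm : 𝓂[F] = Ideal.span {p} := by
    ext x
    rw [IsLocalRing.mem_maximalIdeal, mem_nonunits_iff,
      Valuation.Integer.not_isUnit_iff_valuation_lt_one, Ideal.mem_span_singleton, dvd]
    exact ⟨fun h => valuation_le_of_lt_one hϖ h,
      fun h => lt_of_le_of_lt h (valuation_uniformizer_lt hϖ)⟩
  rw [hm, Ideal.span_singleton_pow, Ideal.mem_span_singleton, dvd, InPow, ← map_pow]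
  rfl

/-- One-units are squares of one-units, as `2` is invertible in the residue field. -/
theorem exists_sqrt_oneUnit (h2 : (2 : 𝓀[F]) ≠ 0) {y : F} (hy : valuation F y < 1) :
    ∃ e : F, e * e = 1 + y ∧ valuation F (e - 1) < 1 := by
  let := IsTopologicalAddGroup.rightUniformSpace F
  have := isUniformAddGroup_of_addCommGroup (G := F)
  have : HenselianRing 𝒪[F] 𝓂[F] := inferInstance
  let y' : 𝒪[F] := ⟨y, hy.le⟩
  have hy' : y' ∈ 𝓂[F] := by
    rw [IsLocalRing.mem_maximalIdeal, mem_nonunits_iff,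
      Valuation.Integer.not_isUnit_iff_valuation_lt_one]
    exact hy
  -- Hensel's lemma for `X ^ 2 - (1 + y)` at the approximate root `1`
  obtain ⟨a, ha, ha1⟩ := HenselianRing.is_henselian (I := 𝓂[F])
    (Polynomial.X ^ 2 - Polynomial.C (1 + y')) (Polynomial.monic_X_pow_sub_C _ two_ne_zero) 1
    (by simpa using hy') (by
      simp only [Polynomial.derivative_sub, Polynomial.derivative_X_pow, Polynomial.derivative_C,
        Nat.cast_ofNat, Polynomial.eval_mul, Polynomial.eval_C,
        Polynomial.eval_pow, Polynomial.eval_X, one_pow, mul_one, sub_zero]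
      exact IsUnit.mk0 (2 : 𝓀[F]) h2)
  refine ⟨a, ?_, ?_⟩
  · have : a ^ 2 - (1 + y') = 0 := by simpa [Polynomial.IsRoot] using ha
    have h' := congrArg (fun z : 𝒪[F] => (z : F)) (sub_eq_zero.mp this)
    rw [← sq]
    exact h'
  · rw [IsLocalRing.mem_maximalIdeal, mem_nonunits_iff,
      Valuation.Integer.not_isUnit_iff_valuation_lt_one] at ha1
    exact ha1

theorem residue_eq_iff (x y : 𝒪[F]) : IsLocalRing.residue 𝒪[F] x = IsLocalRing.residue 𝒪[F] y ↔
    valuation F ((x : F) - y) < 1 := by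
  rw [← sub_eq_zero, ← map_sub, IsLocalRing.residue_eq_zero_iff, IsLocalRing.mem_maximalIdeal,
    mem_nonunits_iff, Valuation.Integer.not_isUnit_iff_valuation_lt_one]
  rfl

theorem mem_congruenceSubgroup_iff (hϖ : ord ϖ = 1) (hj : 1 ≤ j) (g : GL (Fin 2) F) :
    g ∈ congruenceSubgroup F j ↔
      ∀ a b, InPow ϖ j (g a b - (1 : Matrix (Fin 2) (Fin 2) F) a b) := by
  have h1 : ∀ a b, ((1 : GL (Fin 2) (𝒪[F] ⧸ 𝓂[F] ^ j)) a b) =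
      Ideal.Quotient.mk (𝓂[F] ^ j) ((1 : Matrix (Fin 2) (Fin 2) 𝒪[F]) a b) := by
    intro a b
    simp only [Units.val_one, Matrix.one_apply]
    split_ifs <;> simp
  have key : ∀ (u : GL (Fin 2) 𝒪[F]) (a b : Fin 2),
      (GeneralLinearGroup.map (Ideal.Quotient.mk (𝓂[F] ^ j)) u) a b =
        (1 : GL (Fin 2) (𝒪[F] ⧸ 𝓂[F] ^ j)) a b ↔
      InPow ϖ j ((GeneralLinearGroup.map (𝒪[F]).subtype u) a b -
        (1 : Matrix (Fin 2) (Fin 2) F) a b) := by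
    intro u a b
    rw [h1, GeneralLinearGroup.map_apply, Ideal.Quotient.eq, mem_maximalIdeal_pow_iff hϖ]
    simp only [GeneralLinearGroup.map_apply, Matrix.one_apply, AddSubgroupClass.coe_sub]
    split_ifs <;> rfl
  constructor
  · rintro ⟨u, hu, rfl⟩ a b
    rw [← key]
    simp only [SetLike.mem_coe, MonoidHom.mem_ker] at hu
    rw [hu]
  · intro h
    have hlt : ∀ a b, valuation F (g a b - (1 : Matrix (Fin 2) (Fin 2) F) a b) < 1 :=
      fun a b => (h a b).lt_one hϖ hj
    have hone : ∀ a b, valuation F ((1 : Matrix (Fin 2) (Fin 2) F) a b) ≤ 1 := by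
      intro a b
      rw [Matrix.one_apply]
      split_ifs <;> simp
    have hle : ∀ a b, valuation F (g a b) ≤ 1 := by
      intro a b
      have := (Valuation.map_add (valuation F) _ _).trans (max_le (hlt a b).le (hone a b))
      rwa [sub_add_cancel] at this
    have h00 := hlt 0 0
    have h11 := hlt 1 1
    have h10 := hlt 1 0
    rw [Matrix.one_apply_eq] at h00 h11
    rw [Matrix.one_apply_ne (by simp), sub_zero] at h10
    have hd : ord g.det = 0 := by
      rw [ord_eq_zero_iff]
      apply IsOneUnit.val_eq
      unfold IsOneUnit
      have e : (g.det : F) - 1 = g 0 0 * (g 1 1 - 1) + (g 0 0 - 1) - g 0 1 * g 1 0 := by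
        rw [det_val]; ring
      rw [e]
      refine Valuation.map_sub_lt _ (Valuation.map_add_lt _ ?_ h00) ?_ <;> rw [map_mul]
      · rw [mul_comm]; exact mul_lt_one_of_lt_of_le h11 (hle 0 0)
      · rw [mul_comm]; exact mul_lt_one_of_lt_of_le h10 (hle 0 1)
    obtain ⟨u, rfl⟩ := mem_maxCompact hle hd
    refine ⟨u, ?_, rfl⟩
    simp only [SetLike.mem_coe, MonoidHom.mem_ker]
    ext a b
    exact (key u a b).mpr (h a b)

variable {n : ℕ} {hn : n ∣ resCard F - 1}

instance finite_residue_pow (j : ℕ) : Finite (𝒪[F] ⧸ 𝓂[F] ^ j) := by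
  have : Finite (𝒪[F] ⧸ 𝓂[F]) := inferInstanceAs (Finite 𝓀[F])
  exact Ideal.finite_quotient_pow (IsNoetherian.noetherian _) j

theorem relIndex_congruenceSubgroup_ne_zero (j : ℕ) :
    (congruenceSubgroup F j).relIndex (maxCompact F) ≠ 0 := by
  have h : (GeneralLinearGroup.map (Ideal.Quotient.mk (𝓂[F] ^ j))).ker.relIndex
      (⊤ : Subgroup (GL (Fin 2) 𝒪[F])) ≠ 0 := by
    rw [Subgroup.relIndex_ker]
    exact Nat.card_pos.ne'
  rw [maxCompact, MonoidHom.range_eq_map, congruenceSubgroup, Subgroup.relIndex_map_map,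
    top_sup_eq]
  exact fun h0 => h (Subgroup.relIndex_eq_zero_of_le_left le_sup_left h0)

/-- The index is finite because `K_j` has finite index in `K`, its preimage being cut down to
`K_j × {1}` by the finite group of roots of unity. -/
theorem levelSubgroup_finiteIndex {H : Subgroup (Cover F n hn)} (hH : H ≤ coverK F n hn) (j : ℕ) :
    (levelSubgroup H j).FiniteIndex := by
  let L : Subgroup (Cover F n hn) := (congruenceSubgroup F (max 1 j)).comap Cover.proj
  have h1 : L.relIndex (coverK F n hn) ≠ 0 :=
    Subgroup.relIndex_comap_ne_zero _ (relIndex_congruenceSubgroup_ne_zero _)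
  have h2 : (congruenceLift hn j).relIndex L ≠ 0 := by
    let r : L →* rootsOfUnity n 𝓀[F] :=
      { toFun := fun x => x.1.root
        map_one' := rfl
        map_mul' := fun x y => by
          have hx : x.1.mat ∈ congruenceSubgroup F (max 1 j) := x.2
          have hy : y.1.mat ∈ congruenceSubgroup F (max 1 j) := y.2
          rw [Subgroup.coe_mul, Cover.mul_root, cocycle_congruence hn
            (congruenceSubgroup_anti (le_max_left 1 j) hx)
            (congruenceSubgroup_anti (le_max_left 1 j) hy), one_mul] }
    have hr : (congruenceLift hn j).subgroupOf L = r.ker := by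
      ext x
      exact ⟨fun h => h.2, fun h => ⟨x.2, h⟩⟩
    rw [Subgroup.relIndex, hr, Subgroup.index_ker]
    exact Nat.card_pos.ne'
  have h3 := Subgroup.relIndex_ne_zero_trans h2 h1
  exact ⟨fun h0 => h3 (Subgroup.relIndex_eq_zero_of_le_right hH h0)⟩

end LocalField

/-! ### Functions of level `r + 1` along the congruence subgroup of level `r` -/

section Matrices

open Matrix

variable {F : Type*} [Field F]

theorem mul_top_left (g h : GL (Fin 2) F) :
    (g * h) 0 0 = g 0 0 * h 0 0 + g 0 1 * h 1 0 := by
  simp [Matrix.mul_apply, Fin.sum_univ_two]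

theorem inv_bottom_left {g : GL (Fin 2) F} (h : g.det = 1) : g⁻¹ 1 0 = -g 1 0 := by
  have hd : (g : Matrix (Fin 2) (Fin 2) F).det = 1 := congrArg Units.val h
  rw [Matrix.coe_units_inv, Matrix.inv_def, hd, Matrix.adjugate_fin_two]
  simp

theorem inv_bottom_right {g : GL (Fin 2) F} (h : g.det = 1) : g⁻¹ 1 1 = g 0 0 := by
  have hd : (g : Matrix (Fin 2) (Fin 2) F).det = 1 := congrArg Units.val h
  rw [Matrix.coe_units_inv, Matrix.inv_def, hd, Matrix.adjugate_fin_two]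
  simp

theorem inv_top_left {g : GL (Fin 2) F} (h : g.det = 1) : g⁻¹ 0 0 = g 1 1 := by
  have hd : (g : Matrix (Fin 2) (Fin 2) F).det = 1 := congrArg Units.val h
  rw [Matrix.coe_units_inv, Matrix.inv_def, hd, Matrix.adjugate_fin_two]
  simp

theorem inv_top_right {g : GL (Fin 2) F} (h : g.det = 1) : g⁻¹ 0 1 = -g 0 1 := by
  have hd : (g : Matrix (Fin 2) (Fin 2) F).det = 1 := congrArg Units.val h
  rw [Matrix.coe_units_inv, Matrix.inv_def, hd, Matrix.adjugate_fin_two]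
  simp

/-- The invertible matrix with rows `(a, b)` and `(c, d)`. -/
noncomputable def mat2 (a b c d : F) (h : a * d - b * c ≠ 0) : GL (Fin 2) F :=
  GeneralLinearGroup.mkOfDetNeZero !![a, b; c, d] (by rwa [Matrix.det_fin_two_of])

section mat2
variable {a b c d : F} {h : a * d - b * c ≠ 0}
@[simp] theorem mat2_zero_zero : mat2 a b c d h 0 0 = a := rfl
@[simp] theorem mat2_zero_one : mat2 a b c d h 0 1 = b := rfl
@[simp] theorem mat2_one_zero : mat2 a b c d h 1 0 = c := rfl
@[simp] theorem mat2_one_one : mat2 a b c d h 1 1 = d := rfl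
end mat2

theorem det_matrix_ne_zero (g : GL (Fin 2) F) : (g.det : F) * 1 - 0 * 0 ≠ 0 := by
  rw [mul_one, zero_mul, sub_zero]
  exact g.det.ne_zero

end Matrices

section SL2

open ValuativeRel Matrix

variable {F : Type*} [Field F] [ValuativeRel F] [TopologicalSpace F]
  [IsNonarchimedeanLocalField F] {n : ℕ} {hn : n ∣ resCard F - 1}

theorem det_eq_one_of_mem {x : Cover F n hn} (hx : x ∈ coverK1 F n hn) : x.mat.det = 1 := hx.2

theorem valuation_entry_le {x : Cover F n hn} (hx : x ∈ coverK F n hn) (a b : Fin 2) :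
    valuation F (x.mat a b) ≤ 1 :=
  valuation_le_of_mem (show x.mat ∈ maxCompact F from hx) a b

theorem entries_det_one {x : Cover F n hn} (hx : x ∈ coverK1 F n hn) :
    x.mat 0 0 * x.mat 1 1 - x.mat 0 1 * x.mat 1 0 = 1 := by
  rw [← det_val, det_eq_one_of_mem hx, Units.val_one]

/-- The element `((a, b; c, d), 1)` of `K̃¹`. -/
noncomputable def mkK1 (a b c d : F) (ha : valuation F a ≤ 1) (hb : valuation F b ≤ 1)
    (hc : valuation F c ≤ 1) (hd : valuation F d ≤ 1) (h : a * d - b * c = 1) :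
    coverK1 F n hn :=
  ⟨⟨mat2 a b c d (by rw [h]; exact one_ne_zero), 1⟩, by
    have hdet : (mat2 a b c d (by rw [h]; exact one_ne_zero)).det = 1 := by
      ext
      rw [det_val]
      simpa using h
    refine ⟨mem_maxCompact (fun i j => ?_) ?_, hdet⟩
    · fin_cases i <;> fin_cases j <;> simpa [Cover.proj]
    · exact (congrArg ord hdet).trans ord_one⟩

variable {ϖ : Fˣ} {r : ℕ}

theorem mem_congruenceLift_iff (hϖ : ord ϖ = 1) {j : ℕ} (hj : 1 ≤ j) (x : Cover F n hn) :
    x ∈ congruenceLift hn j ↔ (InPow ϖ j (x.mat 0 0 - 1) ∧ InPow ϖ j (x.mat 0 1) ∧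
      InPow ϖ j (x.mat 1 0) ∧ InPow ϖ j (x.mat 1 1 - 1)) ∧ x.root = 1 := by
  change x.mat ∈ congruenceSubgroup F (max 1 j) ∧ x.root = 1 ↔ _
  rw [max_eq_right hj, mem_congruenceSubgroup_iff hϖ hj]
  refine and_congr_left fun _ => ?_
  constructor
  · intro h
    have h01 := h 0 1
    have h10 := h 1 0
    have h00 := h 0 0
    have h11 := h 1 1
    rw [Matrix.one_apply_ne (by simp), sub_zero] at h01 h10
    rw [Matrix.one_apply_eq] at h00 h11
    exact ⟨h00, h01, h10, h11⟩
  · rintro ⟨h00, h01, h10, h11⟩ a b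
    fin_cases a <;> fin_cases b <;> simpa

/-- The conditions on a character of `B̃ ∩ H` under which the level quotient at level `r + 1` is
analyzed: it is multiplicative, depends only on the diagonal entries and the root of unity, and is
trivial on the elements of `K_1 × {1}` whose diagonal entries are congruent to `1` modulo
`𝔭 ^ r`. -/
structure IsLevelChar (ϖ : Fˣ) (r : ℕ) {H : Subgroup (Cover F n hn)}
    (χ : (coverB F n hn).subgroupOf H → ℂ) : Prop where
  mul : ∀ b b', χ (b * b') = χ b * χ b'
  one : χ 1 = 1
  triv : ∀ b : (coverB F n hn).subgroupOf H, (b : H).1 ∈ congruenceLift hn 1 →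
    InPow ϖ r ((b : H).1.mat 0 0 - 1) → InPow ϖ r ((b : H).1.mat 1 1 - 1) → χ b = 1
  congr : ∀ b b' : (coverB F n hn).subgroupOf H, (b : H).1.mat 0 0 = (b' : H).1.mat 0 0 →
    (b : H).1.mat 1 1 = (b' : H).1.mat 1 1 → (b : H).1.root = (b' : H).1.root → χ b = χ b'

theorem IsLevelChar.triv_of_mem (hϖ : ord ϖ = 1) (hr : 1 ≤ r) {H : Subgroup (Cover F n hn)}
    {χ : (coverB F n hn).subgroupOf H → ℂ} (hχ : IsLevelChar ϖ r χ)
    (b : (coverB F n hn).subgroupOf H) (hb : (b : H) ∈ levelSubgroup H r) : χ b = 1 := by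
  have h := (mem_congruenceLift_iff hϖ hr _).mp (show (b : H).1 ∈ congruenceLift hn r from hb)
  exact hχ.triv b (congruenceLift_anti hn hr hb) h.1.1 h.1.2.2.2

/-- The lower unipotent element with entry `x`. -/
noncomputable def lowerK1 (x : F) (hx : valuation F x ≤ 1) : coverK1 F n hn :=
  mkK1 1 0 x 1 (by simp) (by simp) hx (by simp) (by ring)

theorem lowerK1_mem (hϖ : ord ϖ = 1) {j : ℕ} (hj : 1 ≤ j) {x : F} (hx : InPow ϖ j x) :
    lowerK1 x (hx.le_one hϖ) ∈ levelSubgroup (coverK1 F n hn) j := by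
  refine (mem_congruenceLift_iff hϖ hj _).mpr ⟨⟨?_, ?_, hx, ?_⟩, rfl⟩ <;>
    simp [lowerK1, mkK1, inPow_zero]

variable {χ : (coverB F n hn).subgroupOf (coverK1 F n hn) → ℂ}

/-- A lower unipotent element of `K¹_{r+1}` makes `w` upper triangular, and `χ` is trivial on the
result. -/
theorem apply_mul_of_inPow (hϖ : ord ϖ = 1) (hr : 1 ≤ r) (hχ : IsLevelChar ϖ r χ)
    (f : levelFun _ χ (levelSubgroup (coverK1 F n hn) (r + 1))) {w : coverK1 F n hn}
    (hw : w ∈ levelSubgroup (coverK1 F n hn) r) (h10 : InPow ϖ (r + 1) (w.1.mat 1 0))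
    (g : coverK1 F n hn) : f.1 (w * g) = f.1 g := by
  have hw' := (mem_congruenceLift_iff hϖ hr _).mp (show w.1 ∈ congruenceLift hn r from hw)
  have u11 : IsOneUnit (w.1.mat 1 1) := hw'.1.2.2.2.lt_one hϖ hr
  have n11 : w.1.mat 1 1 ≠ 0 := by
    intro h; have := u11.val_eq; simp [h] at this
  have hz : InPow ϖ (r + 1) (-(w.1.mat 1 0 / w.1.mat 1 1)) := by
    rw [InPow, Valuation.map_neg, map_div₀, u11.val_eq, div_one]
    exact h10
  have hl := lowerK1_mem (n := n) (hn := hn) hϖ (by omega) hz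
  have hb : w * lowerK1 _ (hz.le_one hϖ) ∈ (coverB F n hn).subgroupOf (coverK1 F n hn) := by
    change (w.1.mat * (lowerK1 (n := n) (hn := hn) _ (hz.le_one hϖ)).1.mat) 1 0 = 0
    rw [mul_bottom_left]
    simp only [lowerK1, mkK1, mat2_zero_zero, mat2_one_zero]
    field_simp
    ring
  have hχ1 : χ ⟨_, hb⟩ = 1 := hχ.triv_of_mem hϖ hr _
    (Subgroup.mul_mem _ hw (levelSubgroup_anti _ (Nat.le_succ r) hl))
  have e : w * g = ((⟨_, hb⟩ : (coverB F n hn).subgroupOf (coverK1 F n hn)) : coverK1 F n hn) *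
      ((lowerK1 _ (hz.le_one hϖ))⁻¹ * g) := by
    simp only [mul_assoc, mul_inv_cancel_left]
  rw [e, levelFun_left, hχ1, one_mul,
    levelFun_left_normal (levelSubgroup_normal (coverK1_le hn) _) f (Subgroup.inv_mem _ hl)]

/-- The value at `v g` for `v ∈ K¹_r` depends on `v` only through its lower left entry modulo
`𝔭 ^ (r + 1)`. -/
theorem apply_mul_congr (hϖ : ord ϖ = 1) (hr : 1 ≤ r) (hχ : IsLevelChar ϖ r χ)
    (f : levelFun _ χ (levelSubgroup (coverK1 F n hn) (r + 1))) {v v' : coverK1 F n hn}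
    (hv : v ∈ levelSubgroup (coverK1 F n hn) r) (hv' : v' ∈ levelSubgroup (coverK1 F n hn) r)
    (h10 : InPow ϖ (r + 1) (v.1.mat 1 0 - v'.1.mat 1 0))
    (g : coverK1 F n hn) : f.1 (v * g) = f.1 (v' * g) := by
  have e : v * g = (v * v'⁻¹) * (v' * g) := by group
  rw [e]
  apply apply_mul_of_inPow hϖ hr hχ f (Subgroup.mul_mem _ hv (Subgroup.inv_mem _ hv'))
  change InPow ϖ (r + 1) ((v.1.mat * v'.1.mat⁻¹) 1 0)
  have hd := det_eq_one_of_mem v'.2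
  rw [mul_bottom_left, inv_bottom_left hd, inv_top_left hd]
  have a := (mem_congruenceLift_iff hϖ hr _).mp (show v.1 ∈ congruenceLift hn r from hv)
  have a' := (mem_congruenceLift_iff hϖ hr _).mp (show v'.1 ∈ congruenceLift hn r from hv')
  have e2 : v.1.mat 1 0 * v'.1.mat 1 1 + v.1.mat 1 1 * -v'.1.mat 1 0 =
      v.1.mat 1 0 * (v'.1.mat 1 1 - 1) - (v.1.mat 1 1 - 1) * v'.1.mat 1 0 +
        (v.1.mat 1 0 - v'.1.mat 1 0) := by ring
  rw [e2]
  exact (((a.1.2.2.1.mul a'.1.2.2.2).mono hϖ (by omega)).sub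
    ((a.1.2.2.2.mul a'.1.2.2.1).mono hϖ (by omega))).add h10

/-- A set-theoretic section of the reduction map. -/
noncomputable def resLift (x : 𝓀[F]) : 𝒪[F] :=
  Function.surjInv IsLocalRing.residue_surjective x

theorem residue_resLift (x : 𝓀[F]) : IsLocalRing.residue 𝒪[F] (resLift x) = x :=
  Function.surjInv_eq _ x

/-- The lower unipotent element with entry `ϖ ^ r x̂`, where `x̂` lifts `x`. -/
noncomputable def unip (hϖ : ord ϖ = 1) (r : ℕ) (x : 𝓀[F]) : coverK1 F n hn :=
  lowerK1 ((ϖ : F) ^ r * resLift x) ((inPow_uniformizer_mul r (resLift x)).le_one hϖ)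

theorem unip_mem (hϖ : ord ϖ = 1) (hr : 1 ≤ r) (x : 𝓀[F]) :
    unip hϖ r x ∈ levelSubgroup (coverK1 F n hn) r :=
  lowerK1_mem hϖ hr (inPow_uniformizer_mul r (resLift x))

/-- Along `K¹_r g`, a function of level `r + 1` is given by its values at `unip hϖ r x * g`, for `x`
in the residue field. -/
theorem apply_mul_eq_unip (hϖ : ord ϖ = 1) (hr : 1 ≤ r) (hχ : IsLevelChar ϖ r χ)
    (f : levelFun _ χ (levelSubgroup (coverK1 F n hn) (r + 1))) {v : coverK1 F n hn}
    (hv : v ∈ levelSubgroup (coverK1 F n hn) r) {y : 𝒪[F]}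
    (h10 : v.1.mat 1 0 = (ϖ : F) ^ r * y) (g : coverK1 F n hn) :
    f.1 (v * g) = f.1 (unip hϖ r (IsLocalRing.residue 𝒪[F] y) * g) := by
  apply apply_mul_congr hϖ hr hχ f hv (unip_mem hϖ hr _)
  rw [h10]
  change InPow ϖ (r + 1) (_ - (ϖ : F) ^ r * _)
  rw [← mul_sub]
  refine InPow.mul (i := r) (by rw [InPow, map_pow]) ?_
  rw [inPow_one_iff hϖ]
  exact (residue_eq_iff _ _).mp (residue_resLift _).symm

theorem apply_unip_zero_mul (hϖ : ord ϖ = 1) (hr : 1 ≤ r) (hχ : IsLevelChar ϖ r χ)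
    (f : levelFun _ χ (levelSubgroup (coverK1 F n hn) (r + 1))) (g : coverK1 F n hn) :
    f.1 (unip hϖ r 0 * g) = f.1 g := by
  have := apply_mul_eq_unip hϖ hr hχ f (Subgroup.one_mem _) (y := 0)
    (by simp [Cover.one_mat]) g
  rw [map_zero, one_mul] at this
  exact this.symm

theorem apply_unip_mul_unip (hϖ : ord ϖ = 1) (hr : 1 ≤ r) (hχ : IsLevelChar ϖ r χ)
    (f : levelFun _ χ (levelSubgroup (coverK1 F n hn) (r + 1))) (x : 𝓀[F]) {v : coverK1 F n hn}
    (hv : v ∈ levelSubgroup (coverK1 F n hn) r) {y : 𝒪[F]}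
    (h10 : v.1.mat 1 0 = (ϖ : F) ^ r * y) (g : coverK1 F n hn) :
    f.1 (unip hϖ r x * (v * g)) = f.1 (unip hϖ r (x + IsLocalRing.residue 𝒪[F] y) * g) := by
  have a := (mem_congruenceLift_iff hϖ hr _).mp (show v.1 ∈ congruenceLift hn r from hv)
  have h00 : valuation F (v.1.mat 0 0) ≤ 1 := valuation_entry_le (coverK1_le hn v.2) 0 0
  have := apply_mul_eq_unip hϖ hr hχ f (Subgroup.mul_mem _ (unip_mem hϖ hr x) hv)
    (y := resLift x * ⟨v.1.mat 0 0, h00⟩ + y) (by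
      change (_ * v.1.mat) 1 0 = _
      rw [mul_bottom_left, h10]
      simp only [unip, lowerK1, mkK1, mat2_one_zero, mat2_one_one]
      change _ = (ϖ : F) ^ r * ((resLift x : F) * v.1.mat 0 0 + (y : F))
      ring) g
  rw [mul_assoc] at this
  rw [this, map_add, map_mul, residue_resLift]
  have h1 : IsLocalRing.residue 𝒪[F] ⟨v.1.mat 0 0, h00⟩ = 1 := by
    rw [← map_one (IsLocalRing.residue 𝒪[F]), residue_eq_iff]
    exact a.1.1.lt_one hϖ hr
  rw [h1, mul_one]

theorem isUnit_diag {b : coverK1 F n hn} (hb : b ∈ (coverB F n hn).subgroupOf (coverK1 F n hn)) :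
    b.1.mat 0 0 * b.1.mat 1 1 = 1 := by
  have h0 : b.1.mat 1 0 = 0 := hb
  have := entries_det_one b.2
  rwa [h0, mul_zero, sub_zero] at this

/-- The reduction of the upper left entry. -/
noncomputable def resEntry (b : coverK1 F n hn) : 𝓀[F] :=
  IsLocalRing.residue 𝒪[F] ⟨b.1.mat 0 0, valuation_entry_le (coverK1_le hn b.2) 0 0⟩

theorem resEntry_ne_zero {b : coverK1 F n hn}
    (hb : b ∈ (coverB F n hn).subgroupOf (coverK1 F n hn)) : resEntry b ≠ 0 := by
  intro h
  have h1 : (1 : 𝓀[F]) = resEntry b * IsLocalRing.residue 𝒪[F]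
      ⟨b.1.mat 1 1, valuation_entry_le (coverK1_le hn b.2) 1 1⟩ := by
    rw [resEntry, ← map_mul, ← map_one (IsLocalRing.residue 𝒪[F])]
    congr 1
    ext
    exact (isUnit_diag hb).symm
  rw [h, zero_mul] at h1
  exact one_ne_zero h1

/-- Moving `b` past `unip` multiplies the coordinate by the square of its upper left entry. -/
theorem apply_unip_mul_borel (hϖ : ord ϖ = 1) (hr : 1 ≤ r) (hχ : IsLevelChar ϖ r χ)
    (f : levelFun _ χ (levelSubgroup (coverK1 F n hn) (r + 1))) (x : 𝓀[F])
    (b : (coverB F n hn).subgroupOf (coverK1 F n hn)) (g : coverK1 F n hn) :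
    f.1 (unip hϖ r x * ((b : coverK1 F n hn) * g)) =
      χ b * f.1 (unip hϖ r (resEntry b.1 ^ 2 * x) * g) := by
  have e : unip hϖ r x * ((b : coverK1 F n hn) * g) =
      (b : coverK1 F n hn) * (((b : coverK1 F n hn)⁻¹ * unip hϖ r x *
      ((b : coverK1 F n hn)⁻¹)⁻¹) * g) := by group
  have hv := (levelSubgroup_normal (coverK1_le hn) r).conj_mem _ (unip_mem hϖ hr x)
    (b : coverK1 F n hn)⁻¹
  have h0 : b.1.1.mat 1 0 = 0 := b.2
  rw [e, levelFun_left]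
  congr 1
  have h00 := valuation_entry_le (coverK1_le hn b.1.2) 0 0
  rw [apply_mul_eq_unip hϖ hr hχ f hv (y := ⟨b.1.1.mat 0 0, h00⟩ ^ 2 * resLift x) ?_ g]
  · rw [map_mul, map_pow, residue_resLift]
    rfl
  · rw [inv_inv]
    change (b.1.1.mat⁻¹ * _ * b.1.1.mat) 1 0 = (ϖ : F) ^ r * (b.1.1.mat 0 0 ^ 2 * (resLift x : F))
    have hd := det_eq_one_of_mem b.1.2
    rw [mul_assoc, mul_bottom_left, inv_bottom_left hd, inv_bottom_right hd, h0, mul_bottom_left,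
      h0]
    simp only [unip, lowerK1, mkK1, mat2_one_zero, mat2_one_one]
    ring

end SL2

/-! ### Convolution operators and the quadratic character -/

section Operators

open ValuativeRel Matrix

variable {F : Type*} [Field F] [ValuativeRel F] [TopologicalSpace F]
  [IsNonarchimedeanLocalField F] {n : ℕ} {hn : n ∣ resCard F - 1}

noncomputable instance residueFieldFintype : Fintype 𝓀[F] := Fintype.ofFinite _

variable {ϖ : Fˣ} {r : ℕ} {χ : (coverB F n hn).subgroupOf (coverK1 F n hn) → ℂ}

/-- The intertwining operator `f ↦ ∑ φ(x) f(u(x) g)`, the sum being over the residue field, for a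
function `φ` which is invariant under multiplication by nonzero squares. -/
noncomputable def convOp (hϖ : ord ϖ = 1) (hr : 1 ≤ r) (hχ : IsLevelChar ϖ r χ) (φ : 𝓀[F] → ℂ)
    (hφ : ∀ t x, t ≠ 0 → φ (t ^ 2 * x) = φ x) :
    levelFun _ χ (levelSubgroup (coverK1 F n hn) (r + 1)) →ₗ[ℂ]
      levelFun _ χ (levelSubgroup (coverK1 F n hn) (r + 1)) where
  toFun f := ⟨fun g => ∑ x, φ x * f.1 (unip hϖ r x * g), by
    constructor
    · intro b g
      rw [Finset.mul_sum]
      refine Fintype.sum_equiv (Equiv.mulLeft₀ (resEntry b.1 ^ 2)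
        (pow_ne_zero _ (resEntry_ne_zero b.2))) _ _ fun x => ?_
      rw [apply_unip_mul_borel hϖ hr hχ, Equiv.mulLeft₀_apply,
        hφ _ _ (resEntry_ne_zero b.2)]
      ring
    · intro u hu g
      refine Finset.sum_congr rfl fun x _ => ?_
      rw [← mul_assoc, levelFun_right f hu]⟩
  map_add' f f' := by
    ext g
    simp [mul_add, Finset.sum_add_distrib]
  map_smul' c f := by
    ext g
    simp [Finset.mul_sum, mul_left_comm]

variable (hϖ : ord ϖ = 1) (hr : 1 ≤ r) (hχ : IsLevelChar ϖ r χ) {φ ψ : 𝓀[F] → ℂ}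
  (hφ : ∀ t x, t ≠ 0 → φ (t ^ 2 * x) = φ x) (hψ : ∀ t x, t ≠ 0 → ψ (t ^ 2 * x) = ψ x)
  (f : levelFun _ χ (levelSubgroup (coverK1 F n hn) (r + 1)))

theorem convOp_apply (g : coverK1 F n hn) :
    (convOp hϖ hr hχ φ hφ f).1 g = ∑ x, φ x * f.1 (unip hϖ r x * g) := rfl

theorem convOp_comm (h : coverK1 F n hn) :
    convOp hϖ hr hχ φ hφ (levelFunRep _ χ _ (levelSubgroup_normal (coverK1_le hn) (r + 1)) h f) =
      levelFunRep _ χ _ (levelSubgroup_normal (coverK1_le hn) (r + 1)) h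
        (convOp hϖ hr hχ φ hφ f) := by
  ext g
  simp only [convOp_apply, levelFunRep_apply, mul_assoc]

theorem unip_bottom_left (x : 𝓀[F]) :
    (unip (n := n) (hn := hn) hϖ r x).1.mat 1 0 = (ϖ : F) ^ r * resLift x := rfl

theorem convOp_unip (y : 𝓀[F]) (g : coverK1 F n hn) :
    (convOp hϖ hr hχ φ hφ f).1 (unip hϖ r y * g) =
      ∑ x, φ (x - y) * f.1 (unip hϖ r x * g) := by
  rw [convOp_apply]
  refine Fintype.sum_equiv (Equiv.addRight y) _ _ fun x => ?_
  rw [apply_unip_mul_unip hϖ hr hχ f x (unip_mem hϖ hr y) (unip_bottom_left hϖ y),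
    residue_resLift, Equiv.coe_addRight, add_sub_cancel_right]

theorem convOp_convOp (g : coverK1 F n hn) :
    (convOp hϖ hr hχ φ hφ (convOp hϖ hr hχ ψ hψ f)).1 g =
      ∑ z, (∑ x, φ x * ψ (z - x)) * f.1 (unip hϖ r z * g) := by
  rw [convOp_apply]
  simp only [convOp_unip hϖ hr hχ hψ, Finset.mul_sum, Finset.sum_mul, mul_assoc]
  exact Finset.sum_comm

theorem convOp_of_mem (hf : f.1 ∈ levelFun _ χ (levelSubgroup (coverK1 F n hn) r))
    (g : coverK1 F n hn) : (convOp hϖ hr hχ φ hφ f).1 g = (∑ x, φ x) * f.1 g := by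
  rw [convOp_apply, Finset.sum_mul]
  refine Finset.sum_congr rfl fun x _ => ?_
  rw [levelFun_left_normal (levelSubgroup_normal (coverK1_le hn) r) ⟨f.1, hf⟩ (unip_mem hϖ hr x)]

/-- Averaging over `K¹_r` lowers the level. -/
theorem convOp_const_mem (c : ℂ) (hc : ∀ t x : 𝓀[F], t ≠ 0 → (fun _ : 𝓀[F] => c) (t ^ 2 * x) =
    (fun _ : 𝓀[F] => c) x) :
    (convOp hϖ hr hχ (fun _ => c) hc f).1 ∈
      levelFun _ χ (levelSubgroup (coverK1 F n hn) r) := by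
  refine ⟨(convOp hϖ hr hχ (fun _ => c) hc f).2.1, fun u hu g => ?_⟩
  have hv := (levelSubgroup_normal (coverK1_le hn) r).conj_mem _ hu g
  have e : g * u = (g * u * g⁻¹) * g := by group
  have hv' := (mem_congruenceLift_iff hϖ hr _).mp
    (show (g * u * g⁻¹).1 ∈ congruenceLift hn r from hv)
  obtain ⟨y, hy⟩ := exists_integer_of_inPow hv'.1.2.2.1
  rw [convOp_apply, convOp_apply, e]
  refine Fintype.sum_equiv (Equiv.addRight (IsLocalRing.residue 𝒪[F] y)) _ _ fun x => ?_
  rw [apply_unip_mul_unip hϖ hr hχ f x hv hy, Equiv.coe_addRight]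

open Classical in
/-- The quadratic character of the residue field, with values in `ℂ`. -/
noncomputable def resQuad (x : 𝓀[F]) : ℂ := (quadraticChar 𝓀[F] x : ℤ)

theorem resQuad_mul (x y : 𝓀[F]) : resQuad (x * y) = resQuad x * resQuad y := by
  rw [resQuad, map_mul, Int.cast_mul]
  rfl

theorem resQuad_zero : resQuad (0 : 𝓀[F]) = 0 := by
  simp [resQuad]

theorem resQuad_one : resQuad (1 : 𝓀[F]) = 1 := by
  simp [resQuad]

theorem resQuad_sq {t : 𝓀[F]} (ht : t ≠ 0) : resQuad t * resQuad t = 1 := by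
  classical
  have := quadraticChar_sq_one ht
  rw [resQuad, ← Int.cast_mul, ← sq]
  convert congrArg (Int.cast : ℤ → ℂ) this
  simp

theorem resQuad_sq_mul (t x : 𝓀[F]) (ht : t ≠ 0) : resQuad (t ^ 2 * x) = resQuad x := by
  rw [resQuad_mul, sq, resQuad_mul, resQuad_sq ht, one_mul]

theorem exists_sq_of_resQuad {x : 𝓀[F]} (h : resQuad x = 1) : ∃ t, t ≠ 0 ∧ x = t ^ 2 := by
  classical
  have hx : x ≠ 0 := by
    rintro rfl
    rw [resQuad_zero] at h
    exact zero_ne_one h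
  have h1 : quadraticChar 𝓀[F] x = 1 := by
    have : ((quadraticChar 𝓀[F] x : ℤ) : ℂ) = ((1 : ℤ) : ℂ) := by
      rw [Int.cast_one, ← h, resQuad]
    exact_mod_cast this
  obtain ⟨t, rfl⟩ := (quadraticChar_one_iff_isSquare hx).mp h1
  exact ⟨t, fun h0 => hx (by rw [h0, mul_zero]), (sq t).symm⟩

theorem resQuad_dichotomy {x : 𝓀[F]} (hx : x ≠ 0) : resQuad x = 1 ∨ resQuad x = -1 :=
  mul_self_eq_one_iff.mp (resQuad_sq hx)

theorem exists_resQuad_neg_one (h2 : ringChar 𝓀[F] ≠ 2) : ∃ x : 𝓀[F], resQuad x = -1 := by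
  classical
  obtain ⟨x, hx⟩ := quadraticChar_exists_neg_one h2
  refine ⟨x, ?_⟩
  have : ((quadraticChar 𝓀[F] x : ℤ) : ℂ) = ((-1 : ℤ) : ℂ) := by rw [hx]
  rw [resQuad]
  convert this
  simp

theorem sum_resQuad (h2 : ringChar 𝓀[F] ≠ 2) : ∑ x : 𝓀[F], resQuad x = 0 := by
  classical
  have := congrArg (Int.cast : ℤ → ℂ) (quadraticChar_sum_zero h2)
  rw [Int.cast_sum, Int.cast_zero] at this
  rw [← this]
  refine Finset.sum_congr rfl fun x _ => ?_
  rw [resQuad]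

theorem sum_resQuad_jacobi (h2 : ringChar 𝓀[F] ≠ 2) :
    ∑ x : 𝓀[F], resQuad x * resQuad (1 - x) = -resQuad (-1 : 𝓀[F]) := by
  classical
  have h := jacobiSum_nontrivial_inv (quadraticChar_ne_one h2)
  rw [(quadraticChar_isQuadratic 𝓀[F]).inv, jacobiSum] at h
  have h' := congrArg (Int.cast : ℤ → ℂ) h
  rw [Int.cast_sum, Int.cast_neg] at h'
  have e : ∀ x : 𝓀[F], resQuad x = ((quadraticChar 𝓀[F] x : ℤ) : ℂ) := by
    intro x
    rw [resQuad]
  simp only [e]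
  rw [← h']
  refine Finset.sum_congr rfl fun x _ => ?_
  rw [Int.cast_mul]

open Classical in
/-- The self-convolution of the quadratic character is a Jacobi sum. -/
theorem resQuad_conv (h2 : ringChar 𝓀[F] ≠ 2) (z : 𝓀[F]) :
    ∑ x : 𝓀[F], resQuad x * resQuad (z - x) =
      resQuad (-1 : 𝓀[F]) * ((if z = 0 then (Fintype.card 𝓀[F] : ℂ) else 0) - 1) := by
  by_cases hz : z = 0
  · subst hz
    rw [if_pos rfl]
    have e : ∀ x : 𝓀[F], resQuad x * resQuad (0 - x) =
        resQuad (-1 : 𝓀[F]) * ((1 : ℂ) - if x = 0 then 1 else 0) := by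
      intro x
      rw [zero_sub, neg_eq_neg_one_mul x, resQuad_mul]
      split_ifs with hx
      · subst hx
        simp [resQuad_zero]
      · rw [mul_left_comm, resQuad_sq hx, sub_zero]
    rw [Finset.sum_congr rfl fun x _ => e x, ← Finset.mul_sum, Finset.sum_sub_distrib,
      Finset.sum_ite_eq' Finset.univ (0 : 𝓀[F]) fun _ => (1 : ℂ)]
    simp
  · rw [if_neg hz, zero_sub, mul_neg_one, ← sum_resQuad_jacobi h2]
    refine (Fintype.sum_equiv (Equiv.mulLeft₀ z hz) _ _ fun x => ?_).symm
    rw [Equiv.mulLeft₀_apply, resQuad_mul, show z - z * x = z * (1 - x) by ring, resQuad_mul]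
    linear_combination (-(resQuad x * resQuad (1 - x))) * resQuad_sq hz

end Operators

/-! ### Eigenfunctions of the Borel subgroup -/

section Eigenfunctions

open ValuativeRel Matrix

variable {F : Type*} [Field F] [ValuativeRel F] [TopologicalSpace F]
  [IsNonarchimedeanLocalField F] {n : ℕ} {hn : n ∣ resCard F - 1}
  {ϖ : Fˣ} {r : ℕ} {χ : (coverB F n hn).subgroupOf (coverK1 F n hn) → ℂ}

theorem IsLevelChar.triv_level (hϖ : ord ϖ = 1) (hr : 1 ≤ r) (hχ : IsLevelChar ϖ r χ)
    (b : (coverB F n hn).subgroupOf (coverK1 F n hn))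
    (hb : (b : coverK1 F n hn) ∈ levelSubgroup (coverK1 F n hn) (r + 1)) : χ b = 1 :=
  hχ.triv_of_mem hϖ hr b (levelSubgroup_anti _ (Nat.le_succ r) hb)

theorem IsLevelChar.ne_zero {H : Subgroup (Cover F n hn)} {χ : (coverB F n hn).subgroupOf H → ℂ}
    (hχ : IsLevelChar ϖ r χ) (b : (coverB F n hn).subgroupOf H) : χ b ≠ 0 := by
  intro h
  have := hχ.mul b b⁻¹
  rw [mul_inv_cancel, hχ.one, h, zero_mul] at this
  exact one_ne_zero this

open Classical in
theorem bump_unip (hϖ : ord ϖ = 1) (hr : 1 ≤ r) (hχ : IsLevelChar ϖ r χ) (z : 𝓀[F]) :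
    (bump (N := levelSubgroup (coverK1 F n hn) (r + 1)) hχ.mul (hχ.triv_level hϖ hr)).1
      (unip hϖ r z) = if z = 0 then 1 else 0 := by
  split_ifs with hz
  · subst hz
    have h1 := apply_unip_zero_mul hϖ hr hχ
      (bump (N := levelSubgroup (coverK1 F n hn) (r + 1)) hχ.mul (hχ.triv_level hϖ hr)) 1
    rw [mul_one] at h1
    rw [h1]
    change bumpFun χ _ 1 = 1
    rw [bumpFun_of_mem hχ.mul (hχ.triv_level hϖ hr) 1 (by simp), hχ.one]
  · refine bumpFun_of_not ?_
    rintro ⟨b, hb⟩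
    apply hz
    have hb' := (mem_congruenceLift_iff hϖ (by omega) _).mp
      (show ((b : coverK1 F n hn)⁻¹ * unip hϖ r z).1 ∈ congruenceLift hn (r + 1) from hb)
    have h10 : InPow ϖ (r + 1) ((b.1.1.mat⁻¹ * (unip (n := n) (hn := hn) hϖ r z).1.mat) 1 0) :=
      hb'.1.2.2.1
    have hd := det_eq_one_of_mem b.1.2
    have h0 : b.1.1.mat 1 0 = 0 := b.2
    have v11 := valuation_entry_le (coverK1_le hn b.1.2) 1 1
    rw [mul_bottom_left, inv_bottom_left hd, inv_bottom_right hd, h0, neg_zero, zero_mul,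
      zero_add, unip_bottom_left] at h10
    have h3 := h10.mul_left v11
    have e : b.1.1.mat 1 1 * (b.1.1.mat 0 0 * ((ϖ : F) ^ r * (resLift z : F))) =
        (ϖ : F) ^ r * resLift z := by
      linear_combination ((ϖ : F) ^ r * (resLift z : F)) * isUnit_diag b.2
    rw [e, InPow, map_mul, map_pow, pow_succ] at h3
    have hp : 0 < valuation F (ϖ : F) ^ r :=
      zero_lt_iff.mpr (pow_ne_zero _ ((map_ne_zero _).mpr ϖ.ne_zero))
    have h4 := (mul_le_mul_iff_right₀ hp).mp h3
    rw [← residue_resLift z, ← map_zero (IsLocalRing.residue 𝒪[F]), residue_eq_iff]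
    rw [ZeroMemClass.coe_zero, sub_zero]
    exact h4.trans_lt (valuation_uniformizer_lt hϖ)

theorem convOp_bump_unip (hϖ : ord ϖ = 1) (hr : 1 ≤ r) (hχ : IsLevelChar ϖ r χ) {φ : 𝓀[F] → ℂ}
    (hφ : ∀ t x, t ≠ 0 → φ (t ^ 2 * x) = φ x) (y : 𝓀[F]) :
    (convOp hϖ hr hχ φ hφ
      (bump (N := levelSubgroup (coverK1 F n hn) (r + 1)) hχ.mul (hχ.triv_level hϖ hr))).1
      (unip hϖ r y) = φ (-y) := by
  classical
  have h := convOp_unip hϖ hr hχ hφ (bump hχ.mul (hχ.triv_level hϖ hr)) y 1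
  rw [mul_one] at h
  rw [h]
  rw [Finset.sum_eq_single 0]
  · rw [mul_one, bump_unip hϖ hr hχ, if_pos rfl, mul_one, zero_sub]
  · intro x _ hx
    rw [mul_one, bump_unip hϖ hr hχ, if_neg hx, mul_zero]
  · exact fun h0 => (h0 (Finset.mem_univ _)).elim

section Const

variable {h : levelFun _ χ (levelSubgroup (coverK1 F n hn) (r + 1))} {A : ℂ}

theorem apply_of_mem_level (hϖ : ord ϖ = 1) (hr : 1 ≤ r) (hχ : IsLevelChar ϖ r χ)
    (hA : ∀ x, h.1 (unip hϖ r x) = A) {v : coverK1 F n hn}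
    (hv : v ∈ levelSubgroup (coverK1 F n hn) r) : h.1 v = A := by
  have hv' := (mem_congruenceLift_iff hϖ hr _).mp (show v.1 ∈ congruenceLift hn r from hv)
  obtain ⟨y, hy⟩ := exists_integer_of_inPow hv'.1.2.2.1
  have := apply_mul_eq_unip hϖ hr hχ h hv hy 1
  rwa [mul_one, mul_one, hA] at this

/-- Near the identity coset: `g = b v` with `b` upper triangular and `v ∈ K¹_r`. -/
theorem apply_mul_of_inPow_bottom (hϖ : ord ϖ = 1) (hr : 1 ≤ r) (hχ : IsLevelChar ϖ r χ)
    (hA : ∀ x, h.1 (unip hϖ r x) = A) {g u : coverK1 F n hn}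
    (hg : InPow ϖ r (g.1.mat 1 0)) (hu : u ∈ levelSubgroup (coverK1 F n hn) r) :
    h.1 (g * u) = h.1 g := by
  have hd := entries_det_one g.2
  have v1 := valuation_entry_le (coverK1_le hn g.2) 0 1
  have v0 := valuation_entry_le (coverK1_le hn g.2) 0 0
  have v11 := valuation_entry_le (coverK1_le hn g.2) 1 1
  have u11 : valuation F (g.1.mat 1 1) = 1 := by
    refine le_antisymm v11 ?_
    have o : IsOneUnit (g.1.mat 0 0 * g.1.mat 1 1) := by
      unfold IsOneUnit
      have e : g.1.mat 0 0 * g.1.mat 1 1 - 1 = g.1.mat 0 1 * g.1.mat 1 0 := by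
        linear_combination hd
      rw [e]
      exact (hg.mul_left v1).lt_one hϖ hr
    rw [← o.val_eq, map_mul]
    exact mul_le_of_le_one_left' v0
  have n11 : g.1.mat 1 1 ≠ 0 := by
    intro h0
    rw [h0, map_zero] at u11
    exact zero_ne_one u11
  have hz : InPow ϖ r (-(g.1.mat 1 0 / g.1.mat 1 1)) := by
    rw [InPow, Valuation.map_neg, map_div₀, u11, div_one]
    exact hg
  have hl := lowerK1_mem (n := n) (hn := hn) hϖ hr hz
  have hb : g * lowerK1 _ (hz.le_one hϖ) ∈ (coverB F n hn).subgroupOf (coverK1 F n hn) := by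
    change (g.1.mat * (lowerK1 (n := n) (hn := hn) _ (hz.le_one hϖ)).1.mat) 1 0 = 0
    rw [mul_bottom_left]
    simp only [lowerK1, mkK1, mat2_zero_zero, mat2_one_zero]
    field_simp
    ring
  have key : ∀ u ∈ levelSubgroup (coverK1 F n hn) r, h.1 (g * u) = χ ⟨_, hb⟩ * A := by
    intro u hu
    have e : g * u = ((⟨_, hb⟩ : (coverB F n hn).subgroupOf (coverK1 F n hn)) :
        coverK1 F n hn) * ((lowerK1 _ (hz.le_one hϖ))⁻¹ * u) := by
      simp only [mul_assoc, mul_inv_cancel_left]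
    rw [e, levelFun_left, apply_of_mem_level hϖ hr hχ hA
      (Subgroup.mul_mem _ (Subgroup.inv_mem _ hl) hu)]
  have h1 := key 1 (Subgroup.one_mem _)
  rw [mul_one] at h1
  rw [key u hu, h1]

/-- Away from the identity coset: `g u = b g k` with `b`, `k` upper triangular in `K¹_1` and with
inverse diagonal parts. Then `h (g u) = χ b * χ k * h g`, as `h` is an eigenfunction, and
`χ b * χ k = 1`. -/
theorem apply_mul_of_not_inPow_bottom (h2 : (2 : 𝓀[F]) ≠ 0) (hϖ : ord ϖ = 1) (hr : 1 ≤ r)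
    (hχ : IsLevelChar ϖ r χ)
    (hh : IsEigenvector (levelFunRep _ χ _ (levelSubgroup_normal (coverK1_le hn) (r + 1))) _ χ h)
    {g u : coverK1 F n hn} (hg : ¬ InPow ϖ r (g.1.mat 1 0))
    (hu : u ∈ levelSubgroup (coverK1 F n hn) r) : h.1 (g * u) = h.1 g := by
  have hu' := (mem_congruenceLift_iff hϖ hr _).mp (show u.1 ∈ congruenceLift hn r from hu)
  obtain ⟨⟨hu00, hu01, hu10, hu11⟩, -⟩ := hu'
  have v11 := valuation_entry_le (coverK1_le hn g.2) 1 1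
  have n10 : g.1.mat 1 0 ≠ 0 := fun h0 => hg (by rw [h0]; exact inPow_zero r)
  have hy : valuation F ((u.1.mat 0 0 - 1) + g.1.mat 1 1 * (u.1.mat 1 0 / g.1.mat 1 0)) < 1 := by
    refine Valuation.map_add_lt _ (hu00.lt_one hϖ hr) ?_
    rw [map_mul, mul_comm]
    exact mul_lt_one_of_lt_of_le (valuation_lt_of_not_inPow hg hu10) v11
  -- `b = g u k⁻¹ g⁻¹` is upper triangular with lower right entry `e`, where `e` is the upper left
  -- entry of `k`, if the bottom row of `g u` is `e` times that of `g k`; for the left entries this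
  -- says `(g u)₁₀ = e ^ 2 g₁₀`
  obtain ⟨e, he, he1⟩ := exists_sqrt_oneUnit h2 hy
  have ve : valuation F e = 1 := IsOneUnit.val_eq he1
  have ne : e ≠ 0 := by
    intro h0
    rw [h0, map_zero] at ve
    exact zero_ne_one ve
  have hY10 : (g.1.mat * u.1.mat) 1 0 = e * e * g.1.mat 1 0 := by
    rw [he, mul_bottom_left]
    field_simp
    ring
  -- the upper right entry of `k`, determined by comparing the right entries of the bottom rows
  obtain ⟨k2, hk2⟩ : ∃ k2, k2 = e⁻¹ * (u.1.mat 0 1 +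
    g.1.mat 1 1 * ((u.1.mat 1 1 - 1) / g.1.mat 1 0)) := ⟨_, rfl⟩
  have vk2 : valuation F k2 < 1 := by
    rw [hk2, map_mul, map_inv₀, ve, inv_one, one_mul]
    refine Valuation.map_add_lt _ (hu01.lt_one hϖ hr) ?_
    rw [map_mul, mul_comm]
    exact mul_lt_one_of_lt_of_le (valuation_lt_of_not_inPow hg hu11) v11
  have ve' : valuation F e⁻¹ = 1 := by rw [map_inv₀, ve, inv_one]
  let k : coverK1 F n hn := mkK1 e k2 0 e⁻¹ ve.le vk2.le (by simp) ve'.le (by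
    rw [mul_inv_cancel₀ ne, mul_zero, sub_zero])
  have k00 : k.1.mat 0 0 = e := rfl
  have k01 : k.1.mat 0 1 = k2 := rfl
  have k10 : k.1.mat 1 0 = 0 := rfl
  have k11 : k.1.mat 1 1 = e⁻¹ := rfl
  have hkB : k ∈ (coverB F n hn).subgroupOf (coverK1 F n hn) := k10
  have hk1 : k ∈ levelSubgroup (coverK1 F n hn) 1 := by
    refine (mem_congruenceLift_iff hϖ le_rfl _).mpr ⟨⟨?_, ?_, ?_, ?_⟩, rfl⟩
    · change InPow ϖ 1 (k.1.mat 0 0 - 1)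
      rw [k00]; exact (inPow_one_iff hϖ).mpr he1
    · change InPow ϖ 1 (k.1.mat 0 1)
      rw [k01]; exact (inPow_one_iff hϖ).mpr vk2
    · change InPow ϖ 1 (k.1.mat 1 0)
      rw [k10]; exact inPow_zero 1
    · change InPow ϖ 1 (k.1.mat 1 1 - 1)
      rw [k11, inPow_one_iff hϖ]
      have e2 : e⁻¹ - 1 = -(e⁻¹ * (e - 1)) := by field_simp; ring
      rw [e2, Valuation.map_neg, map_mul, ve', one_mul]
      exact he1
  have hX10 : (g.1.mat * k.1.mat) 1 0 = e * g.1.mat 1 0 := by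
    rw [mul_bottom_left, k00, k10]; ring
  have hX11 : (g.1.mat * u.1.mat) 1 1 = e * (g.1.mat * k.1.mat) 1 1 := by
    rw [mul_bottom_right, mul_bottom_right, k01, k11, hk2]
    field_simp
    ring
  have hdX : (g.1.mat * k.1.mat).det = 1 := det_eq_one_of_mem (g * k).2
  have eX : (g.1.mat * k.1.mat) 0 0 * (g.1.mat * k.1.mat) 1 1 -
      (g.1.mat * k.1.mat) 0 1 * (g.1.mat * k.1.mat) 1 0 = 1 := entries_det_one (g * k).2
  let b : coverK1 F n hn := g * u * (g * k)⁻¹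
  have b10 : b.1.mat 1 0 = 0 := by
    change (g.1.mat * u.1.mat * (g.1.mat * k.1.mat)⁻¹) 1 0 = 0
    rw [mul_bottom_left, inv_top_left hdX, inv_bottom_left hdX, hX11, hY10, hX10]
    ring
  have b11 : b.1.mat 1 1 = e := by
    change (g.1.mat * u.1.mat * (g.1.mat * k.1.mat)⁻¹) 1 1 = e
    rw [mul_bottom_right, inv_top_right hdX, inv_bottom_right hdX, hX11, hY10]
    rw [hX10] at eX
    linear_combination e * eX
  have hbB : b ∈ (coverB F n hn).subgroupOf (coverK1 F n hn) := b10
  have hb1 : b ∈ levelSubgroup (coverK1 F n hn) 1 := by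
    have e3 : b = g * (u * k⁻¹) * g⁻¹ := by simp only [b]; group
    rw [e3]
    exact (levelSubgroup_normal (coverK1_le hn) 1).conj_mem _
      (Subgroup.mul_mem _ (levelSubgroup_anti _ hr hu) (Subgroup.inv_mem _ hk1)) g
  have hχ1 : χ (⟨b, hbB⟩ * ⟨k, hkB⟩) = 1 := by
    have hbk := Subgroup.mul_mem _ hbB hkB
    have m11 : (b * k).1.mat 1 1 = 1 := by
      change (b.1.mat * k.1.mat) 1 1 = 1
      rw [mul_bottom_right, b10, b11, k11, zero_mul, zero_add, mul_inv_cancel₀ ne]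
    have m00 := isUnit_diag hbk
    rw [m11, mul_one] at m00
    refine hχ.triv _ (Subgroup.mul_mem _ hb1 hk1) ?_ ?_
    · change InPow ϖ r ((b * k).1.mat 0 0 - 1)
      rw [m00, sub_self]; exact inPow_zero r
    · change InPow ϖ r ((b * k).1.mat 1 1 - 1)
      rw [m11, sub_self]; exact inPow_zero r
  have e4 : g * u = ((⟨b, hbB⟩ : (coverB F n hn).subgroupOf (coverK1 F n hn)) :
      coverK1 F n hn) * (g * k) := by simp only [b]; group
  have h5 := congrFun (congrArg Subtype.val (hh ⟨k, hkB⟩)) g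
  rw [levelFunRep_apply] at h5
  rw [e4, levelFun_left, h5]
  rw [hχ.mul] at hχ1
  change _ * (_ * h.1 g) = _
  rw [← mul_assoc, hχ1, one_mul]

/-- An eigenfunction of the Borel subgroup which is constant on the elements `unip hϖ r x` is of
level `r`. -/
theorem mem_of_eigenvector_of_const (h2 : (2 : 𝓀[F]) ≠ 0) (hϖ : ord ϖ = 1) (hr : 1 ≤ r)
    (hχ : IsLevelChar ϖ r χ)
    (hh : IsEigenvector (levelFunRep _ χ _ (levelSubgroup_normal (coverK1_le hn) (r + 1))) _ χ h)
    (hA : ∀ x, h.1 (unip hϖ r x) = A) :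
    h.1 ∈ levelFun _ χ (levelSubgroup (coverK1 F n hn) r) := by
  refine ⟨h.2.1, fun u hu g => ?_⟩
  by_cases hg : InPow ϖ r (g.1.mat 1 0)
  · exact apply_mul_of_inPow_bottom hϖ hr hχ hA hg hu
  · exact apply_mul_of_not_inPow_bottom h2 hϖ hr hχ hh hg hu

end Const

theorem valuation_resLift {t : 𝓀[F]} (ht : t ≠ 0) : valuation F (resLift t : F) = 1 := by
  refine le_antisymm (resLift t).2 (not_lt.mp fun hlt => ht ?_)
  rw [← residue_resLift t, ← map_zero (IsLocalRing.residue 𝒪[F]), residue_eq_iff]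
  simpa using hlt

/-- Compare right and left translation by a diagonal element reducing to `diag(t, t⁻¹)`. -/
theorem apply_unip_sq_mul (hϖ : ord ϖ = 1) (hr : 1 ≤ r) (hχ : IsLevelChar ϖ r χ)
    {f : levelFun _ χ (levelSubgroup (coverK1 F n hn) (r + 1))}
    (hf : IsEigenvector (levelFunRep _ χ _ (levelSubgroup_normal (coverK1_le hn) (r + 1))) _ χ f)
    {t : 𝓀[F]} (ht : t ≠ 0) (x : 𝓀[F]) : f.1 (unip hϖ r (t ^ 2 * x)) = f.1 (unip hϖ r x) := by
  have vt := valuation_resLift ht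
  have nt : (resLift t : F) ≠ 0 := by
    intro h0
    rw [h0, map_zero] at vt
    exact zero_ne_one vt
  let b : coverK1 F n hn := mkK1 (resLift t : F) 0 0 (resLift t : F)⁻¹ vt.le (by simp) (by simp)
    (by rw [map_inv₀, vt, inv_one]) (by rw [mul_inv_cancel₀ nt, mul_zero, sub_zero])
  have hb : b ∈ (coverB F n hn).subgroupOf (coverK1 F n hn) := by
    change b.1.mat 1 0 = 0
    rfl
  have hres : resEntry b = t := by
    rw [← residue_resLift t]
    rfl
  have h1 := apply_unip_mul_borel hϖ hr hχ f x ⟨b, hb⟩ 1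
  have h2 := congrFun (congrArg Subtype.val (hf ⟨b, hb⟩)) (unip hϖ r x)
  rw [levelFunRep_apply] at h2
  rw [mul_one, mul_one, h2] at h1
  change χ _ * _ = _ at h1
  rw [hres] at h1
  exact (mul_left_cancel₀ (hχ.ne_zero _) h1).symm

/-- The operator `f ↦ ∑ η(x) f(u(x) g)` for the quadratic character `η`. -/
noncomputable def quadOp (hϖ : ord ϖ = 1) (hr : 1 ≤ r) (hχ : IsLevelChar ϖ r χ) :=
  convOp (n := n) (hn := hn) hϖ hr hχ resQuad resQuad_sq_mul

/-- On the `unip hϖ r x`, an eigenfunction depends only on the class of `x` in the residue field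
modulo nonzero squares. So, on these elements, it is a combination of the constant function, the
bump function and its image under `quadOp`. -/
theorem quadOp_eigen_span (h2 : (2 : 𝓀[F]) ≠ 0) (hϖ : ord ϖ = 1) (hr : 1 ≤ r)
    (hχ : IsLevelChar ϖ r χ) {ν : 𝓀[F]} (hν : resQuad ν = -1)
    (f : levelFun _ χ (levelSubgroup (coverK1 F n hn) (r + 1)))
    (hf : IsEigenvector (levelFunRep _ χ _ (levelSubgroup_normal (coverK1_le hn) (r + 1)))
      _ χ f) :
    ∃ a b : ℂ, (f - (a • bump hχ.mul (hχ.triv_level hϖ hr) +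
      b • quadOp hϖ hr hχ (bump hχ.mul (hχ.triv_level hϖ hr)))).1 ∈
        levelFun _ χ (levelSubgroup (coverK1 F n hn) r) := by
  classical
  have hm1 : resQuad (-1 : 𝓀[F]) * resQuad (-1 : 𝓀[F]) = 1 := resQuad_sq (by simp)
  obtain ⟨A, hA⟩ : ∃ A, A = (f.1 (unip hϖ r 1) + f.1 (unip hϖ r ν)) / 2 := ⟨_, rfl⟩
  refine ⟨f.1 (unip hϖ r 0) - A,
    resQuad (-1 : 𝓀[F]) * ((f.1 (unip hϖ r 1) - f.1 (unip hϖ r ν)) / 2), ?_⟩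
  refine mem_of_eigenvector_of_const (A := A) h2 hϖ hr hχ ?_ ?_
  · have hδ := isEigenvector_bump (levelSubgroup_normal (coverK1_le hn) (r + 1)) hχ.mul
      (hχ.triv_level hϖ hr)
    intro b
    rw [map_sub, map_add, map_smul, map_smul, hf b, hδ b, quadOp, ← convOp_comm, hδ b, map_smul,
      smul_sub, smul_add, smul_comm (χ b), smul_comm (χ b) (_ * _)]
  · intro x
    have ht : (quadOp hϖ hr hχ (bump (N := levelSubgroup (coverK1 F n hn) (r + 1)) hχ.mul
        (hχ.triv_level hϖ hr))).1 (unip hϖ r x) = resQuad (-1 : 𝓀[F]) * resQuad x := by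
      rw [quadOp, convOp_bump_unip, ← resQuad_mul, neg_one_mul]
    change f.1 (unip hϖ r x) - (_ * (bump hχ.mul (hχ.triv_level hϖ hr)).1 (unip hϖ r x) +
      _ * (quadOp hϖ hr hχ (bump hχ.mul (hχ.triv_level hϖ hr))).1 (unip hϖ r x)) = A
    rw [ht, bump_unip hϖ hr hχ]
    by_cases hx : x = 0
    · subst hx
      rw [if_pos rfl, resQuad_zero]
      ring
    rw [if_neg hx]
    rcases resQuad_dichotomy hx with h | h
    · obtain ⟨t, ht0, rfl⟩ := exists_sq_of_resQuad h
      have h3 := apply_unip_sq_mul hϖ hr hχ hf ht0 1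
      rw [mul_one] at h3
      rw [h, h3, hA]
      linear_combination (-(f.1 (unip hϖ r 1) - f.1 (unip hϖ r ν)) / 2) * hm1
    · have n0 : ν ≠ 0 := by
        rintro rfl
        rw [resQuad_zero] at hν
        norm_num at hν
      have hq : resQuad (x * ν⁻¹) = 1 := by
        have h4 : resQuad ν⁻¹ * resQuad ν = 1 := by
          rw [← resQuad_mul, inv_mul_cancel₀ n0, resQuad_one]
        rw [hν] at h4
        rw [resQuad_mul, h]
        linear_combination h4
      obtain ⟨t, ht0, htx⟩ := exists_sq_of_resQuad hq
      have h3 := apply_unip_sq_mul hϖ hr hχ hf ht0 ν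
      rw [← htx, inv_mul_cancel_right₀ n0] at h3
      rw [h, h3, hA]
      linear_combination ((f.1 (unip hϖ r 1) - f.1 (unip hϖ r ν)) / 2) * hm1

end Eigenfunctions

/-! ### Conjugation by diagonal elements -/

section Conj

open ValuativeRel Matrix

variable {F : Type*} [Field F] [ValuativeRel F] [TopologicalSpace F]
  [IsNonarchimedeanLocalField F] {n : ℕ} {hn : n ∣ resCard F - 1}
  {ϖ : Fˣ} {r : ℕ} {χ : (coverB F n hn).subgroupOf (coverK1 F n hn) → ℂ}

theorem ord_diag_of_borel {x : Cover F n hn} (hx : x ∈ coverB F n hn)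
    (hK : x ∈ coverK F n hn) (i : Fin 2) : valuation F (x.mat i i) = 1 := by
  have h0 : x.mat 1 0 = 0 := hx
  have hK : x.mat ∈ maxCompact F := hK
  have hd := (ord_eq_zero_iff _).mp (valuation_det_of_mem hK)
  rw [det_val, h0, mul_zero, sub_zero, map_mul] at hd
  have v0 := valuation_le_of_mem hK 0 0
  have v1 := valuation_le_of_mem hK 1 1
  have key : ∀ a b : ValueGroupWithZero F, a ≤ 1 → b ≤ 1 → a * b = 1 → a = 1 :=
    fun a b ha hb h => le_antisymm ha (h ▸ mul_le_of_le_one_right' hb)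
  fin_cases i
  · exact key _ _ v0 v1 hd
  · exact key _ _ v1 v0 (by rw [mul_comm]; exact hd)

theorem cocycle_borel {x y : Cover F n hn} (hx : x ∈ coverB F n hn) (hy : y ∈ coverB F n hn)
    (hxK : x ∈ coverK F n hn) (hyK : y ∈ coverK F n hn) :
    cocycle (hilbertSymbol n hn) x.mat y.mat = 1 := by
  have hx0 : x.mat 1 0 = 0 := hx
  have hy0 : y.mat 1 0 = 0 := hy
  have hd := valuation_det_of_mem (show x.mat ∈ maxCompact F from hxK)
  have ox : ord (lead x.mat) = 0 := by
    rw [ord_eq_zero_iff, lead_of_eq hx0]; exact ord_diag_of_borel hx hxK 1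
  have oy : ord (lead y.mat) = 0 := by
    rw [ord_eq_zero_iff, lead_of_eq hy0]; exact ord_diag_of_borel hy hyK 1
  unfold cocycle
  rw [lead_mul_of_eq hx0]
  apply hilbertSymbol_units
  · rw [mul_div_cancel_left]; exact oy
  · rw [mul_comm, mul_div_mul_left_eq_div, div_eq_mul_inv, ord_mul, ord_inv, ox, hd]; rfl

theorem root_mul_of_borel {x y : Cover F n hn} (hx : x ∈ coverB F n hn) (hy : y ∈ coverB F n hn)
    (hxK : x ∈ coverK F n hn) (hyK : y ∈ coverK F n hn) :
    (x * y).root = x.root * y.root := by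
  rw [Cover.mul_root, cocycle_borel hx hy hxK hyK, one_mul]

theorem root_conj_of_borel {x y : Cover F n hn} (hx : x ∈ coverB F n hn)
    (hy : y ∈ coverB F n hn) (hxK : x ∈ coverK F n hn) (hyK : y ∈ coverK F n hn) :
    (x * y * x⁻¹).root = y.root := by
  have h := root_mul_of_borel (mul_mem (mul_mem hx hy) (inv_mem hx)) hx
    (mul_mem (mul_mem hxK hyK) (inv_mem hxK)) hxK
  rw [inv_mul_cancel_right, root_mul_of_borel hx hy hxK hyK, mul_comm] at h
  exact (mul_right_cancel h).symm

theorem diag_mul_of_borel {x y : Cover F n hn} (hx : x ∈ coverB F n hn)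
    (hy : y ∈ coverB F n hn) (i : Fin 2) :
    (x * y).mat i i = x.mat i i * y.mat i i := by
  have hx0 : x.mat 1 0 = 0 := hx
  have hy0 : y.mat 1 0 = 0 := hy
  rw [Cover.mul_mat]
  fin_cases i
  · change (x.mat * y.mat) 0 0 = _
    rw [mul_top_left, hy0, mul_zero, add_zero]
    rfl
  · change (x.mat * y.mat) 1 1 = _
    rw [mul_bottom_right, hx0, zero_mul, zero_add]
    rfl

theorem diag_conj_of_borel {x y : Cover F n hn} (hx : x ∈ coverB F n hn)
    (hy : y ∈ coverB F n hn) (i : Fin 2) : (x * y * x⁻¹).mat i i = y.mat i i := by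
  have h := diag_mul_of_borel (mul_mem (mul_mem hx hy) (inv_mem hx)) hx i
  rw [inv_mul_cancel_right, diag_mul_of_borel hx hy, mul_comm] at h
  exact (mul_right_cancel₀ (diag_ne_zero (g := x.mat) hx i) h).symm

theorem conj_mem_coverK1 {x g : Cover F n hn} (hx : x ∈ coverK F n hn) (hg : g ∈ coverK1 F n hn) :
    x * g * x⁻¹ ∈ coverK1 F n hn := by
  refine ⟨(coverK F n hn).mul_mem ((coverK F n hn).mul_mem hx (coverK1_le hn hg))
    ((coverK F n hn).inv_mem hx), ?_⟩
  exact (MonoidHom.normal_ker (GeneralLinearGroup.det (n := Fin 2) (R := F))).conj_mem _ hg.2 _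

/-- Conjugation by an element of `K̃`, as an endomorphism of `K̃¹`. -/
noncomputable def conjK1 (x : coverK F n hn) : coverK1 F n hn →* coverK1 F n hn where
  toFun g := ⟨x * g * (x : Cover F n hn)⁻¹, conj_mem_coverK1 x.2 g.2⟩
  map_one' := by ext1; simp
  map_mul' g h := by
    ext1
    change (x : Cover F n hn) * (g * h) * (x : Cover F n hn)⁻¹ =
      (x : Cover F n hn) * g * (x : Cover F n hn)⁻¹ * (x * h * (x : Cover F n hn)⁻¹)
    group

theorem conjK1_val (x : coverK F n hn) (g : coverK1 F n hn) :
    (conjK1 x g : Cover F n hn) = x * g * (x : Cover F n hn)⁻¹ := rfl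

theorem conjK1_inv_conjK1 (x : coverK F n hn) (g : coverK1 F n hn) :
    conjK1 x⁻¹ (conjK1 x g) = g := by
  ext1
  rw [conjK1_val, conjK1_val, Subgroup.coe_inv]
  group

theorem conjK1_conjK1_inv (x : coverK F n hn) (g : coverK1 F n hn) :
    conjK1 x (conjK1 x⁻¹ g) = g := by
  have := conjK1_inv_conjK1 x⁻¹ g
  rwa [inv_inv] at this

theorem conjK1_mem_level (x : coverK F n hn) {j : ℕ} {u : coverK1 F n hn}
    (hu : u ∈ levelSubgroup (coverK1 F n hn) j) :
    conjK1 x u ∈ levelSubgroup (coverK1 F n hn) j :=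
  (levelSubgroup_normal (le_refl (coverK F n hn)) j).conj_mem ⟨u.1, coverK1_le hn u.2⟩ hu x

theorem conjK1_mem_borel {x : coverK F n hn} (hx : (x : Cover F n hn) ∈ coverB F n hn)
    {b : coverK1 F n hn} (hb : b ∈ (coverB F n hn).subgroupOf (coverK1 F n hn)) :
    conjK1 x b ∈ (coverB F n hn).subgroupOf (coverK1 F n hn) :=
  mul_mem (mul_mem hx hb) (inv_mem hx)

theorem IsLevelChar.conj (hχ : IsLevelChar ϖ r χ) {x : coverK F n hn}
    (hx : (x : Cover F n hn) ∈ coverB F n hn) (b : (coverB F n hn).subgroupOf (coverK1 F n hn)) :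
    χ ⟨conjK1 x b, conjK1_mem_borel hx b.2⟩ = χ b :=
  hχ.congr _ _ (diag_conj_of_borel hx b.2 0) (diag_conj_of_borel hx b.2 1)
    (root_conj_of_borel hx b.2 x.2 (coverK1_le hn b.1.2))

theorem comp_conjK1_mem (hχ : IsLevelChar ϖ r χ) {x : coverK F n hn}
    (hx : (x : Cover F n hn) ∈ coverB F n hn) {j : ℕ} {f : coverK1 F n hn → ℂ}
    (hf : f ∈ levelFun _ χ (levelSubgroup (coverK1 F n hn) j)) :
    (fun g => f (conjK1 x g)) ∈ levelFun _ χ (levelSubgroup (coverK1 F n hn) j) := by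
  constructor
  · intro b g
    change f (conjK1 x (b * g)) = _
    rw [map_mul, ← hχ.conj hx b]
    exact hf.1 ⟨conjK1 x b, conjK1_mem_borel hx b.2⟩ _
  · intro u hu g
    change f (conjK1 x (g * u)) = _
    rw [map_mul]
    exact hf.2 _ (conjK1_mem_level x hu) _

/-- The operator `f ↦ (g ↦ f(x g x⁻¹))` for `x` in `B̃ ∩ K̃`. -/
noncomputable def conjOp (hχ : IsLevelChar ϖ r χ) {x : coverK F n hn}
    (hx : (x : Cover F n hn) ∈ coverB F n hn) (j : ℕ) :
    levelFun _ χ (levelSubgroup (coverK1 F n hn) j) →ₗ[ℂ]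
      levelFun _ χ (levelSubgroup (coverK1 F n hn) j) where
  toFun f := ⟨fun g => f.1 (conjK1 x g), comp_conjK1_mem hχ hx f.2⟩
  map_add' _ _ := rfl
  map_smul' _ _ := rfl

theorem conjOp_apply (hχ : IsLevelChar ϖ r χ) {x : coverK F n hn}
    (hx : (x : Cover F n hn) ∈ coverB F n hn) {j : ℕ}
    (f : levelFun _ χ (levelSubgroup (coverK1 F n hn) j)) (g : coverK1 F n hn) :
    (conjOp hχ hx j f).1 g = f.1 (conjK1 x g) := rfl

theorem conjOp_mem_iff (hχ : IsLevelChar ϖ r χ) {x : coverK F n hn}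
    (hx : (x : Cover F n hn) ∈ coverB F n hn) {i j : ℕ}
    (f : levelFun _ χ (levelSubgroup (coverK1 F n hn) j)) :
    (conjOp hχ hx j f).1 ∈ levelFun _ χ (levelSubgroup (coverK1 F n hn) i) ↔
      f.1 ∈ levelFun _ χ (levelSubgroup (coverK1 F n hn) i) := by
  refine ⟨fun h => ?_, fun h => comp_conjK1_mem hχ hx h⟩
  have := comp_conjK1_mem hχ (x := x⁻¹) (inv_mem hx) h
  convert this using 2 with g
  rw [conjOp_apply, conjK1_conjK1_inv]

theorem conjOp_bump (hϖ : ord ϖ = 1) (hr : 1 ≤ r) (hχ : IsLevelChar ϖ r χ) {x : coverK F n hn}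
    (hx : (x : Cover F n hn) ∈ coverB F n hn) :
    conjOp hχ hx (r + 1) (bump hχ.mul (hχ.triv_level hϖ hr)) =
      bump hχ.mul (hχ.triv_level hϖ hr) := by
  ext g
  change bumpFun χ _ (conjK1 x g) = bumpFun χ _ g
  have key : ∀ {y : coverK F n hn} (hy : (y : Cover F n hn) ∈ coverB F n hn) (g : coverK1 F n hn)
      (b : (coverB F n hn).subgroupOf (coverK1 F n hn)),
      (b : coverK1 F n hn)⁻¹ * g ∈ levelSubgroup (coverK1 F n hn) (r + 1) →
      (conjK1 y b)⁻¹ * conjK1 y g ∈ levelSubgroup (coverK1 F n hn) (r + 1) := by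
    intro y hy g b hb
    rw [← map_inv, ← map_mul]
    exact conjK1_mem_level y hb
  by_cases h : ∃ b : (coverB F n hn).subgroupOf (coverK1 F n hn),
      (b : coverK1 F n hn)⁻¹ * g ∈ levelSubgroup (coverK1 F n hn) (r + 1)
  · obtain ⟨b, hb⟩ := h
    rw [bumpFun_of_mem hχ.mul (hχ.triv_level hϖ hr) b hb, ← hχ.conj hx b]
    exact bumpFun_of_mem hχ.mul (hχ.triv_level hϖ hr) ⟨conjK1 x b, conjK1_mem_borel hx b.2⟩
      (key hx g b hb)
  · rw [bumpFun_of_not h, bumpFun_of_not]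
    rintro ⟨b, hb⟩
    have h' := key (y := x⁻¹) (inv_mem hx) _ b hb
    rw [conjK1_inv_conjK1] at h'
    exact h ⟨⟨conjK1 x⁻¹ b, conjK1_mem_borel (x := x⁻¹) (inv_mem hx) b.2⟩, h'⟩

/-- The element `(diag(1, N̂), 1)` of `K̃`, where `N̂` lifts `ν`. -/
noncomputable def diagK (ν : 𝓀[F]) (hν : ν ≠ 0) : coverK F n hn :=
  ⟨⟨mat2 1 0 0 (resLift ν : F) (by
      have vt := valuation_resLift hν
      intro h0
      rw [one_mul, mul_zero, sub_zero] at h0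
      rw [h0, map_zero] at vt
      exact zero_ne_one vt), 1⟩, by
    refine mem_maxCompact (fun i j => ?_) ?_
    · fin_cases i <;> fin_cases j <;> simp [Cover.proj]
      exact (resLift ν).2
    · rw [ord_eq_zero_iff, det_val]
      simpa [Cover.proj] using valuation_resLift hν⟩

theorem diagK_mem (ν : 𝓀[F]) (hν : ν ≠ 0) :
    (diagK (n := n) (hn := hn) ν hν : Cover F n hn) ∈ coverB F n hn := by
  change (diagK (n := n) (hn := hn) ν hν : Cover F n hn).mat 1 0 = 0
  rfl

theorem conjK1_diagK_unip (hϖ : ord ϖ = 1) (r : ℕ) (ν : 𝓀[F]) (hν : ν ≠ 0) (y : 𝓀[F]) :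
    (conjK1 (diagK ν hν) (unip (n := n) (hn := hn) hϖ r y)).1.mat 1 0 =
      (ϖ : F) ^ r * (resLift ν * resLift y : 𝒪[F]) := by
  let x : Cover F n hn := diagK (n := n) (hn := hn) ν hν
  have hx : x⁻¹.mat 1 0 = 0 := inv_mem (diagK_mem (n := n) (hn := hn) ν hν)
  have x00 : x.mat 0 0 = 1 := rfl
  have hinv : x⁻¹.mat 0 0 = 1 := by
    have h := diag_mul_of_borel (diagK_mem (n := n) (hn := hn) ν hν)
      (inv_mem (diagK_mem (n := n) (hn := hn) ν hν)) 0
    rw [mul_inv_cancel] at h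
    change _ = x.mat 0 0 * x⁻¹.mat 0 0 at h
    rw [x00, one_mul] at h
    rw [← h]
    rfl
  change (x.mat * (unip (n := n) (hn := hn) hϖ r y).1.mat * x⁻¹.mat) 1 0 = _
  have x10 : x.mat 1 0 = 0 := rfl
  have x11 : x.mat 1 1 = resLift ν := rfl
  rw [mul_bottom_left, hx, hinv, mul_bottom_left, x10, x11, unip_bottom_left]
  change _ = (ϖ : F) ^ r * ((resLift ν : F) * (resLift y : F))
  ring

/-- Conjugation by `diag(1, N̂)` multiplies the coordinate of `unip` by the nonsquare `ν`. -/
theorem conjOp_quadOp (hϖ : ord ϖ = 1) (hr : 1 ≤ r) (hχ : IsLevelChar ϖ r χ) {ν : 𝓀[F]}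
    (hν : ν ≠ 0) (hη : resQuad ν = -1)
    (f : levelFun _ χ (levelSubgroup (coverK1 F n hn) (r + 1))) :
    conjOp hχ (diagK_mem ν hν) (r + 1) (quadOp hϖ hr hχ f) =
      -quadOp hϖ hr hχ (conjOp hχ (diagK_mem ν hν) (r + 1) f) := by
  ext g
  change ∑ y, resQuad y * f.1 (unip hϖ r y * conjK1 (diagK ν hν) g) =
    -∑ y, resQuad y * f.1 (conjK1 (diagK ν hν) (unip hϖ r y * g))
  rw [← Finset.sum_neg_distrib]
  refine (Fintype.sum_equiv (Equiv.mulLeft₀ ν hν) _ _ fun y => ?_).symm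
  rw [map_mul, apply_mul_eq_unip hϖ hr hχ f (conjK1_mem_level _ (unip_mem hϖ hr y))
    (conjK1_diagK_unip hϖ r ν hν y), Equiv.mulLeft₀_apply, resQuad_mul, hη, map_mul,
    residue_resLift, residue_resLift]
  ring

/-- By the Jacobi sum `resQuad_conv`, the square of `quadOp` is a scalar plus an operator which
lowers the level. -/
theorem quadOp_sq (hϖ : ord ϖ = 1) (hr : 1 ≤ r) (hχ : IsLevelChar ϖ r χ)
    (h2 : ringChar 𝓀[F] ≠ 2) (f : levelFun _ χ (levelSubgroup (coverK1 F n hn) (r + 1))) :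
    (quadOp hϖ hr hχ (quadOp hϖ hr hχ f) -
      (resQuad (-1 : 𝓀[F]) * (Fintype.card 𝓀[F] : ℂ)) • f).1 ∈
        levelFun _ χ (levelSubgroup (coverK1 F n hn) r) := by
  classical
  have e : quadOp hϖ hr hχ (quadOp hϖ hr hχ f) -
      (resQuad (-1 : 𝓀[F]) * (Fintype.card 𝓀[F] : ℂ)) • f =
      convOp hϖ hr hχ (fun _ => -resQuad (-1 : 𝓀[F])) (fun _ _ _ => rfl) f := by
    ext g
    change (quadOp hϖ hr hχ (quadOp hϖ hr hχ f)).1 g -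
      (resQuad (-1 : 𝓀[F]) * (Fintype.card 𝓀[F] : ℂ)) * f.1 g = _
    rw [quadOp, convOp_convOp, convOp_apply]
    simp only [resQuad_conv h2]
    rw [sub_eq_iff_eq_add]
    have h3 : ∀ z : 𝓀[F], resQuad (-1 : 𝓀[F]) *
        ((if z = 0 then (Fintype.card 𝓀[F] : ℂ) else 0) - 1) * f.1 (unip hϖ r z * g) =
        -resQuad (-1 : 𝓀[F]) * f.1 (unip hϖ r z * g) + (if z = 0 then
          resQuad (-1 : 𝓀[F]) * (Fintype.card 𝓀[F] : ℂ) * f.1 (unip hϖ r z * g) else 0) := by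
      intro z
      split_ifs <;> ring
    rw [Finset.sum_congr rfl fun z _ => h3 z, Finset.sum_add_distrib, Finset.sum_ite_eq']
    rw [if_pos (Finset.mem_univ _), apply_unip_zero_mul hϖ hr hχ]
  rw [e]
  exact convOp_const_mem hϖ hr hχ f _ _

theorem quadOp_bump (hϖ : ord ϖ = 1) (hr : 1 ≤ r) (hχ : IsLevelChar ϖ r χ) {ν : 𝓀[F]}
    (hν : ν ≠ 0) (hη : resQuad ν = -1) (a : ℂ) :
    (quadOp hϖ hr hχ (bump (N := levelSubgroup (coverK1 F n hn) (r + 1)) hχ.mul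
      (hχ.triv_level hϖ hr)) - a • bump hχ.mul (hχ.triv_level hϖ hr)).1 ∉
        levelFun _ χ (levelSubgroup (coverK1 F n hn) r) := by
  classical
  intro h
  have key : ∀ y : 𝓀[F], y ≠ 0 → resQuad (-y) =
      (quadOp hϖ hr hχ (bump (N := levelSubgroup (coverK1 F n hn) (r + 1)) hχ.mul
      (hχ.triv_level hϖ hr)) - a • bump hχ.mul (hχ.triv_level hϖ hr)).1 1 := by
    intro y hy
    rw [← h.2 _ (unip_mem hϖ hr y) 1, one_mul]
    change _ = (quadOp hϖ hr hχ (bump (N := levelSubgroup (coverK1 F n hn) (r + 1)) hχ.mul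
      (hχ.triv_level hϖ hr))).1 (unip hϖ r y) - a * (bump hχ.mul (hχ.triv_level hϖ hr)).1 _
    rw [quadOp, convOp_bump_unip, bump_unip hϖ hr hχ, if_neg hy, mul_zero, sub_zero]
  have h1 := (key (-1) (by simp)).trans (key (-ν) (neg_ne_zero.mpr hν)).symm
  rw [neg_neg, neg_neg, resQuad_one, hη] at h1
  norm_num at h1

/-- The operators on the functions of level `r + 1` on `K̃¹`: averaging over `K¹_r`, convolution
with the quadratic character of the residue field, and conjugation by `diag(1, N̂)`. -/
noncomputable def levelOperators (hϖ : ord ϖ = 1) (hr : 1 ≤ r) (hχ : IsLevelChar ϖ r χ)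
    (h2 : (2 : 𝓀[F]) ≠ 0) (h2' : ringChar 𝓀[F] ≠ 2) (ν : 𝓀[F]) (hν : ν ≠ 0)
    (hη : resQuad ν = -1) (τ : ℂ)
    (hτ : τ * τ = resQuad (-1 : 𝓀[F]) * (Fintype.card 𝓀[F] : ℂ)) :
    LevelOperators ((coverB F n hn).subgroupOf (coverK1 F n hn)) χ
      (levelSubgroup (coverK1 F n hn) (r + 1)) (levelSubgroup (coverK1 F n hn) r)
      (levelSubgroup_normal (coverK1_le hn) (r + 1)) where
  mul := hχ.mul
  one := hχ.one
  triv := hχ.triv_level hϖ hr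
  P := convOp hϖ hr hχ (fun _ => (Fintype.card 𝓀[F] : ℂ)⁻¹) (fun _ _ _ => rfl)
  T := quadOp hϖ hr hχ
  J := conjOp hχ (diagK_mem ν hν) (r + 1)
  τ := τ
  τ_ne h := by
    rw [h, mul_zero] at hτ
    have h1 : resQuad (-1 : 𝓀[F]) * resQuad (-1 : 𝓀[F]) = 1 := resQuad_sq (by simp)
    have hc : (Fintype.card 𝓀[F] : ℂ) ≠ 0 := by exact_mod_cast Fintype.card_ne_zero
    rcases mul_eq_zero.mp hτ.symm with h0 | h0
    · rw [h0, mul_zero] at h1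
      exact zero_ne_one h1
    · exact hc h0
  P_comm h f := convOp_comm hϖ hr hχ _ f h
  P_mem f := convOp_const_mem hϖ hr hχ f _ _
  P_of_mem f hf := by
    have hc : (Fintype.card 𝓀[F] : ℂ) ≠ 0 := by exact_mod_cast Fintype.card_ne_zero
    ext g
    rw [convOp_of_mem hϖ hr hχ _ f hf, Finset.sum_const, Finset.card_univ, nsmul_eq_mul,
      mul_inv_cancel₀ hc, one_mul]
  T_comm h f := convOp_comm hϖ hr hχ _ f h
  T_mem f hf := by
    have e : quadOp hϖ hr hχ f = 0 := by
      ext g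
      rw [quadOp, convOp_of_mem hϖ hr hχ _ f hf, sum_resQuad h2', zero_mul]
      rfl
    rw [e]
    exact Submodule.zero_mem _
  T_sq f := by
    rw [hτ]
    exact quadOp_sq hϖ hr hχ h2' f
  T_bump := quadOp_bump hϖ hr hχ hν hη
  eigen_span := quadOp_eigen_span h2 hϖ hr hχ hη
  J_T := conjOp_quadOp hϖ hr hχ hν hη
  J_bump := conjOp_bump hϖ hr hχ _
  J_mem_iff := conjOp_mem_iff hχ _

end Conj

/-! ### Characters induced from the torus -/

section TorusCharacters

open ValuativeRel Matrix

variable {F : Type*} [Field F] [ValuativeRel F] [TopologicalSpace F]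
  [IsNonarchimedeanLocalField F] {n : ℕ} {hn : n ∣ resCard F - 1} {ϖ : Fˣ}

/-- A unit pairing trivially with a uniformizer pairs trivially with everything. -/
theorem hilbertSymbol_eq_one_of_uniformizer (hϖ : ord ϖ = 1) {t : Fˣ} (ht : ord t = 0)
    (h : hilbertSymbol n hn ϖ t = 1) (a : Fˣ) : hilbertSymbol n hn a t = 1 := by
  have e : a = ϖ ^ ord a * (a / ϖ ^ ord a) := by rw [mul_div_cancel]
  rw [e, map_mul, MonoidHom.mul_apply, map_zpow, MonoidHom.zpow_apply, h, _root_.one_zpow, one_mul]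
  apply hilbertSymbol_units hn _ _ _ ht
  rw [div_eq_mul_inv, ord_mul, ord_inv, ord_zpow, hϖ]
  ring

theorem ord_diagEntry {x : Cover F n hn} (hx : x ∈ coverB F n hn) (hK : x ∈ coverK F n hn)
    (i : Fin 2) : ord (diagEntry x.mat hx i) = 0 :=
  (ord_eq_zero_iff _).mpr (ord_diag_of_borel hx hK i)

theorem diagEntry_mul {x y : Cover F n hn} (hx : x ∈ coverB F n hn) (hy : y ∈ coverB F n hn)
    (hxy : x * y ∈ coverB F n hn) (i : Fin 2) :
    diagEntry (x * y).mat hxy i = diagEntry x.mat hx i * diagEntry y.mat hy i :=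
  Units.ext (diag_mul_of_borel hx hy i)

/-- Two diagonal elements commute if the entries of the first are in the kernel of the symbol. -/
theorem commute_of_hilbertSymbol {x y : Cover F n hn} (hx : x ∈ coverT F n hn)
    (hy : y ∈ coverT F n hn)
    (h : ∀ i a, hilbertSymbol n hn a (diagEntry x.mat hx.1 i) = 1) : x * y = y * x := by
  have mx : x.mat 1 0 = 0 ∧ x.mat 0 1 = 0 := hx
  have my : y.mat 1 0 = 0 ∧ y.mat 0 1 = 0 := hy
  have lx : lead x.mat = diagEntry x.mat hx.1 1 := Units.ext (lead_of_eq mx.1)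
  have dx : x.mat.det = diagEntry x.mat hx.1 0 * diagEntry x.mat hx.1 1 := by
    ext
    rw [det_val, mx.1, mul_zero, sub_zero]
    rfl
  ext1
  · rw [Cover.mul_mat, Cover.mul_mat]
    ext a b
    simp only [Units.val_mul, Matrix.mul_apply, Fin.sum_univ_two]
    fin_cases a <;> fin_cases b <;> simp [mx, my, mul_comm]
  · have c1 : cocycle (hilbertSymbol n hn) x.mat y.mat = 1 := by
      unfold cocycle
      rw [lead_mul_of_eq mx.1, mul_div_cancel_left, mul_comm, mul_div_mul_left_eq_div, lx, dx,
        map_div, map_mul, h, h]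
      simp
    have c2 : cocycle (hilbertSymbol n hn) y.mat x.mat = 1 := by
      unfold cocycle
      rw [lead_mul_of_eq my.1, mul_div_cancel_left, lx,
        symbol_symm _ (hilbertSymbol_steinberg hn), h, inv_one]
    rw [Cover.mul_root, Cover.mul_root, c1, c2, one_mul, one_mul, mul_comm]

variable {T H : Subgroup (Cover F n hn)}

/-- A diagonal element of `K̃` whose entries pair trivially with a uniformizer is central. -/
theorem mem_center_of_hilbertSymbol (hϖ : ord ϖ = 1) (hT : T ≤ coverT F n hn) (x : T)
    (hK : (x : Cover F n hn) ∈ coverK F n hn)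
    (h : ∀ i, hilbertSymbol n hn ϖ (diagEntry x.1.mat (hT x.2).1 i) = 1) :
    x ∈ Subgroup.center T := by
  rw [Subgroup.mem_center_iff]
  intro y
  refine Subtype.ext (commute_of_hilbertSymbol (hT x.2) (hT y.2) fun i a => ?_).symm
  exact hilbertSymbol_eq_one_of_uniformizer hϖ (ord_diagEntry (hT x.2).1 hK i) (h i) a

/-- The character of `B̃ ∩ H` obtained from a character `χ₀` of the torus and a twist `η` of the
root of unity by the diagonal entries. -/
noncomputable def torusChar (hT : T ≤ coverT F n hn) (hH : H ≤ coverK F n hn)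
    (hTH : ∀ (b : (coverB F n hn).subgroupOf H) η, diagPart b.1.1 b.2 η ∈ T)
    (χ₀ : torusA T →* ℂˣ) (η : Fˣ × Fˣ →* rootsOfUnity n 𝓀[F])
    (b : (coverB F n hn).subgroupOf H) : ℂ :=
  χ₀ ⟨⟨diagPart b.1.1 b.2 (η (diagEntry b.1.1.mat b.2 0, diagEntry b.1.1.mat b.2 1)), hTH b _⟩,
    mem_torusA hT _ (diagPart_mem_coverK _ b.2 (hH b.1.2) _)⟩

theorem diagPart_root (b : Cover F n hn) (h : b ∈ coverB F n hn) (η : rootsOfUnity n 𝓀[F]) :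
    (diagPart b h η).root = η * b.root := rfl

theorem diagPart_mul {b b' : Cover F n hn} (h : b ∈ coverB F n hn) (h' : b' ∈ coverB F n hn)
    (hK : b ∈ coverK F n hn) (hK' : b' ∈ coverK F n hn) (hb : b * b' ∈ coverB F n hn)
    (η η' : rootsOfUnity n 𝓀[F]) :
    diagPart (b * b') hb (η * η') = diagPart b h η * diagPart b' h' η' := by
  have hd := diagPart_mem_coverT b h η
  have hd' := diagPart_mem_coverT b' h' η'
  ext1
  · have h10 := (mul_mem hd hd').1
    have h01 := (mul_mem hd hd').2
    have hm := diag_mul_of_borel h h'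
    have hm' := diag_mul_of_borel hd.1 hd'.1
    ext i j
    fin_cases i <;> fin_cases j
    · exact (hm 0).trans (hm' 0).symm
    · exact h01.symm
    · exact h10.symm
    · exact (hm 1).trans (hm' 1).symm
  · rw [root_mul_of_borel hd.1 hd'.1 (diagPart_mem_coverK b h hK η)
      (diagPart_mem_coverK b' h' hK' η'), diagPart_root, diagPart_root, diagPart_root,
      root_mul_of_borel h h' hK hK', mul_mul_mul_comm]

theorem diagPart_congr {b b' : Cover F n hn} (h : b ∈ coverB F n hn) (h' : b' ∈ coverB F n hn)
    (h0 : b.mat 0 0 = b'.mat 0 0) (h1 : b.mat 1 1 = b'.mat 1 1) (hr : b.root = b'.root)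
    (η : rootsOfUnity n 𝓀[F]) : diagPart b h η = diagPart b' h' η := by
  ext1
  · ext i j
    fin_cases i <;> fin_cases j
    · exact h0
    · rfl
    · rfl
    · exact h1
  · rw [diagPart_root, diagPart_root, hr]

variable (hT : T ≤ coverT F n hn) (hH : H ≤ coverK F n hn)
  (hTH : ∀ (b : (coverB F n hn).subgroupOf H) η, diagPart b.1.1 b.2 η ∈ T)
  (χ₀ : torusA T →* ℂˣ) (η : Fˣ × Fˣ →* rootsOfUnity n 𝓀[F])

theorem torusChar_mul (b b' : (coverB F n hn).subgroupOf H) :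
    torusChar hT hH hTH χ₀ η (b * b') =
      torusChar hT hH hTH χ₀ η b * torusChar hT hH hTH χ₀ η b' := by
  rw [torusChar, torusChar, torusChar, ← Units.val_mul, ← map_mul]
  congr 2
  refine Subtype.ext (Subtype.ext ?_)
  have hb : b.1.1 ∈ coverB F n hn := b.2
  have hb' : b'.1.1 ∈ coverB F n hn := b'.2
  have hbb : b.1.1 * b'.1.1 ∈ coverB F n hn := mul_mem hb hb'
  have hη : η (diagEntry (b.1.1 * b'.1.1).mat hbb 0, diagEntry (b.1.1 * b'.1.1).mat hbb 1) =
      η (diagEntry b.1.1.mat hb 0, diagEntry b.1.1.mat hb 1) *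
        η (diagEntry b'.1.1.mat hb' 0, diagEntry b'.1.1.mat hb' 1) := by
    rw [← map_mul, Prod.mk_mul_mk, diagEntry_mul hb hb', diagEntry_mul hb hb']
  exact (congrArg (diagPart (b.1.1 * b'.1.1) hbb) hη).trans
    (diagPart_mul hb hb' (hH b.1.2) (hH b'.1.2) hbb _ _)

theorem torusChar_eq_of_mem_center {χ : Subgroup.center T →* ℂˣ} (hχ : Extends χ₀ χ)
    (b : (coverB F n hn).subgroupOf H)
    (hc : (⟨diagPart b.1.1 b.2 (η (diagEntry b.1.1.mat b.2 0, diagEntry b.1.1.mat b.2 1)),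
      hTH b _⟩ : T) ∈ Subgroup.center T) :
    torusChar hT hH hTH χ₀ η b = χ ⟨_, hc⟩ := by
  rw [← hχ]
  rfl

/-- Primitivity mod `m` makes the characters of `B̃ ∩ H` trivial on diagonal parts congruent to
`1` modulo `𝔭 ^ r` for all `r ≥ m`, as these are central in the torus. -/
theorem isLevelChar_torusChar (hϖ : ord ϖ = 1) {χ : Subgroup.center T →* ℂˣ} {m r : ℕ}
    (hχ : Extends χ₀ χ) (hm : IsPrimitiveMod χ m) (hr : m ≤ r)
    (hη : ∀ a d : Fˣ, IsOneUnit (a : F) → IsOneUnit (d : F) → η (a, d) = 1) :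
    IsLevelChar ϖ r (torusChar hT hH hTH χ₀ η) where
  mul := torusChar_mul hT hH hTH χ₀ η
  one := by
    have h := torusChar_mul hT hH hTH χ₀ η 1 1
    rw [mul_one] at h
    exact (mul_eq_left₀ (Units.ne_zero _)).mp h.symm
  triv b hb1 h0 h1 := by
    have hm1 := hm.1.1
    have hr1 : 1 ≤ r := hm1.trans hr
    have o0 : IsOneUnit (diagEntry b.1.1.mat b.2 0 : F) := h0.lt_one hϖ hr1
    have o1 : IsOneUnit (diagEntry b.1.1.mat b.2 1 : F) := h1.lt_one hϖ hr1
    have hη1 := hη _ _ o0 o1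
    have hc : (⟨diagPart b.1.1 b.2 (η (diagEntry b.1.1.mat b.2 0, diagEntry b.1.1.mat b.2 1)),
        hTH b _⟩ : T) ∈ Subgroup.center T := by
      refine mem_center_of_hilbertSymbol hϖ hT _ (diagPart_mem_coverK _ b.2 (hH b.1.2) _)
        fun i => hilbertSymbol_oneUnit_right hn _ _ ?_
      fin_cases i
      · exact o0
      · exact o1
    rw [torusChar_eq_of_mem_center hT hH hTH χ₀ η hχ b hc, hm.1.2, Units.val_one]
    refine (mem_congruenceLift_iff hϖ hm1 _).mpr ⟨⟨?_, ?_, ?_, ?_⟩, ?_⟩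
    · exact h0.mono hϖ hr
    · exact inPow_zero m
    · exact inPow_zero m
    · exact h1.mono hϖ hr
    · change _ * b.1.1.root = 1
      rw [hη1, one_mul]
      exact hb1.2
  congr b b' h0 h1 hr := by
    rw [torusChar, torusChar]
    congr 3
    refine Subtype.ext ?_
    have e0 : diagEntry b.1.1.mat b.2 0 = diagEntry b'.1.1.mat b'.2 0 := Units.ext h0
    have e1 : diagEntry b.1.1.mat b.2 1 = diagEntry b'.1.1.mat b'.2 1 := Units.ext h1
    change diagPart b.1.1 b.2 (η (diagEntry b.1.1.mat b.2 0, diagEntry b.1.1.mat b.2 1)) =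
      diagPart b'.1.1 b'.2 (η (diagEntry b'.1.1.mat b'.2 0, diagEntry b'.1.1.mat b'.2 1))
    rw [e0, e1]
    exact diagPart_congr b.2 b'.2 h0 h1 hr _

/-- The twist `(a, d) ↦ (ϖ, a) ^ (2 k)` in the definition of `χ_k`. -/
noncomputable def twistSL (hn : n ∣ resCard F - 1) (ϖ : Fˣ) (k : ℕ) :
    Fˣ × Fˣ →* rootsOfUnity n 𝓀[F] :=
  (powMonoidHom (2 * k)).comp ((hilbertSymbol n hn ϖ).comp (MonoidHom.fst Fˣ Fˣ))

/-- The twist `(a, d) ↦ (ϖ, a) ^ (-j) (ϖ, d) ^ (-i)` in the definition of `χ'_{i,j}`. -/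
noncomputable def twistGL (hn : n ∣ resCard F - 1) (ϖ : Fˣ) (i j : ℕ) :
    Fˣ × Fˣ →* rootsOfUnity n 𝓀[F] :=
  ((powMonoidHom j).comp ((hilbertSymbol n hn ϖ).comp (MonoidHom.fst Fˣ Fˣ)))⁻¹ *
    ((powMonoidHom i).comp ((hilbertSymbol n hn ϖ).comp (MonoidHom.snd Fˣ Fˣ)))⁻¹

theorem chiSL_eq_torusChar (χ₀ : torusA (coverT1 F n hn) →* ℂˣ) (k : ℕ) :
    chiSL ϖ χ₀ k = torusChar (coverT1_le hn) (coverK1_le hn)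
      (fun b η => diagPart_mem_coverT1 _ b.2 b.1.2 η) χ₀ (twistSL hn ϖ k) := rfl

theorem chiGL_eq_torusChar (χ₀ : torusA (coverT F n hn) →* ℂˣ) (i j : ℕ) :
    chiGL ϖ χ₀ i j = torusChar le_rfl le_rfl
      (fun b η => diagPart_mem_coverT _ b.2 η) χ₀ (twistGL hn ϖ i j) := rfl

theorem isLevelChar_chiSL (hϖ : ord ϖ = 1) {χ : Subgroup.center (coverT1 F n hn) →* ℂˣ}
    {χ₀ : torusA (coverT1 F n hn) →* ℂˣ} {m r : ℕ} (hχ : Extends χ₀ χ) (hm : IsPrimitiveMod χ m)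
    (hr : m ≤ r) (k : ℕ) : IsLevelChar ϖ r (chiSL ϖ χ₀ k) := by
  rw [chiSL_eq_torusChar]
  refine isLevelChar_torusChar _ _ _ _ _ hϖ hχ hm hr fun a d ha hd => ?_
  change hilbertSymbol n hn ϖ a ^ (2 * k) = 1
  rw [hilbertSymbol_oneUnit_right hn _ _ ha, one_pow]

theorem isLevelChar_chiGL (hϖ : ord ϖ = 1) {χ : Subgroup.center (coverT F n hn) →* ℂˣ}
    {χ₀ : torusA (coverT F n hn) →* ℂˣ} {m r : ℕ} (hχ : Extends χ₀ χ) (hm : IsPrimitiveMod χ m)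
    (hr : m ≤ r) (i j : ℕ) : IsLevelChar ϖ r (chiGL ϖ χ₀ i j) := by
  rw [chiGL_eq_torusChar]
  refine isLevelChar_torusChar _ _ _ _ _ hϖ hχ hm hr fun a d ha hd => ?_
  change (hilbertSymbol n hn ϖ a ^ j)⁻¹ * (hilbertSymbol n hn ϖ d ^ i)⁻¹ = 1
  rw [hilbertSymbol_oneUnit_right hn _ _ ha, hilbertSymbol_oneUnit_right hn _ _ hd]
  simp

/-- An element of `B̃ ∩ K̃¹` as an element of `B̃ ∩ K̃`. -/
noncomputable def borelIncl :
    (coverB F n hn).subgroupOf (coverK1 F n hn) →* (coverB F n hn).subgroupOf (coverK F n hn) where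
  toFun b := ⟨⟨b.1.1, coverK1_le hn b.1.2⟩, b.2⟩
  map_one' := rfl
  map_mul' _ _ := rfl

/-- A homomorphism which factors through a homomorphism `s` to the roots of unity is a power
of a faithful character of the roots of unity composed with `s`. -/
theorem exists_pow_eq_of_ker_le {G κ : Type*} [Group G] [Field κ] {n : ℕ} [NeZero n]
    (s : G →* rootsOfUnity n κ) (γ : G →* ℂˣ) (ε : rootsOfUnity n κ →* ℂˣ)
    (hε : Function.Injective ε) (h : ∀ g, s g = 1 → γ g = 1) :
    ∃ i < n, ∀ g, γ g = ε (s g) ^ i := by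
  obtain ⟨⟨c, g₀, rfl⟩, hc⟩ := IsCyclic.exists_generator (α := s.range)
  have hgen : ∀ g, ∃ k : ℤ, s g₀ ^ k = s g := by
    intro g
    obtain ⟨k, hk⟩ := hc ⟨s g, g, rfl⟩
    exact ⟨k, congrArg Subtype.val hk⟩
  have hd : orderOf (s g₀) ≤ n := by
    refine orderOf_le_of_pow_eq_one (NeZero.pos n) (Subtype.ext ?_)
    exact (mem_rootsOfUnity n _).mp (s g₀).2
  have hpos : 0 < orderOf (s g₀) := by
    rw [orderOf_pos_iff, isOfFinOrder_iff_pow_eq_one]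
    exact ⟨n, NeZero.pos n, Subtype.ext ((mem_rootsOfUnity n _).mp (s g₀).2)⟩
  have hprim : IsPrimitiveRoot (ε (s g₀)) (orderOf (s g₀)) := by
    have := IsPrimitiveRoot.orderOf (s g₀)
    exact this.map_of_injective hε
  have hγ : γ g₀ ^ orderOf (s g₀) = 1 := by
    rw [← map_pow]
    exact h _ (by rw [map_pow, pow_orderOf_eq_one])
  have : NeZero (orderOf (s g₀)) := ⟨hpos.ne'⟩
  obtain ⟨i, hi, hi'⟩ := (IsPrimitiveRoot.coe_units_iff.mpr hprim).eq_pow_of_pow_eq_one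
    (ξ := (γ g₀ : ℂ)) (by rw [← Units.val_pow_eq_pow_val, hγ, Units.val_one])
  refine ⟨i, hi.trans_le hd, fun g => ?_⟩
  obtain ⟨k, hk⟩ := hgen g
  have hgk : γ g = γ g₀ ^ k := by
    have h1 : γ (g * (g₀ ^ k)⁻¹) = 1 := h _ (by rw [map_mul, map_inv, map_zpow, hk, mul_inv_cancel])
    rw [map_mul, map_inv, map_zpow] at h1
    exact mul_inv_eq_one.mp h1
  have hu : ε (s g₀) ^ i = γ g₀ := Units.ext (by rw [Units.val_pow_eq_pow_val]; exact hi')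
  rw [hgk, ← hk, map_zpow, ← hu, ← zpow_natCast, ← zpow_natCast, ← _root_.zpow_mul,
    ← _root_.zpow_mul, mul_comm]

end TorusCharacters

/-! ### Comparison of the characters for the two groups -/

section Twist

open ValuativeRel Matrix

variable {F : Type*} [Field F] [ValuativeRel F] [TopologicalSpace F]
  [IsNonarchimedeanLocalField F] {n : ℕ} {hn : n ∣ resCard F - 1} {ϖ : Fˣ}

theorem exists_ne_zero_of_isIrreducible {G V : Type*} [Group G] [AddCommGroup V] [Module ℂ V]
    {ρ : Representation ℂ G V} (h : ρ.IsIrreducible) : ∃ v : V, v ≠ 0 := by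
  by_contra! hall
  obtain ⟨X, Y, hXY⟩ := h.exists_pair_ne
  apply hXY
  apply Subrepresentation.toSubmodule_injective
  ext w
  rw [hall w]
  exact ⟨fun _ => Submodule.zero_mem _, fun _ => Submodule.zero_mem _⟩

theorem diagPart_eq_mul {b : Cover F n hn} (h : b ∈ coverB F n hn) (ζ : rootsOfUnity n 𝓀[F]) :
    diagPart b h ζ = (⟨1, ζ⟩ : Cover F n hn) * diagPart b h 1 := by
  ext1
  · rw [Cover.mul_mat, one_mul]
    rfl
  · rw [Cover.mul_root, cocycle_one_left, one_mul, diagPart_root, diagPart_root, one_mul]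

theorem diagEntry_diagPart {b : Cover F n hn} (h : b ∈ coverB F n hn) (ζ : rootsOfUnity n 𝓀[F])
    (h' : diagPart b h ζ ∈ coverB F n hn) (i : Fin 2) :
    diagEntry (diagPart b h ζ).mat h' i = diagEntry b.mat h i := by
  fin_cases i <;> rfl

/-- On a genuine representation, twisting the root of unity scales the character by `ε`. -/
theorem torusChar_twist {T H : Subgroup (Cover F n hn)} (hT : T ≤ coverT F n hn)
    (hH : H ≤ coverK F n hn)
    (hTH : ∀ (b : (coverB F n hn).subgroupOf H) η, diagPart b.1.1 b.2 η ∈ T)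
    {ε : rootsOfUnity n 𝓀[F] →* ℂˣ} {V : Type*} [AddCommGroup V] [Module ℂ V]
    {ρ : Representation ℂ T V} (hρ : ρ.IsIrreducible) (hρε : IsGenuine ε ρ)
    {χ : Subgroup.center T →* ℂˣ} (hχ : HasCentralCharacter ρ χ)
    {χ₀ : torusA T →* ℂˣ} (hχ₀ : Extends χ₀ χ) (η : Fˣ × Fˣ →* rootsOfUnity n 𝓀[F])
    (b : (coverB F n hn).subgroupOf H) :
    torusChar hT hH hTH χ₀ η b =
      (ε (η (diagEntry b.1.1.mat b.2 0, diagEntry b.1.1.mat b.2 1)) : ℂ) *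
        torusChar hT hH hTH χ₀ 1 b := by
  obtain ⟨v, hv⟩ := exists_ne_zero_of_isIrreducible hρ
  obtain ⟨ζ, hζ⟩ : ∃ ζ, ζ = η (diagEntry b.1.1.mat b.2 0, diagEntry b.1.1.mat b.2 1) := ⟨_, rfl⟩
  have hd := hTH b
  have hz : diagPart b.1.1 b.2 ζ = (⟨1, ζ⟩ : Cover F n hn) * diagPart b.1.1 b.2 1 :=
    diagPart_eq_mul b.2 ζ
  have hzT : (⟨1, ζ⟩ : Cover F n hn) ∈ T := by
    rw [← mul_inv_eq_iff_eq_mul.mpr hz]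
    exact mul_mem (hd ζ) (inv_mem (hd 1))
  have hzc : (⟨_, hzT⟩ : T) ∈ Subgroup.center T := by
    rw [Subgroup.mem_center_iff]
    intro y
    apply Subtype.ext
    change y.1 * ⟨1, ζ⟩ = ⟨1, ζ⟩ * y.1
    ext1
    · rw [Cover.mul_mat, Cover.mul_mat, one_mul, mul_one]
    · rw [Cover.mul_root, Cover.mul_root, cocycle_one_left, cocycle_one_right, one_mul, one_mul,
        mul_comm]
  have h1 : (χ ⟨_, hzc⟩ : ℂ) = ε ζ := by
    have h2 := hχ ⟨_, hzc⟩ v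
    have h3 := hρε ⟨_, hzT⟩ rfl v
    exact smul_left_injective ℂ hv (h2.symm.trans h3)
  rw [← hζ, ← h1, ← hχ₀]
  change _ = (χ₀ ⟨⟨_, hzT⟩, center_le_torusA _ hzc⟩ : ℂ) * _
  rw [torusChar, torusChar, ← Units.val_mul, ← map_mul]
  congr 2
  refine Subtype.ext (Subtype.ext ?_)
  change diagPart b.1.1 b.2 (η (diagEntry b.1.1.mat b.2 0, diagEntry b.1.1.mat b.2 1)) =
    (⟨1, ζ⟩ : Cover F n hn) * diagPart b.1.1 b.2 1
  rw [← hz, hζ]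

theorem diagEntry_inv {b : Cover F n hn} (h : b ∈ coverB F n hn) (h1 : b ∈ coverK1 F n hn) :
    diagEntry b.mat h 1 = (diagEntry b.mat h 0)⁻¹ := by
  rw [eq_inv_iff_mul_eq_one, mul_comm]
  exact Units.ext (isUnit_diag (b := ⟨b, h1⟩) h)

theorem hilbertSymbol_diagEntry_one {b : Cover F n hn} (h : b ∈ coverB F n hn)
    (h1 : b ∈ coverK1 F n hn) : hilbertSymbol n hn ϖ (diagEntry b.mat h 1) =
      (hilbertSymbol n hn ϖ (diagEntry b.mat h 0))⁻¹ := by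
  rw [diagEntry_inv h h1, map_inv]

/-- The pairing of a uniformizer with the upper left entry. -/
noncomputable def uniformizerPairing (hn : n ∣ resCard F - 1) (ϖ : Fˣ) :
    (coverB F n hn).subgroupOf (coverK1 F n hn) →* rootsOfUnity n 𝓀[F] where
  toFun b := hilbertSymbol n hn ϖ (diagEntry b.1.1.mat b.2 0)
  map_one' := by
    have : diagEntry (1 : Cover F n hn).mat (one_mem (coverB F n hn)) 0 = 1 := Units.ext rfl
    exact (congrArg _ this).trans (map_one _)
  map_mul' b b' := by
    rw [← map_mul]
    exact congrArg _ (diagEntry_mul (x := b.1.1) (y := b'.1.1) b.2 b'.2 (mul_mem b.2 b'.2) 0)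

/-- The central characters of `ρ` and of a representation of the larger torus containing `ρ`
agree on common central elements. -/
theorem centralCharacter_eq {V V' : Type*} [AddCommGroup V] [Module ℂ V] [AddCommGroup V']
    [Module ℂ V'] {ρ : Representation ℂ (coverT1 F n hn) V} (hρ : ρ.IsIrreducible)
    {ρ' : Representation ℂ (coverT F n hn) V'}
    {χ : Subgroup.center (coverT1 F n hn) →* ℂˣ} (hχ : HasCentralCharacter ρ χ)
    {χ' : Subgroup.center (coverT F n hn) →* ℂˣ} (hχ' : HasCentralCharacter ρ' χ')
    (f : Representation.IntertwiningMap ρ (ρ'.comp (Subgroup.inclusion (coverT1_le hn))))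
    (hf : Function.Injective f) (z : Subgroup.center (coverT1 F n hn))
    (z' : Subgroup.center (coverT F n hn)) (h : z.1.1 = z'.1.1) : (χ z : ℂ) = χ' z' := by
  obtain ⟨v, hv⟩ := exists_ne_zero_of_isIrreducible hρ
  have hv' : f v ≠ 0 := fun h0 => hv (hf (h0.trans (map_zero f).symm))
  have h1 : f (ρ z v) = ρ' z' (f v) := by
    have h2 := LinearMap.congr_fun (f.isIntertwining' z.1) v
    have e : Subgroup.inclusion (coverT1_le hn) z.1 = z'.1 := Subtype.ext h
    change f (ρ z v) = ρ' (Subgroup.inclusion (coverT1_le hn) z.1) (f v) at h2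
    rw [e] at h2
    exact h2
  rw [hχ z v, hχ' z' (f v), map_smul] at h1
  exact smul_left_injective ℂ hv' h1

/-- The quotient of the characters `χ_k` and `χ'_{0,0}` of `B̃ ∩ K̃¹` is trivial where the pairing
with `ϖ` is, as there the diagonal parts are central in both tori. Hence it is a power of that
pairing, and a suitable `χ'_{i,0}` extends `χ_k`. -/
theorem exists_chiGL_eq_chiSL (hn2 : 2 ≤ n) (hϖ : ord ϖ = 1)
    {ε : rootsOfUnity n 𝓀[F] →* ℂˣ} (hε : Function.Injective ε)
    {V V' : Type*} [AddCommGroup V] [Module ℂ V] [AddCommGroup V']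
    [Module ℂ V'] {ρ : Representation ℂ (coverT1 F n hn) V} (hρ : ρ.IsIrreducible)
    {ρ' : Representation ℂ (coverT F n hn) V'} (hρ' : ρ'.IsIrreducible) (hρε : IsGenuine ε ρ')
    {χ : Subgroup.center (coverT1 F n hn) →* ℂˣ} (hχ : HasCentralCharacter ρ χ)
    {χ' : Subgroup.center (coverT F n hn) →* ℂˣ} (hχ' : HasCentralCharacter ρ' χ')
    (f : Representation.IntertwiningMap ρ (ρ'.comp (Subgroup.inclusion (coverT1_le hn))))
    (hf : Function.Injective f)
    {χ₀ : torusA (coverT1 F n hn) →* ℂˣ} (hχ₀ : Extends χ₀ χ)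
    {χ₀' : torusA (coverT F n hn) →* ℂˣ} (hχ₀' : Extends χ₀' χ') (k : ℕ) :
    ∃ i < n, ∀ b, chiGL ϖ χ₀' i 0 (borelIncl b) = chiSL ϖ χ₀ k b := by
  have : NeZero n := ⟨by omega⟩
  -- `χ_k` and `χ'_{0,0}` as homomorphisms to the units
  let X₁ : (coverB F n hn).subgroupOf (coverK1 F n hn) →* ℂˣ :=
    { toFun := fun b => χ₀ ⟨⟨diagPart b.1.1 b.2
          (twistSL hn ϖ k (diagEntry b.1.1.mat b.2 0, diagEntry b.1.1.mat b.2 1)),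
          diagPart_mem_coverT1 _ _ b.1.2 _⟩, mem_torusA (coverT1_le hn) _
          (diagPart_mem_coverK _ b.2 (coverK1_le hn b.1.2) _)⟩
      map_one' := by
        have h := torusChar_mul (coverT1_le hn) (coverK1_le hn)
          (fun b η => diagPart_mem_coverT1 _ b.2 b.1.2 η) χ₀ (twistSL hn ϖ k) 1 1
        rw [mul_one] at h
        exact Units.ext ((mul_eq_left₀ (Units.ne_zero _)).mp h.symm)
      map_mul' := fun b b' => Units.ext (torusChar_mul (coverT1_le hn) (coverK1_le hn)
          (fun b η => diagPart_mem_coverT1 _ b.2 b.1.2 η) χ₀ (twistSL hn ϖ k) b b') }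
  let X₂ : (coverB F n hn).subgroupOf (coverK F n hn) →* ℂˣ :=
    { toFun := fun b => χ₀' ⟨⟨diagPart b.1.1 b.2
          ((1 : Fˣ × Fˣ →* rootsOfUnity n 𝓀[F])
            (diagEntry b.1.1.mat b.2 0, diagEntry b.1.1.mat b.2 1)),
          diagPart_mem_coverT _ _ _⟩, mem_torusA le_rfl _
          (diagPart_mem_coverK _ b.2 b.1.2 _)⟩
      map_one' := by
        have h := torusChar_mul le_rfl le_rfl
          (fun b η => diagPart_mem_coverT _ b.2 η) χ₀' 1 1 1
        rw [mul_one] at h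
        exact Units.ext ((mul_eq_left₀ (Units.ne_zero _)).mp h.symm)
      map_mul' := fun b b' => Units.ext (torusChar_mul le_rfl le_rfl
          (fun b η => diagPart_mem_coverT _ b.2 η) χ₀' 1 b b') }
  obtain ⟨i, hi, h⟩ := exists_pow_eq_of_ker_le (uniformizerPairing hn ϖ)
    (X₁ / X₂.comp borelIncl) ε hε (by
      intro b hb
      have hb0 : hilbertSymbol n hn ϖ (diagEntry b.1.1.mat b.2 0) = 1 := hb
      have hb1 : hilbertSymbol n hn ϖ (diagEntry b.1.1.mat b.2 1) = 1 :=
        (hilbertSymbol_diagEntry_one b.2 b.1.2).trans (inv_eq_one.mpr hb0)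
      have hall : ∀ j, hilbertSymbol n hn ϖ (diagEntry b.1.1.mat b.2 j) = 1 := by
        intro j
        fin_cases j
        · exact hb0
        · exact hb1
      rw [MonoidHom.div_apply, div_eq_one]
      refine Units.ext ?_
      have hK := coverK1_le hn b.1.2
      have c1 := torusChar_eq_of_mem_center (coverT1_le hn) (coverK1_le hn)
        (fun b η => diagPart_mem_coverT1 _ b.2 b.1.2 η) χ₀ (twistSL hn ϖ k) hχ₀ b
        (mem_center_of_hilbertSymbol hϖ (coverT1_le hn) _ (diagPart_mem_coverK _ b.2 hK _)
          fun j => (congrArg _ (diagEntry_diagPart b.2 _ _ j)).trans (hall j))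
      have c2 := torusChar_eq_of_mem_center le_rfl le_rfl
        (fun b η => diagPart_mem_coverT _ b.2 η) χ₀' 1 hχ₀' (borelIncl b)
        (mem_center_of_hilbertSymbol hϖ le_rfl _ (diagPart_mem_coverK _ b.2 hK _)
          fun j => (congrArg _ (diagEntry_diagPart b.2 _ _ j)).trans (hall j))
      refine c1.trans (Eq.trans ?_ c2.symm)
      refine centralCharacter_eq hρ hχ hχ' f hf _ _ ?_
      change diagPart b.1.1 b.2 (hilbertSymbol n hn ϖ (diagEntry b.1.1.mat b.2 0) ^ (2 * k)) =
        diagPart b.1.1 b.2 1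
      rw [hb0, one_pow])
  refine ⟨i, hi, fun b => ?_⟩
  rw [chiGL_eq_torusChar]
  refine (torusChar_twist le_rfl le_rfl (fun b η => diagPart_mem_coverT _ b.2 η) hρ' hρε hχ' hχ₀'
    _ _).trans ?_
  have h1 := congrArg Units.val (div_eq_iff_eq_mul.mp (h b))
  refine Eq.trans ?_ h1.symm
  rw [Units.val_mul]
  refine congrArg₂ (· * ·) (congrArg Units.val ?_) rfl
  change ε ((hilbertSymbol n hn ϖ (diagEntry b.1.1.mat b.2 0) ^ 0)⁻¹ *
    (hilbertSymbol n hn ϖ (diagEntry b.1.1.mat b.2 1) ^ i)⁻¹) =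
    ε (hilbertSymbol n hn ϖ (diagEntry b.1.1.mat b.2 0)) ^ i
  have h2 : hilbertSymbol n hn ϖ (diagEntry b.1.1.mat b.2 1) =
      (hilbertSymbol n hn ϖ (diagEntry b.1.1.mat b.2 0))⁻¹ :=
    hilbertSymbol_diagEntry_one b.2 b.1.2
  rw [h2, pow_zero, inv_one, one_mul, inv_pow, inv_inv, map_pow]

end Twist

/-! ### Restriction of functions from `K̃` to `K̃¹` -/

section Restriction

open ValuativeRel Matrix

variable {F : Type*} [Field F] [ValuativeRel F] [TopologicalSpace F]
  [IsNonarchimedeanLocalField F] {n : ℕ} {hn : n ∣ resCard F - 1} {ϖ : Fˣ} {r : ℕ}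
  {χ : (coverB F n hn).subgroupOf (coverK1 F n hn) → ℂ}
  {χ' : (coverB F n hn).subgroupOf (coverK F n hn) → ℂ}

/-- The inclusion of `K̃¹` in `K̃`. -/
noncomputable def inclK1 : coverK1 F n hn →* coverK F n hn :=
  Subgroup.inclusion (coverK1_le hn)

/-- The element `(diag(det g, 1), 1)` of `B̃ ∩ K̃`. -/
noncomputable def detPart (g : coverK F n hn) : (coverB F n hn).subgroupOf (coverK F n hn) :=
  ⟨⟨⟨mat2 (g.1.mat.det : F) 0 0 1 (det_matrix_ne_zero _), 1⟩, by
    have hd : ord g.1.mat.det = 0 :=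
      valuation_det_of_mem (show g.1.mat ∈ maxCompact F from g.2)
    refine mem_maxCompact (fun i j => ?_) ?_
    · fin_cases i <;> fin_cases j <;> simp [Cover.proj]
      exact ((ord_eq_zero_iff _).mp hd).le
    · rw [ord_eq_zero_iff, det_val]
      simpa [Cover.proj] using (ord_eq_zero_iff _).mp hd⟩, by
    change (mat2 (g.1.mat.det : F) 0 0 1 (det_matrix_ne_zero _)) 1 0 = 0
    rfl⟩

theorem detPart_det (g : coverK F n hn) : (detPart g).1.1.mat.det = g.1.mat.det := by
  ext
  rw [det_val]
  change (g.1.mat.det : F) * 1 - 0 * 0 = _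
  ring

theorem mem_coverK1_iff_det {g : Cover F n hn} (hg : g ∈ coverK F n hn) :
    g ∈ coverK1 F n hn ↔ g.mat.det = 1 :=
  ⟨fun h => h.2, fun h => ⟨hg, h⟩⟩

theorem det_mul_mat (g h : Cover F n hn) : (g * h).mat.det = g.mat.det * h.mat.det :=
  map_mul GeneralLinearGroup.det g.mat h.mat

theorem det_inv_mat (g : Cover F n hn) : (g⁻¹).mat.det = (g.mat.det)⁻¹ :=
  map_inv GeneralLinearGroup.det g.mat

/-- The factor in `K̃¹` of `g = detPart g * g'`. -/
noncomputable def slPart (g : coverK F n hn) : coverK1 F n hn :=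
  ⟨((detPart g : coverK F n hn)⁻¹ * g : coverK F n hn), (mem_coverK1_iff_det
    ((detPart g : coverK F n hn)⁻¹ * g).2).mpr (by
      change ((detPart g).1.1⁻¹ * g.1).mat.det = 1
      rw [det_mul_mat, det_inv_mat, detPart_det, inv_mul_cancel])⟩

theorem detPart_mul_slPart (g : coverK F n hn) :
    (detPart g : coverK F n hn) * inclK1 (slPart g) = g := by
  change (detPart g : coverK F n hn) * ((detPart g : coverK F n hn)⁻¹ * g) = g
  rw [mul_inv_cancel_left]

theorem detPart_mem_level (hϖ : ord ϖ = 1) {j : ℕ} (hj : 1 ≤ j) {u : coverK F n hn}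
    (hu : u ∈ levelSubgroup (coverK F n hn) j) :
    (detPart u : coverK F n hn) ∈ levelSubgroup (coverK F n hn) j := by
  obtain ⟨⟨h00, h01, h10, h11⟩, -⟩ :=
    (mem_congruenceLift_iff hϖ hj _).mp (show u.1 ∈ congruenceLift hn j from hu)
  refine (mem_congruenceLift_iff hϖ hj _).mpr ⟨⟨?_, inPow_zero j, inPow_zero j, ?_⟩, rfl⟩
  · change InPow ϖ j ((u.1.mat.det : F) - 1)
    have v1 := valuation_entry_le u.2 1 1
    have v2 := valuation_entry_le u.2 0 1
    have e : (u.1.mat.det : F) - 1 = (u.1.mat 0 0 - 1) * u.1.mat 1 1 + (u.1.mat 1 1 - 1) -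
        u.1.mat 0 1 * u.1.mat 1 0 := by
      rw [det_val]; ring
    rw [e]
    exact ((h00.mul_right v1).add h11).sub (h10.mul_left v2)
  · change InPow ϖ j ((1 : F) - 1)
    rw [sub_self]
    exact inPow_zero j

theorem slPart_mem_level (hϖ : ord ϖ = 1) {j : ℕ} (hj : 1 ≤ j) {u : coverK F n hn}
    (hu : u ∈ levelSubgroup (coverK F n hn) j) :
    slPart u ∈ levelSubgroup (coverK1 F n hn) j := by
  have h := (levelSubgroup (coverK F n hn) j).mul_mem
    ((levelSubgroup (coverK F n hn) j).inv_mem (detPart_mem_level hϖ hj hu)) hu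
  exact h

/-- Restriction to `K̃¹` does not change the level of a function, as `K_j` is the product of its
elements `diag(d, 1)`, on which `χ'` is trivial, and `K¹_j`. -/
theorem comp_inclK1_mem_iff (hχ : ∀ b, χ' (borelIncl b) = χ b)
    (hϖ : ord ϖ = 1) {j : ℕ} (hj : 1 ≤ j)
    (htriv : ∀ b : (coverB F n hn).subgroupOf (coverK F n hn),
      (b : coverK F n hn) ∈ levelSubgroup (coverK F n hn) j → χ' b = 1)
    {f : coverK F n hn → ℂ}
    (hf : ∀ (b : (coverB F n hn).subgroupOf (coverK F n hn)) (g : coverK F n hn),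
      f (b * g) = χ' b * f g) :
    f ∘ inclK1 ∈ levelFun _ χ (levelSubgroup (coverK1 F n hn) j) ↔
      f ∈ levelFun _ χ' (levelSubgroup (coverK F n hn) j) := by
  constructor
  · intro h
    refine ⟨hf, fun u hu g => ?_⟩
    obtain ⟨w, hw⟩ : ∃ w, w = slPart g := ⟨_, rfl⟩
    rw [← detPart_mul_slPart g, mul_assoc, hf, hf, ← hw]
    congr 1
    obtain ⟨u', hu'⟩ : ∃ u', u' = inclK1 w * u * (inclK1 w)⁻¹ := ⟨_, rfl⟩
    have hu'l : u' ∈ levelSubgroup (coverK F n hn) j := by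
      rw [hu']
      exact (levelSubgroup_normal le_rfl j).conj_mem u hu _
    have e : inclK1 w * u = (detPart u' : coverK F n hn) * inclK1 (slPart u' * w) := by
      rw [map_mul, ← mul_assoc, detPart_mul_slPart, hu', inv_mul_cancel_right]
    rw [e, hf, htriv _ (detPart_mem_level hϖ hj hu'l), one_mul]
    exact levelFun_left_normal (levelSubgroup_normal (coverK1_le hn) j) ⟨_, h⟩
      (slPart_mem_level hϖ hj hu'l) w
  · intro h
    refine ⟨fun b g => ?_, fun u hu g => ?_⟩
    · rw [← hχ b]
      exact hf (borelIncl b) (inclK1 g)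
    · exact h.2 (inclK1 u) hu (inclK1 g)

/-- A function on `K̃¹` which is left equivariant extends to `K̃`. -/
theorem exists_extension (hχ : ∀ b, χ' (borelIncl b) = χ b)
    (hmul : ∀ b b', χ' (b * b') = χ' b * χ' b')
    (hone : χ' 1 = 1) {f : coverK1 F n hn → ℂ}
    (hf : ∀ (b : (coverB F n hn).subgroupOf (coverK1 F n hn)) (g : coverK1 F n hn),
      f (b * g) = χ b * f g) :
    ∃ f' : coverK F n hn → ℂ, f' ∘ inclK1 = f ∧
      ∀ (b : (coverB F n hn).subgroupOf (coverK F n hn)) (g : coverK F n hn),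
        f' (b * g) = χ' b * f' g := by
  refine ⟨fun g => χ' (detPart g) * f (slPart g), ?_, fun b g => ?_⟩
  · ext g
    have hd : detPart (inclK1 g) = 1 := by
      have hdet : g.1.mat.det = 1 := det_eq_one_of_mem g.2
      refine Subtype.ext (Subtype.ext ?_)
      ext1
      · ext i j
        change (mat2 (g.1.mat.det : F) 0 0 1 (det_matrix_ne_zero _)) i j =
          (1 : Matrix (Fin 2) (Fin 2) F) i j
        fin_cases i <;> fin_cases j <;> simp [hdet]
      · rfl
    have hs : slPart (inclK1 g) = g := by
      have h1 := detPart_mul_slPart (inclK1 g)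
      rw [hd] at h1
      have h2 : inclK1 (slPart (inclK1 g)) = inclK1 g := by
        rw [← h1]
        change _ = (1 : coverK F n hn) * _
        rw [one_mul]
        congr 2
      exact Subgroup.inclusion_injective _ h2
    change χ' (detPart (inclK1 g)) * f (slPart (inclK1 g)) = f g
    rw [hd, hs, hone, one_mul]
  · -- the two decompositions of `b g` differ by an element of `B̃ ∩ K̃¹`
    obtain ⟨x, hx⟩ : ∃ x : coverK F n hn, x = (b : coverK F n hn) * g := ⟨_, rfl⟩
    rw [← hx]
    obtain ⟨c, hc⟩ : ∃ c : (coverB F n hn).subgroupOf (coverK1 F n hn),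
        borelIncl c = (detPart x)⁻¹ * b * detPart g := by
      have hK1 : ((detPart x)⁻¹ * b * detPart g).1.1 ∈ coverK1 F n hn := by
        refine (mem_coverK1_iff_det ((detPart x)⁻¹ * b * detPart g).1.2).mpr ?_
        change ((detPart x).1.1⁻¹ * b.1.1 * (detPart g).1.1).mat.det = 1
        have hxd : x.1.mat.det = b.1.1.mat.det * g.1.mat.det := by
          rw [hx]
          exact det_mul_mat _ _
        rw [det_mul_mat, det_mul_mat, det_inv_mat, detPart_det, detPart_det, hxd, mul_assoc,
          inv_mul_cancel]
      exact ⟨⟨⟨_, hK1⟩, ((detPart x)⁻¹ * b * detPart g).2⟩, rfl⟩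
    have hs : slPart x = (c : coverK1 F n hn) * slPart g := by
      have h1 : inclK1 (c : coverK1 F n hn) =
          (detPart x : coverK F n hn)⁻¹ * b * detPart g := congrArg Subtype.val hc
      have h2 : inclK1 (slPart x) = inclK1 ((c : coverK1 F n hn) * slPart g) := by
        have h3 := detPart_mul_slPart x
        have h4 := detPart_mul_slPart g
        rw [map_mul, h1, mul_assoc, h4, mul_assoc, ← hx, eq_inv_mul_iff_mul_eq]
        exact h3
      exact Subgroup.inclusion_injective (coverK1_le hn) h2
    change χ' (detPart x) * f (slPart x) = χ' b * (χ' (detPart g) * f (slPart g))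
    rw [hs, hf, ← hχ, hc, hmul, hmul]
    have h5 : χ' (detPart x) * χ' (detPart x)⁻¹ = 1 := by
      rw [← hmul, mul_inv_cancel, hone]
    linear_combination (χ' b * χ' (detPart g) * f (slPart g)) * h5

/-- Restriction of functions of level `j` from `K̃` to `K̃¹`. -/
noncomputable def resLevel (hχ : ∀ b, χ' (borelIncl b) = χ b)
    (hϖ : ord ϖ = 1) {j : ℕ} (hj : 1 ≤ j)
    (htriv : ∀ b : (coverB F n hn).subgroupOf (coverK F n hn),
      (b : coverK F n hn) ∈ levelSubgroup (coverK F n hn) j → χ' b = 1) :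
    levelFun _ χ' (levelSubgroup (coverK F n hn) j) →ₗ[ℂ]
      levelFun _ χ (levelSubgroup (coverK1 F n hn) j) where
  toFun f := ⟨f.1 ∘ inclK1, (comp_inclK1_mem_iff hχ hϖ hj htriv f.2.1).mpr f.2⟩
  map_add' _ _ := rfl
  map_smul' _ _ := rfl

end Restriction

/-! ### The level quotients -/

section Transfer

variable {H G W W' : Type*} [Group H] [Group G] [AddCommGroup W] [Module ℂ W] [AddCommGroup W']
  [Module ℂ W'] {σ : Representation ℂ H W} {σ' : Representation ℂ G W'} {B : Subgroup H}
  {χ : B → ℂ}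

/-- If the restriction of `σ'` to `H` is `σ`, and the operator `J` comes, up to a scalar, from an
element of `G`, then `σ'` is irreducible. -/
theorem SplitDatum.isIrreducible_of_restrict (D : SplitDatum σ B χ) (ι : H →* G) (A : W' ≃ₗ[ℂ] W)
    (hA : ∀ h w, A (σ' (ι h) w) = σ h (A w)) (x : G) (c : ℂ)
    (hJ : ∀ w, D.J (A w) = c • A (σ' x w)) : σ'.IsIrreducible := by
  have hδ : A.symm D.δ ≠ 0 := fun h => D.δ_ne_zero (by
    rw [← A.apply_symm_apply D.δ, h, map_zero])
  refine { exists_pair_ne := ⟨⊥, ⊤, fun h => hδ ?_⟩, eq_bot_or_eq_top := fun M => ?_ }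
  · have h2 : A.symm D.δ ∈ (⊤ : Subrepresentation σ').toSubmodule := trivial
    rw [← h] at h2
    exact (Submodule.mem_bot ℂ).mp h2
  · by_cases hM : M.toSubmodule = ⊥
    · exact Or.inl (Subrepresentation.toSubmodule_injective hM)
    right
    let M' : Subrepresentation σ :=
      { toSubmodule := M.toSubmodule.map A.toLinearMap
        apply_mem_toSubmodule := by
          rintro h _ ⟨w, hw, rfl⟩
          exact ⟨σ' (ι h) w, M.apply_mem_toSubmodule _ hw, hA h w⟩ }
    have hM' : M'.toSubmodule ≠ ⊥ := by
      obtain ⟨w, hw, hw0⟩ := Submodule.exists_mem_ne_zero_of_ne_bot hM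
      intro hb
      have hAw : A w ∈ M'.toSubmodule := ⟨w, hw, rfl⟩
      rw [hb, Submodule.mem_bot] at hAw
      exact hw0 (A.injective (hAw.trans (map_zero A).symm))
    have htop := D.eq_top_of_stable M' hM' (by
      rintro _ ⟨w, hw, rfl⟩
      change D.J (A w) ∈ _
      rw [hJ]
      exact M'.toSubmodule.smul_mem _ ⟨_, M.apply_mem_toSubmodule _ hw, rfl⟩)
    apply Subrepresentation.toSubmodule_injective
    refine eq_top_iff.mpr fun w _ => ?_
    have hAw : A w ∈ M'.toSubmodule := by rw [htop]; trivial
    obtain ⟨w', hw', h⟩ := hAw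
    rwa [← A.injective h]

theorem SplitDatum.split (D : SplitDatum σ B χ) [FiniteDimensional ℂ W] :
    (∃ Wp Wm : Subrepresentation σ, IsCompl Wp.toSubmodule Wm.toSubmodule ∧
        Wp.toRepresentation.IsIrreducible ∧ Wm.toRepresentation.IsIrreducible) ∧
      ∀ Wp Wm : Subrepresentation σ, IsCompl Wp.toSubmodule Wm.toSubmodule →
        Wp.toRepresentation.IsIrreducible → Wm.toRepresentation.IsIrreducible →
        IsEmpty (Representation.Equiv Wp.toRepresentation Wm.toRepresentation) ∧
        FiniteDimensional ℂ Wp.toSubmodule ∧ FiniteDimensional ℂ Wm.toSubmodule ∧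
        Module.finrank ℂ Wp.toSubmodule = Module.finrank ℂ Wm.toSubmodule := by
  refine ⟨⟨D.piece D.τ, D.piece (-D.τ), D.isCompl_pieces, D.piece_isIrreducible rfl,
    D.piece_isIrreducible (neg_mul_neg _ _)⟩, fun Wp Wm h hp hm => ?_⟩
  have hp0 := SplitDatum.ne_bot_of_isIrreducible hp
  have hm0 := SplitDatum.ne_bot_of_isIrreducible hm
  refine ⟨D.isEmpty_equiv h hp0 hm0, inferInstance, inferInstance, ?_⟩
  obtain ⟨s, -, hs, hs'⟩ := D.eq_piece_of_isCompl h hp0 hm0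
  rw [hs, hs']
  exact D.finrank_piece_eq s

variable {L L' : Type*} [AddCommGroup L] [Module ℂ L] [AddCommGroup L'] [Module ℂ L']

/-- `SplitDatum.isIrreducible_of_restrict` for quotients `π : L → W` and `π' : L' → W'`, the
equivalence of `W'` and `W` being induced by a surjection `res : L' → L`. -/
theorem SplitDatum.restrict (D : SplitDatum σ B χ) (ι : H →* G) {π : L →ₗ[ℂ] W}
    (hπ : Function.Surjective π) {π' : L' →ₗ[ℂ] W'} (hπ' : Function.Surjective π')
    {lam : Representation ℂ H L} {lam' : Representation ℂ G L'}
    (hlam : ∀ h f, π (lam h f) = σ h (π f)) (hlam' : ∀ g f, π' (lam' g f) = σ' g (π' f))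
    (res : L' →ₗ[ℂ] L) (hres : Function.Surjective res)
    (hker : ∀ f, π (res f) = 0 ↔ π' f = 0)
    (hcomm : ∀ h f, res (lam' (ι h) f) = lam h (res f)) (x : G) (c : ℂ)
    (hJ : ∀ f, D.J (π (res f)) = c • π (res (lam' x f))) :
    σ'.IsIrreducible ∧ Nonempty (Representation.Equiv σ (σ'.comp ι)) := by
  let A₀ : W' →ₗ[ℂ] W := descend π' hπ' (π ∘ₗ res) fun f hf => (hker f).mpr hf
  have hA₀ : ∀ f, A₀ (π' f) = π (res f) := descend_apply π' hπ' _ _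
  have hbij : Function.Bijective A₀ := by
    refine ⟨(injective_iff_map_eq_zero A₀).mpr fun w hw => ?_, fun w => ?_⟩
    · obtain ⟨f, rfl⟩ := hπ' w
      rw [hA₀] at hw
      exact (hker f).mp hw
    · obtain ⟨f, rfl⟩ := hπ w
      obtain ⟨f, rfl⟩ := hres f
      exact ⟨π' f, hA₀ f⟩
  let A : W' ≃ₗ[ℂ] W := LinearEquiv.ofBijective A₀ hbij
  have hA : ∀ h w, A (σ' (ι h) w) = σ h (A w) := by
    intro h w
    obtain ⟨f, rfl⟩ := hπ' w
    change A₀ _ = σ h (A₀ _)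
    rw [← hlam', hA₀, hA₀, hcomm, hlam]
  refine ⟨D.isIrreducible_of_restrict ι A hA x c fun w => ?_,
    ⟨(Representation.Equiv.mk (ρ := σ'.comp ι) (σ := σ) A
      fun h => LinearMap.ext fun w => hA h w).symm⟩⟩
  obtain ⟨f, rfl⟩ := hπ' w
  change D.J (A₀ _) = c • A₀ _
  rw [← hlam', hA₀, hA₀, hJ]

end Transfer

section LevelQuotients

open ValuativeRel Matrix

variable {F : Type*} [Field F] [ValuativeRel F] [TopologicalSpace F]
  [IsNonarchimedeanLocalField F] {n : ℕ} {hn : n ∣ resCard F - 1} {ϖ : Fˣ} {r : ℕ}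

theorem two_ne_zero_residue (hq : Odd (resCard F)) : (2 : 𝓀[F]) ≠ 0 := by
  intro h
  have h2 : ringChar 𝓀[F] = 2 := by
    have hd : ringChar 𝓀[F] ∣ 2 := ringChar.dvd (by exact_mod_cast h)
    exact ((Nat.dvd_prime Nat.prime_two).mp hd).resolve_left (CharP.ringChar_ne_one)
  have hc := FiniteField.even_card_of_char_two h2
  rw [resCard, Nat.card_eq_fintype_card, Nat.odd_iff] at hq
  omega

theorem ringChar_ne_two (hq : Odd (resCard F)) : ringChar 𝓀[F] ≠ 2 := by
  intro h
  apply two_ne_zero_residue hq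
  have := ringChar.Nat.cast_ringChar (R := 𝓀[F])
  rw [h] at this
  exact_mod_cast this

/-- The projection from functions of level `r + 1` onto the level quotient. -/
noncomputable def quotProj {H : Subgroup (Cover F n hn)} (hH : H ≤ coverK F n hn)
    (χ : (coverB F n hn).subgroupOf H → ℂ) (r : ℕ) :=
  levelProj ((coverB F n hn).subgroupOf H) χ (levelSubgroup H) (levelSubgroup_anti H)
    (levelSubgroup_normal hH) (r + 1) (r + 1 - 1) (by omega)

section quotProj

variable {H : Subgroup (Cover F n hn)} (hH : H ≤ coverK F n hn)
  (χ : (coverB F n hn).subgroupOf H → ℂ)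

theorem quotProj_surjective : Function.Surjective (quotProj hH χ r) :=
  levelProj_surjective _ _ _ _ _ _ _ _

theorem quotProj_eq_zero_iff (f : levelFun _ χ (levelSubgroup H (r + 1))) :
    quotProj hH χ r f = 0 ↔ f.1 ∈ levelFun _ χ (levelSubgroup H r) :=
  levelProj_eq_zero_iff _ _ _ _ _ _ _ _ f

theorem quotProj_comm (h : H) (f : levelFun _ χ (levelSubgroup H (r + 1))) :
    quotProj hH χ r (levelFunRep _ χ _ (levelSubgroup_normal hH (r + 1)) h f) =
      levelQuotient hH χ (r + 1) h (quotProj hH χ r f) := rfl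

end quotProj

variable {χ : (coverB F n hn).subgroupOf (coverK1 F n hn) → ℂ}
  {χ' : (coverB F n hn).subgroupOf (coverK F n hn) → ℂ}

/-- The level quotient at level `r + 1` has the two-piece structure, with `J` given by conjugation
by `(diag(1, N), 1)` for a nonsquare unit `N`. -/
theorem exists_splitDatum (hq : Odd (resCard F)) (hϖ : ord ϖ = 1) (hr : 1 ≤ r)
    (hχ : IsLevelChar ϖ r χ) :
    ∃ D : SplitDatum (levelQuotient (coverK1_le hn) χ (r + 1))
        ((coverB F n hn).subgroupOf (coverK1 F n hn)) χ,
      ∃ (x : coverK F n hn) (hx : (x : Cover F n hn) ∈ coverB F n hn), ∀ f,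
        D.J (quotProj (coverK1_le hn) χ r f) =
          quotProj (coverK1_le hn) χ r (conjOp hχ hx (r + 1) f) := by
  have := levelSubgroup_finiteIndex (coverK1_le hn) (r + 1)
  obtain ⟨ν, hη⟩ := exists_resQuad_neg_one (ringChar_ne_two hq)
  have hν : ν ≠ 0 := by
    rintro rfl
    rw [resQuad_zero] at hη
    norm_num at hη
  obtain ⟨τ, hτ⟩ := IsAlgClosed.exists_pow_nat_eq
    (resQuad (-1 : 𝓀[F]) * (Fintype.card 𝓀[F] : ℂ)) two_pos
  let L := levelOperators hϖ hr hχ (two_ne_zero_residue hq) (ringChar_ne_two hq) ν hν hη τ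
    (by rw [← sq, hτ])
  exact ⟨L.splitDatum (quotProj (coverK1_le hn) χ r) (quotProj_eq_zero_iff (coverK1_le hn) χ)
    (quotProj_comm (coverK1_le hn) χ) (quotProj_surjective (coverK1_le hn) χ), diagK ν hν,
    diagK_mem ν hν, fun f => LevelOperators.splitDatum_J _ L _ _ _ f⟩

/-- If `χ'` extends `χ`, then the level quotient for `K̃` is irreducible and restricts to the level
quotient for `K̃¹`. -/
theorem levelQuotient_restrict (hq : Odd (resCard F)) (hϖ : ord ϖ = 1) (hr : 1 ≤ r)
    (hχ : IsLevelChar ϖ r χ) (hχ' : IsLevelChar ϖ r χ') (hc : ∀ b, χ' (borelIncl b) = χ b) :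
    (levelQuotient (le_refl (coverK F n hn)) χ' (r + 1)).IsIrreducible ∧
      Nonempty (Representation.Equiv (levelQuotient (coverK1_le hn) χ (r + 1))
        ((levelQuotient (le_refl (coverK F n hn)) χ' (r + 1)).comp
          (Subgroup.inclusion (coverK1_le hn)))) := by
  obtain ⟨D, x, hx, hJ⟩ := exists_splitDatum hq hϖ hr hχ
  have htriv : ∀ b : (coverB F n hn).subgroupOf (coverK F n hn),
      (b : coverK F n hn) ∈ levelSubgroup (coverK F n hn) (r + 1) → χ' b = 1 := fun b hb =>
    hχ'.triv_of_mem hϖ hr b (levelSubgroup_anti _ (Nat.le_succ r) hb)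
  let res := resLevel hc hϖ (Nat.le_add_left 1 r) htriv
  refine D.restrict (inclK1 (hn := hn)) (quotProj_surjective (coverK1_le hn) χ)
    (quotProj_surjective (le_refl (coverK F n hn)) χ') (quotProj_comm (coverK1_le hn) χ)
    (quotProj_comm (le_refl (coverK F n hn)) χ') res (fun f => ?_) (fun f => ?_)
    (fun h f => rfl) x⁻¹ (χ' ⟨x, hx⟩) (fun f => ?_)
  · obtain ⟨f', hf', hl⟩ := exists_extension hc hχ'.mul hχ'.one f.2.1
    have hf'' : f' ∈ levelFun _ χ' (levelSubgroup (coverK F n hn) (r + 1)) := by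
      rw [← comp_inclK1_mem_iff hc hϖ (Nat.le_add_left 1 r) htriv hl, hf']
      exact f.2
    exact ⟨⟨f', hf''⟩, Subtype.ext hf'⟩
  · rw [quotProj_eq_zero_iff, quotProj_eq_zero_iff]
    exact comp_inclK1_mem_iff hc hϖ hr (hχ'.triv_of_mem hϖ hr) f.2.1
  · rw [hJ, ← map_smul]
    refine congrArg _ (Subtype.ext (funext fun g => ?_))
    -- `f (x g x⁻¹) = χ' x * f (g x⁻¹)`
    have h1 := levelFun_left f ⟨x, hx⟩ (inclK1 g * x⁻¹)
    rw [← mul_assoc] at h1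
    exact h1

/-- For a character of level `r`, the level quotient at `r + 1` of `Ind χ` is the direct sum of two
irreducible representations, which in any such decomposition are inequivalent and of the same finite
dimension. -/
theorem levelQuotient_split (hq : Odd (resCard F)) (hϖ : ord ϖ = 1) (hr : 1 ≤ r)
    (hχ : IsLevelChar ϖ r χ) :
    (∃ Wp Wm : Subrepresentation (levelQuotient (coverK1_le hn) χ (r + 1)),
        IsCompl Wp.toSubmodule Wm.toSubmodule ∧
        Wp.toRepresentation.IsIrreducible ∧ Wm.toRepresentation.IsIrreducible) ∧
      ∀ Wp Wm : Subrepresentation (levelQuotient (coverK1_le hn) χ (r + 1)),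
        IsCompl Wp.toSubmodule Wm.toSubmodule →
        Wp.toRepresentation.IsIrreducible → Wm.toRepresentation.IsIrreducible →
        IsEmpty (Representation.Equiv Wp.toRepresentation Wm.toRepresentation) ∧
        FiniteDimensional ℂ Wp.toSubmodule ∧ FiniteDimensional ℂ Wm.toSubmodule ∧
        Module.finrank ℂ Wp.toSubmodule = Module.finrank ℂ Wm.toSubmodule := by
  have := levelSubgroup_finiteIndex (coverK1_le hn) (r + 1)
  have := finiteDimensional_levelFun (B := (coverB F n hn).subgroupOf (coverK1 F n hn)) (χ := χ)
    (levelSubgroup_normal (coverK1_le hn) (r + 1))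
  have := Module.Finite.of_surjective (quotProj (coverK1_le hn) χ r)
    (quotProj_surjective (coverK1_le hn) χ)
  exact (exists_splitDatum hq hϖ hr hχ).choose.split

end LevelQuotients

end Kubota

theorem mainTheorem9 {F : Type*} [Field F] [ValuativeRel F] [TopologicalSpace F]
    [IsNonarchimedeanLocalField F] (hq : Odd (Kubota.resCard F))
    (n : ℕ) (hn2 : 2 ≤ n) (hn : n ∣ Kubota.resCard F - 1)
    (ϖ : Fˣ) (hϖ : Kubota.ord ϖ = 1)
    (ε : rootsOfUnity n (IsLocalRing.ResidueField (ValuativeRel.valuation F).integer) →* ℂˣ)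
    (hε : Function.Injective ε)
    -- `ρ` is a genuine irreducible representation of `T̃¹` with central character `χ`,
    -- primitive mod `m`, and `χ₀` is an extension of `χ` to `A¹`
    {V : Type*} [AddCommGroup V] [Module ℂ V]
    (ρ : Representation ℂ (Kubota.coverT1 F n hn) V) (hρ : ρ.IsIrreducible)
    (hρε : Kubota.IsGenuine ε ρ)
    (χ : Subgroup.center (Kubota.coverT1 F n hn) →* ℂˣ) (hχ : Kubota.HasCentralCharacter ρ χ)
    (m : ℕ) (hm : Kubota.IsPrimitiveMod χ m)
    (χ₀ : Kubota.torusA (Kubota.coverT1 F n hn) →* ℂˣ) (hχ₀ : Kubota.Extends χ₀ χ) :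
    -- for every genuine irreducible `ρ'` of `T̃` with central character `χ'` primitive mod `m`
    -- whose restriction contains `ρ`, each `W̃_{k,l}` is the restriction of some irreducible
    -- `W̃'_{i,j,l}`
    (∀ {V' : Type*} [AddCommGroup V'] [Module ℂ V']
      (ρ' : Representation ℂ (Kubota.coverT F n hn) V') (χ' : Subgroup.center
        (Kubota.coverT F n hn) →* ℂˣ) (χ₀' : Kubota.torusA (Kubota.coverT F n hn) →* ℂˣ),
      ρ'.IsIrreducible → Kubota.IsGenuine ε ρ' → Kubota.HasCentralCharacter ρ' χ' →
      Kubota.IsPrimitiveMod χ' m → Kubota.Extends χ₀' χ' →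
      (∃ f : Representation.IntertwiningMap ρ
        (ρ'.comp (Subgroup.inclusion (Kubota.coverT1_le hn))), Function.Injective f) →
      ∀ k < Kubota.reducedDegree n, ∀ l > m, ∃ i < n, ∃ j < n,
        (Kubota.WGL ϖ χ₀' i j l).IsIrreducible ∧
        Nonempty (Representation.Equiv (Kubota.WSL ϖ χ₀ k l)
          ((Kubota.WGL ϖ χ₀' i j l).comp (Subgroup.inclusion (Kubota.coverK1_le hn))))) ∧
    -- each `W̃_{k,l}` is the direct sum of two inequivalent irreducible constituents, and in
    -- every such decomposition the two constituents have the same finite dimension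
    (∀ k < Kubota.reducedDegree n, ∀ l > m,
      (∃ Wp Wm : Subrepresentation (Kubota.WSL ϖ χ₀ k l),
        IsCompl Wp.toSubmodule Wm.toSubmodule ∧
        Wp.toRepresentation.IsIrreducible ∧ Wm.toRepresentation.IsIrreducible) ∧
      ∀ Wp Wm : Subrepresentation (Kubota.WSL ϖ χ₀ k l),
        IsCompl Wp.toSubmodule Wm.toSubmodule →
        Wp.toRepresentation.IsIrreducible → Wm.toRepresentation.IsIrreducible →
        IsEmpty (Representation.Equiv Wp.toRepresentation Wm.toRepresentation) ∧
        FiniteDimensional ℂ Wp.toSubmodule ∧ FiniteDimensional ℂ Wm.toSubmodule ∧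
        Module.finrank ℂ Wp.toSubmodule = Module.finrank ℂ Wm.toSubmodule) := by
  have hm1 : 1 ≤ m := hm.1.1
  constructor
  · intro V' _ _ ρ' χ' χ₀' hρ' hρε' hχ' hm' hχ₀' hf k _ l hl
    obtain ⟨f, hf⟩ := hf
    obtain ⟨i, hi, hc⟩ :=
      Kubota.exists_chiGL_eq_chiSL hn2 hϖ hε hρ hρ' hρε' hχ hχ' f hf hχ₀ hχ₀' k
    refine ⟨i, hi, 0, by omega, ?_⟩
    cases l with
    | zero => exact absurd hl (Nat.not_lt_zero m)
    | succ r =>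
      exact Kubota.levelQuotient_restrict hq hϖ (by omega)
        (Kubota.isLevelChar_chiSL hϖ hχ₀ hm (by omega) k)
        (Kubota.isLevelChar_chiGL hϖ hχ₀' hm' (by omega) i 0) hc
  · intro k _ l hl
    cases l with
    | zero => exact absurd hl (Nat.not_lt_zero m)
    | succ r =>
      exact Kubota.levelQuotient_split hq hϖ (by omega)
        (Kubota.isLevelChar_chiSL hϖ hχ₀ hm (by omega) k)
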